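/- Let $r:\mathbb{R}\to[0,\infty)$ be bounded, measurable and compactly supported with $\|r\|_{1}=1$. Let $a,c\in\ell^\infty(\mathbb{Z})$ be real sequences with $a(n)\ge\delta>0$ for all $n\in\mathbb{Z}$. Let $(d_n)_{n\in\mathbb{Z}}$ be a sequence with $0\le d_n\le 1$ for all $n$, with $d_0>0$, and with $d_n\ge C|n|^{-\zeta}$ for all $n\ne 0$, where $C>0$ and $\zeta<\tfrac12$ are constants. Put $r_n(x)=d_n^{-1}r(d_n^{-1}x)$, $M_n=\sup\{|E|:E\in\operatorname{supp} r_n\}$ and $\Omega=\prod_{n\in\mathbb{Z}}[c(n)-M_n,\,c(n)+M_n]$, and let $\mu$ be the product probability measure $d\mu(x)=\prod_{n\in\mathbb{Z}}r_n(x_n-c(n))\,dx_n$, which is carried by $\Omega$. For bounded $\omega$, in particular for $\omega\in\Omega$, let $J_\omega$ be the Jacobi operator on $\ell^2(\mathbb{Z})$ given by $$(J_\omega\phi)(n)=a(n)\phi(n+1)+a(n-1)\phi(n-1)+\omega(n)\phi(n).$$ Then for $\mu$-almost every $\omega$ the operator $J_\omega$ has purely pure point spectrum: $J_\omega$ is a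 bounded self-adjoint operator, and for every $\psi\in\ell^2(\mathbb{Z})$ the spectral measure of $J_\omega$ at $\psi$ (the finite Borel measure $\nu$ on $\mathbb{R}$ with $\langle\psi,f(J_\omega)\psi\rangle=\int f\,d\nu$ for all bounded continuous $f:\mathbb{R}\to\mathbb{R}$) is carried by a countable set. -/

import Mathlib

open MeasureTheory
open scoped ENNReal NNReal BoundedContinuousFunction

noncomputable section

namespace RandomJacobi

/-- The Hilbert space `ℓ²(ℤ)` of square-summable complex sequences. -/
abbrev L2Z : Type := lp (fun _ : ℤ => ℂ) 2

/-- The space `ℓ^∞(ℤ)` of bounded real sequences. -/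
abbrev LInftyZ : Type := lp (fun _ : ℤ => ℝ) ∞

/-! ### Jacobi operators -/

theorem memlp_shift (k : ℤ) (φ : L2Z) : Memℓp (fun n : ℤ => φ (n + k)) 2 := by
  have h := (lp.memℓp φ).summable (by norm_num)
  exact memℓp_gen (h.comp_injective (add_left_injective k))

/-- Translation on `ℓ²(ℤ)`: `(shift k φ)(n) = φ(n + k)`. -/
def shift (k : ℤ) : L2Z →L[ℂ] L2Z :=
  LinearMap.mkContinuous
    { toFun := fun φ => ⟨fun n : ℤ => φ (n + k), memlp_shift k φ⟩
      map_add' := fun _ _ => rfl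
      map_smul' := fun z φ => by ext n; simp }
    1 (fun φ => by
      have h2 : 0 < (2 : ℝ≥0∞).toReal := by norm_num
      rw [one_mul]
      refine lp.norm_le_of_tsum_le h2 (norm_nonneg φ) ?_
      rw [lp.norm_rpow_eq_tsum h2 φ]
      exact ((Equiv.addRight k).tsum_eq (fun n : ℤ => ‖φ n‖ ^ (2 : ℝ≥0∞).toReal)).le)

@[simp] theorem shift_apply (k : ℤ) (φ : L2Z) (n : ℤ) : shift k φ n = φ (n + k) := rfl

theorem mul_bound (b : LInftyZ) (φ : L2Z) (n : ℤ) :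
    ‖(b n : ℂ) * φ n‖ ≤ ‖((‖b‖ : ℝ) : ℂ) * φ n‖ := by
  rw [norm_mul, norm_mul, Complex.norm_real, Complex.norm_real, norm_norm]
  exact mul_le_mul_of_nonneg_right (lp.norm_apply_le_norm ENNReal.top_ne_zero b n)
    (norm_nonneg _)

theorem memlp_mul (b : LInftyZ) (φ : L2Z) : Memℓp (fun n : ℤ => (b n : ℂ) * φ n) 2 := by
  have h := (lp.memℓp (((‖b‖ : ℝ) : ℂ) • φ)).summable (by norm_num)
  refine memℓp_gen (h.of_nonneg_of_le (fun n => by positivity) (fun n => ?_))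
  exact Real.rpow_le_rpow (norm_nonneg _) (mul_bound b φ n) (by norm_num)

/-- Multiplication by a bounded real sequence: `(multiplication b φ)(n) = b(n) φ(n)`. -/
def multiplication (b : LInftyZ) : L2Z →L[ℂ] L2Z :=
  LinearMap.mkContinuous
    { toFun := fun φ => ⟨fun n : ℤ => (b n : ℂ) * φ n, memlp_mul b φ⟩
      map_add' := fun φ ψ => by
        ext n
        exact mul_add (b n : ℂ) (φ n) (ψ n)
      map_smul' := fun z φ => by ext n; simp [mul_left_comm] }
    ‖b‖ (fun φ => by
      refine (lp.norm_mono (y := ((‖b‖ : ℝ) : ℂ) • φ) (by norm_num) (mul_bound b φ)).trans ?_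
      rw [norm_smul, Complex.norm_real, norm_norm])

@[simp] theorem multiplication_apply (b : LInftyZ) (φ : L2Z) (n : ℤ) :
    multiplication b φ n = (b n : ℂ) * φ n := rfl

/-- The Jacobi operator on `ℓ²(ℤ)` with off-diagonal sequence `a` and diagonal sequence `b`;
see `jacobi_apply` for the coordinate formula. -/
def jacobi (a b : LInftyZ) : L2Z →L[ℂ] L2Z :=
  multiplication a ∘L shift 1 + shift (-1) ∘L multiplication a + multiplication b

/-- `(Jφ)(n) = a(n) φ(n+1) + a(n-1) φ(n-1) + b(n) φ(n)`. -/
theorem jacobi_apply (a b : LInftyZ) (φ : L2Z) (n : ℤ) :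
    jacobi a b φ n =
      (a n : ℂ) * φ (n + 1) + (a (n - 1) : ℂ) * φ (n - 1) + (b n : ℂ) * φ n := rfl

/-! ### Spectral measures and pure point spectrum -/

/-- `ν` is the spectral measure of the self-adjoint operator `A` at the vector `ψ`:
`ν` is a finite Borel measure on `ℝ` with `⟨ψ, f(A) ψ⟩ = ∫ f dν` for all bounded continuous `f`,
`f(A)` being given by the continuous functional calculus. These identities determine `ν`, see
`IsSpectralMeasure.unique`. -/
def IsSpectralMeasure {H : Type*} [NormedAddCommGroup H] [InnerProductSpace ℂ H]
    [CompleteSpace H] (A : H →L[ℂ] H) (ψ : H) (ν : Measure ℝ) : Prop :=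
  IsFiniteMeasure ν ∧
    ∀ f : ℝ →ᵇ ℝ, inner ℂ ψ (cfc (f : ℝ → ℝ) A ψ) = ((∫ x, f x ∂ν : ℝ) : ℂ)

theorem IsSpectralMeasure.unique {H : Type*} [NormedAddCommGroup H] [InnerProductSpace ℂ H]
    [CompleteSpace H] {A : H →L[ℂ] H} {ψ : H}
    {ν ν' : Measure ℝ}
    (h : IsSpectralMeasure A ψ ν) (h' : IsSpectralMeasure A ψ ν') : ν = ν' := by
  have := h.1
  have := h'.1
  refine ext_of_forall_integral_eq_of_IsFiniteMeasure (fun f => ?_)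
  exact_mod_cast (h.2 f).symm.trans (h'.2 f)

/-- A measure on `ℝ` is pure point if it is carried by a countable set. -/
def IsPurePointMeasure (ν : Measure ℝ) : Prop :=
  ∃ S : Set ℝ, S.Countable ∧ ν Sᶜ = 0

/-- The operator `A` is self-adjoint with purely pure point spectrum: the spectral measure of
every vector is a pure point measure. -/
def HasPurePointSpectrum {H : Type*} [NormedAddCommGroup H] [InnerProductSpace ℂ H]
    [CompleteSpace H] (A : H →L[ℂ] H) : Prop :=
  IsSelfAdjoint A ∧
    ∀ ψ : H, ∃ ν : Measure ℝ, IsSpectralMeasure A ψ ν ∧ IsPurePointMeasure ν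

/-! ### The random potential -/

/-- A bounded, measurable, nonnegative, compactly supported function `r` with `‖r‖₁ = 1`. -/
structure IsSingleSiteDensity (r : ℝ → ℝ) : Prop where
  measurable : Measurable r
  nonneg : ∀ x, 0 ≤ r x
  bounded : ∃ K, ∀ x, r x ≤ K
  hasCompactSupport : HasCompactSupport r
  integral_eq_one : ∫ x, r x = 1

/-- The rescaled density `r_n(x) = d_n⁻¹ r(d_n⁻¹ x)`. -/
def scaledDensity (r : ℝ → ℝ) (d : ℤ → ℝ) (n : ℤ) (x : ℝ) : ℝ :=
  (d n)⁻¹ * r ((d n)⁻¹ * x)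

/-- The law of the potential at site `n`, which has Lebesgue density `x ↦ r_n(x - c(n))`. -/
def siteLaw (r : ℝ → ℝ) (d c : ℤ → ℝ) (n : ℤ) : Measure ℝ :=
  volume.withDensity fun x => ENNReal.ofReal (scaledDensity r d n (x - c n))

/-- The radius `M_n = sup {|E| : E ∈ supp r_n}`. -/
def siteRadius (r : ℝ → ℝ) (d : ℤ → ℝ) (n : ℤ) : ℝ :=
  sSup ((fun E : ℝ => |E|) '' tsupport (scaledDensity r d n))

/-- The space `Ω = ∏ₙ [c(n) - M_n, c(n) + M_n]`. -/
def configurations (r : ℝ → ℝ) (d c : ℤ → ℝ) : Set (ℤ → ℝ) :=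
  Set.univ.pi fun n => Set.Icc (c n - siteRadius r d n) (c n + siteRadius r d n)

/-- The product measure `μ` with `dμ(x) = ∏ₙ r_n(x_n - c(n)) dx_n`. -/
def potentialLaw (r : ℝ → ℝ) (d c : ℤ → ℝ) : Measure (ℤ → ℝ) :=
  Measure.infinitePi (siteLaw r d c)

/-- For positive scales the site laws are probability measures, so that `potentialLaw` is the
genuine product measure. -/
theorem isProbabilityMeasure_siteLaw {r : ℝ → ℝ} (hr : IsSingleSiteDensity r) {d : ℤ → ℝ}
    (hd : ∀ n, 0 < d n) (c : ℤ → ℝ) (n : ℤ) : IsProbabilityMeasure (siteLaw r d c n) := by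
  have hint : Integrable r := by
    by_contra h
    have := hr.integral_eq_one
    rw [integral_undef h] at this
    exact zero_ne_one this
  have hint' : Integrable (fun x => scaledDensity r d n (x - c n)) :=
    ((hint.comp_mul_left' (inv_ne_zero (hd n).ne')).const_mul _).comp_sub_right (c n)
  constructor
  rw [siteLaw, withDensity_apply _ MeasurableSet.univ, setLIntegral_univ,
    ← ofReal_integral_eq_lintegral_ofReal hint'
      (Filter.Eventually.of_forall fun x =>
        mul_nonneg (inv_nonneg.2 (hd n).le) (hr.nonneg _)),
    integral_sub_right_eq_self (fun x => scaledDensity r d n x) (c n)]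
  simp only [scaledDensity]
  rw [integral_const_mul, Measure.integral_comp_mul_left, hr.integral_eq_one, inv_inv,
    abs_of_pos (hd n), smul_eq_mul, mul_one, inv_mul_cancel₀ (hd n).ne', ENNReal.ofReal_one]

theorem isProbabilityMeasure_potentialLaw {r : ℝ → ℝ} (hr : IsSingleSiteDensity r) {d : ℤ → ℝ}
    (hd : ∀ n, 0 < d n) (c : ℤ → ℝ) : IsProbabilityMeasure (potentialLaw r d c) := by
  have := isProbabilityMeasure_siteLaw hr hd c
  unfold potentialLaw
  infer_instance

end RandomJacobi

end

/-! The proof is the Kunz–Souillard method: the expected eigenfunction correlator is summable, and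
summable correlators force pure point spectrum.

For fixed `m`, a rational polynomial `p` with `|p| ≤ 1` on `[-K, K]` has `⟨δ_n, p(J) δ_m⟩` unchanged
when `J` is cut to a box about `m` of radius at least `deg p`. Hence it is bounded by `∑ |φ_i(m)
φ_i(n)|` over a Dirichlet eigenbasis of the box. An eigenfunction with `φ(m) ≠ 0` is `φ(m)` times
ratios of two half-line solutions, which depend on the energy but not on the potential at `m`. Thus
`E` is an eigenvalue exactly when that potential equals an explicit rational function `h(E)`, and
normalization reads `φ(m)² h'(E) = 1`. Integrating over the potential at `m` therefore turns the sum
over eigenvalues into an integral over `E` of the ratio `|u_n / u_0|`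
(`setLIntegral_correlator_le`).

At fixed `E` this ratio is a product along a Riccati recursion, so independence lets the sites of
the ray be integrated out one by one (`lintegral_chainWeight_eq`). Each site acts on functions of
the current ratio by an inversion, which is an `L²` isometry, followed by averaging over translates.
One such step need not contract uniformly, because a function may be nearly translation invariant. A
nearly invariant function has little mass in bounded intervals, however, and the inversion exchanges
a neighbourhood of infinity with a bounded interval. A function and its inversion cannot both be
spread out, so two steps contract by `1 - η / M²` when the densities are at most `M`
(`exists_two_step_contraction`).

Along the first `n` sites `M` is of order `n ^ ζ`, so the expected correlator is at most a power of
`n` times `exp(-c n ^ (1 - 2ζ))`. This is summable because `ζ < 1/2` (`ae_tsum_correlator_ne_top`).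

For the spectral conclusion, let `ν` be the spectral measure of `δ_m` and `g_n` the density with
`⟨δ_n, p(J) δ_m⟩ = ∫ p g_n dν`. By duality the `L¹(ν)` norm of `g_n` is at most the correlator, so
for `ν`-almost every `x` the sequence `(g_n(x))_n` is summable. It solves the eigenvalue equation at
`x`, hence is zero or an eigenvector. A vector `ψ` orthogonal to all eigenvectors then satisfies `∑
g_n(x) conj ψ(n) = 0` almost everywhere, and integration gives `ψ(m) = 0`
(`hasPurePointSpectrum_jacobi_of_correlator`). -/

noncomputable section

namespace RandomJacobi

/-! ### Squared differences of extended nonnegative reals -/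

/-- The squared distance of two extended nonnegative reals. -/
def sqDiff (a b : ℝ≥0∞) : ℝ≥0∞ := (a - b) ^ 2 + (b - a) ^ 2

/-- One of the two truncated differences always vanishes, so this is the usual binomial identity,
written without subtraction so that it survives at `∞`. The exact energy identity
`two_mul_sqNorm_eq` rests on it. -/
theorem sq_add_sq_eq_two_mul_add_sqDiff (a b : ℝ≥0∞) :
    a ^ 2 + b ^ 2 = 2 * (a * b) + sqDiff a b := by
  wlog h : b ≤ a generalizing a b
  · have := this b a (le_of_not_ge h)
    rw [add_comm, this, mul_comm b a, sqDiff, sqDiff, add_comm ((b - a) ^ 2)]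
  rw [sqDiff, tsub_eq_zero_of_le h]
  obtain ⟨c, rfl⟩ := exists_add_of_le h
  rcases eq_or_ne b ∞ with rfl | hb
  · simp
  · rw [ENNReal.add_sub_cancel_left hb]
    ring

theorem ennreal_add_sq_le (a b : ℝ≥0∞) : (a + b) ^ 2 ≤ 2 * (a ^ 2 + b ^ 2) := by
  have h : 2 * (a * b) ≤ a ^ 2 + b ^ 2 := by
    rw [sq_add_sq_eq_two_mul_add_sqDiff]; exact le_self_add
  calc (a + b) ^ 2 = a ^ 2 + b ^ 2 + 2 * (a * b) := by ring
    _ ≤ a ^ 2 + b ^ 2 + (a ^ 2 + b ^ 2) := by gcongr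
    _ = _ := by ring

theorem sqDiff_triangle (a b c : ℝ≥0∞) : sqDiff a c ≤ 2 * (sqDiff a b + sqDiff b c) := by
  have h (x y z : ℝ≥0∞) : (x - z) ^ 2 ≤ 2 * ((x - y) ^ 2 + (y - z) ^ 2) :=
    (pow_le_pow_left' (tsub_le_tsub_add_tsub) 2).trans (ennreal_add_sq_le _ _)
  calc sqDiff a c ≤ 2 * ((a - b) ^ 2 + (b - c) ^ 2) + 2 * ((c - b) ^ 2 + (b - a) ^ 2) :=
        add_le_add (h _ _ _) (h _ _ _)
    _ = _ := by simp only [sqDiff]; ring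

theorem sq_le_two_mul_sqDiff_add (a b : ℝ≥0∞) : a ^ 2 ≤ 2 * (sqDiff a b + b ^ 2) := by
  calc a ^ 2 ≤ ((a - b) + b) ^ 2 := pow_le_pow_left' le_tsub_add 2
    _ ≤ 2 * ((a - b) ^ 2 + b ^ 2) := ennreal_add_sq_le _ _
    _ ≤ _ := by gcongr; exact le_self_add

@[fun_prop]
theorem _root_.Measurable.sqDiff {α : Type*} [MeasurableSpace α] {f g : α → ℝ≥0∞}
    (hf : Measurable f) (hg : Measurable g) : Measurable fun x => sqDiff (f x) (g x) := by
  unfold RandomJacobi.sqDiff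
  fun_prop

/-! ### Translation energy and local mass -/

/-- The squared `L²` norm of a nonnegative function on the line. -/
def sqNorm (f : ℝ → ℝ≥0∞) : ℝ≥0∞ := ∫⁻ x, f x ^ 2

/-- The squared `L²` distance between a function and its translate. -/
def shiftEnergy (f : ℝ → ℝ≥0∞) (w : ℝ) : ℝ≥0∞ := ∫⁻ x, sqDiff (f x) (f (x + w))

theorem shiftEnergy_two_mul {f : ℝ → ℝ≥0∞} (hf : Measurable f) (w : ℝ) :
    shiftEnergy f (2 * w) ≤ 4 * shiftEnergy f w := by
  have h1 : ∫⁻ x, sqDiff (f (x + w)) (f (x + 2 * w)) = shiftEnergy f w := by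
    rw [shiftEnergy, ← lintegral_add_right_eq_self (fun x => sqDiff (f x) (f (x + w))) w]
    simp only [two_mul, add_assoc]
  calc shiftEnergy f (2 * w)
      ≤ ∫⁻ x, 2 * (sqDiff (f x) (f (x + w)) + sqDiff (f (x + w)) (f (x + 2 * w))) :=
        lintegral_mono fun x => sqDiff_triangle _ _ _
    _ = 2 * (shiftEnergy f w + shiftEnergy f w) := by
        rw [lintegral_const_mul _ (by fun_prop), lintegral_add_left (by fun_prop), h1, shiftEnergy]
    _ = _ := by ring

theorem shiftEnergy_two_pow_mul {f : ℝ → ℝ≥0∞} (hf : Measurable f) (w : ℝ) (i : ℕ) :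
    shiftEnergy f (2 ^ i * w) ≤ 4 ^ i * shiftEnergy f w := by
  induction i with
  | zero => simp
  | succ i ih =>
    calc shiftEnergy f (2 ^ (i + 1) * w) = shiftEnergy f (2 * (2 ^ i * w)) := by ring_nf
      _ ≤ 4 * shiftEnergy f (2 ^ i * w) := shiftEnergy_two_mul hf _
      _ ≤ 4 * (4 ^ i * shiftEnergy f w) := by gcongr
      _ = _ := by ring

theorem setLIntegral_sq_le_shift {f : ℝ → ℝ≥0∞} (hf : Measurable f) (I : Set ℝ) (s : ℝ) :
    ∫⁻ x in I, f x ^ 2 ≤ 2 * (shiftEnergy f s + ∫⁻ x in I, f (x + s) ^ 2) := by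
  calc ∫⁻ x in I, f x ^ 2 ≤ ∫⁻ x in I, 2 * (sqDiff (f x) (f (x + s)) + f (x + s) ^ 2) :=
        lintegral_mono fun x => sq_le_two_mul_sqDiff_add _ _
    _ = 2 * ((∫⁻ x in I, sqDiff (f x) (f (x + s))) + ∫⁻ x in I, f (x + s) ^ 2) := by
        rw [lintegral_const_mul _ (by fun_prop), lintegral_add_left (by fun_prop)]
    _ ≤ _ := by gcongr; exact setLIntegral_le_lintegral _ _

/-- Distinct offsets `2 ^ i * W` differ by at least `|W| > ℓ`, so the translated intervals are
disjoint. -/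
theorem sum_setLIntegral_translates_le (f : ℝ → ℝ≥0∞) (c ℓ W : ℝ)
    (hW : ℓ < |W|) (J : ℕ) :
    ∑ e ∈ Finset.range J, ∫⁻ x in Set.Icc c (c + ℓ), f (x + 2 ^ e * W) ^ 2 ≤ sqNorm f := by
  have h1 (s : ℝ) : ∫⁻ x in Set.Icc c (c + ℓ), f (x + s) ^ 2
      = ∫⁻ x in Set.Icc (c + s) (c + s + ℓ), f x ^ 2 := by
    rw [← lintegral_indicator measurableSet_Icc, ← lintegral_indicator measurableSet_Icc,
      
      ← lintegral_add_right_eq_self ((Set.Icc (c + s) (c + s + ℓ)).indicator fun x => f x ^ 2) s]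
    congr 1 with x
    have : x + s ∈ Set.Icc (c + s) (c + s + ℓ) ↔ x ∈ Set.Icc c (c + ℓ) := by
      simp only [Set.mem_Icc]; constructor <;> rintro ⟨h, h'⟩ <;> constructor <;> linarith
    by_cases hx : x ∈ Set.Icc c (c + ℓ)
    · rw [Set.indicator_of_mem hx, Set.indicator_of_mem (this.2 hx)]
    · rw [Set.indicator_of_notMem hx, Set.indicator_of_notMem (mt this.1 hx)]
  simp only [h1]
  rw [← lintegral_biUnion_finset _ (fun _ _ => measurableSet_Icc)]
  · exact setLIntegral_le_lintegral _ _
  · have hlt : ∀ i j : ℕ, i < j → Disjoint (Set.Icc (c + 2 ^ i * W) (c + 2 ^ i * W + ℓ))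
        (Set.Icc (c + 2 ^ j * W) (c + 2 ^ j * W + ℓ)) := by
      intro i j hij
      rw [Set.disjoint_left]
      rintro x ⟨h1, h2⟩ ⟨h3, h4⟩
      have h5 : (1 : ℝ) ≤ 2 ^ j - 2 ^ i := by
        have h6 : (2 : ℝ) ^ (i + 1) ≤ 2 ^ j := pow_le_pow_right₀ (by norm_num) hij
        have h7 : (1 : ℝ) ≤ 2 ^ i := one_le_pow₀ (by norm_num)
        rw [pow_succ] at h6
        linarith
      have h8 : |(2 ^ j - 2 ^ i) * W| ≤ ℓ := by
        rw [abs_le]; constructor <;> nlinarith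
      rw [abs_mul, abs_of_nonneg (by linarith)] at h8
      nlinarith [abs_nonneg W]
    intro i _ j _ hij
    rcases lt_or_gt_of_ne hij with h | h
    · exact hlt i j h
    · exact (hlt j i h).symm

/-- The interval is compared with 16 disjoint translates whose masses add up to at most the total.
Averaging the 16 comparisons leaves the fraction `2 / 16 = 1 / 8`. Doubling offsets keep the energy
cost at most `4 ^ 16`. -/
theorem setLIntegral_sq_le_of_lt {f : ℝ → ℝ≥0∞} (hf : Measurable f) (c ℓ W : ℝ)
    (hW : ℓ < |W|) :
    ∫⁻ x in Set.Icc c (c + ℓ), f x ^ 2 ≤ 2 * 4 ^ 16 * shiftEnergy f W + sqNorm f / 8 := by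
  have h1 : ∑ e ∈ Finset.range 16, ∫⁻ x in Set.Icc c (c + ℓ), f x ^ 2
      ≤ ∑ e ∈ Finset.range 16, 2 * (4 ^ 16 * shiftEnergy f W +
        ∫⁻ x in Set.Icc c (c + ℓ), f (x + 2 ^ e * W) ^ 2) := by
    refine Finset.sum_le_sum fun e he => (setLIntegral_sq_le_shift hf _ (2 ^ e * W)).trans ?_
    gcongr
    refine (shiftEnergy_two_pow_mul hf W e).trans ?_
    gcongr
    · norm_num
    · exact (Finset.mem_range.1 he).le
  rw [← Finset.mul_sum, Finset.sum_add_distrib, Finset.sum_const, Finset.sum_const,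
    Finset.card_range, nsmul_eq_mul, nsmul_eq_mul] at h1
  have h2 := h1.trans (mul_le_mul_right (add_le_add_right
    (sum_setLIntegral_translates_le f c ℓ W hW 16) _) 2)
  have h3 : (16 : ℝ≥0∞) * ∫⁻ x in Set.Icc c (c + ℓ), f x ^ 2
      ≤ 16 * (2 * 4 ^ 16 * shiftEnergy f W + sqNorm f / 8) := by
    refine (by exact_mod_cast h2 : _ ≤ _).trans_eq ?_
    rw [mul_add, mul_add, ENNReal.div_eq_inv_mul, ← mul_assoc 16 8⁻¹,
      show (16 : ℝ≥0∞) * 8⁻¹ = 2 by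
        rw [show (16 : ℝ≥0∞) = 2 * 8 by norm_num, mul_assoc,
          ENNReal.mul_inv_cancel (by norm_num) (by norm_num), mul_one]]
    push_cast
    ring
  exact (ENNReal.mul_le_mul_iff_right (by norm_num) (by norm_num)).1 h3

/-- The mass of `f` in an interval is controlled by one translation energy. -/
theorem setLIntegral_sq_le_shiftEnergy {f : ℝ → ℝ≥0∞} (hf : Measurable f) (c : ℝ) {ℓ w M : ℝ}
    (hℓ : 0 ≤ ℓ) (hM : 1 ≤ M) (hw : 1 / (4 * M) ≤ |w|) :
    ∫⁻ x in Set.Icc c (c + ℓ), f x ^ 2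
      ≤ ENNReal.ofReal (2 * 4 ^ 17 * (1 + 4 * ℓ) ^ 2 * M ^ 2) * shiftEnergy f w
        + sqNorm f / 8 := by
  have hw0 : 0 < |w| := lt_of_lt_of_le (by positivity) hw
  -- The shift `w` is doubled just often enough to exceed the interval length. Since `1 / |w| ≤ 4 *
  -- M`, the factor `2 ^ (n + 1)` is of order `M`, and the energy cost `4 ^ (n + 1)` of order `M ^
  -- 2`.
  obtain ⟨n, hn1, hn2⟩ := exists_nat_pow_near (x := 1 + ℓ / |w|) (y := 2)
    (by have : 0 ≤ ℓ / |w| := by positivity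
        linarith) (by norm_num)
  have hW : ℓ < |2 ^ (n + 1) * w| := by
    rw [abs_mul, abs_of_pos (by positivity : (0 : ℝ) < 2 ^ (n + 1)), ← div_lt_iff₀ hw0]
    linarith
  refine (setLIntegral_sq_le_of_lt hf c ℓ _ hW).trans (add_le_add ?_ le_rfl)
  have h2 : ℓ / |w| ≤ 4 * ℓ * M := by
    rw [div_le_iff₀ hw0]
    have : 1 ≤ |w| * (4 * M) := by rwa [div_le_iff₀ (by positivity)] at hw
    nlinarith
  have h3 : (2 : ℝ) ^ (n + 1) ≤ 2 * ((1 + 4 * ℓ) * M) := by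
    rw [pow_succ]; nlinarith
  have h4 : (4 : ℝ) ^ (n + 1) ≤ 4 * ((1 + 4 * ℓ) ^ 2 * M ^ 2) := by
    calc (4 : ℝ) ^ (n + 1) = (2 ^ (n + 1)) ^ 2 := by rw [← pow_mul, mul_comm, pow_mul]; norm_num
      _ ≤ (2 * ((1 + 4 * ℓ) * M)) ^ 2 := by gcongr
      _ = _ := by ring
  calc 2 * 4 ^ 16 * shiftEnergy f (2 ^ (n + 1) * w)
      ≤ 2 * 4 ^ 16 * (4 ^ (n + 1) * shiftEnergy f w) := by
        gcongr; exact shiftEnergy_two_pow_mul hf w _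
    _ = ENNReal.ofReal (2 * 4 ^ 16 * 4 ^ (n + 1)) * shiftEnergy f w := by
        rw [ENNReal.ofReal_mul (by positivity), ENNReal.ofReal_mul (by positivity),
          ENNReal.ofReal_pow (by positivity), ENNReal.ofReal_pow (by positivity)]
        norm_num [mul_assoc]
    _ ≤ _ := by
        gcongr ENNReal.ofReal ?_ * _
        nlinarith

/-! ### Averaging over a random site -/

/-- The average of `f` over the reflected and translated random variable `e - y - t`. -/
def siteAverage (κ : Measure ℝ) (e : ℝ) (f : ℝ → ℝ≥0∞) (t : ℝ) : ℝ≥0∞ :=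
  ∫⁻ y, f (e - y - t) ∂κ

@[fun_prop]
theorem measurable_siteAverage (κ : Measure ℝ) [SFinite κ] (e : ℝ) {f : ℝ → ℝ≥0∞}
    (hf : Measurable f) : Measurable (siteAverage κ e f) := by
  unfold siteAverage
  exact Measurable.lintegral_prod_right' (f := fun p : ℝ × ℝ => f (e - p.2 - p.1)) (by fun_prop)

/-- The average translation energy over the differences of two independent random sites. -/
def pairEnergy (κ : Measure ℝ) (f : ℝ → ℝ≥0∞) : ℝ≥0∞ :=
  ∫⁻ y, ∫⁻ y', shiftEnergy f (y - y') ∂κ ∂κ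

theorem lintegral_reflect (f : ℝ → ℝ≥0∞) (e : ℝ) : ∫⁻ t, f (e - t) = ∫⁻ t, f t :=
  lintegral_sub_left_eq_self f e

/-- This is the variance identity `2 E[X²] = 2 (E X)² + E |X - X'|²` for an independent copy `X'`,
taken at `X = f (e - y - t)` and integrated over `t`. The norm lost by averaging is thus exactly
half the pair energy. -/
theorem two_mul_sqNorm_eq (κ : Measure ℝ) [IsProbabilityMeasure κ] (e : ℝ) {f : ℝ → ℝ≥0∞}
    (hf : Measurable f) :
    2 * sqNorm f = 2 * sqNorm (siteAverage κ e f) + pairEnergy κ f := by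
  have h1 (t : ℝ) : 2 * ∫⁻ y, f (e - y - t) ^ 2 ∂κ
      = 2 * siteAverage κ e f t ^ 2
        + ∫⁻ y, ∫⁻ y', sqDiff (f (e - y - t)) (f (e - y' - t)) ∂κ ∂κ := by
    have hm : Measurable fun p : ℝ × ℝ => sqDiff (f (e - p.1 - t)) (f (e - p.2 - t)) := by
      fun_prop
    have h2 : ∫⁻ y, ∫⁻ y', (f (e - y - t) ^ 2 + f (e - y' - t) ^ 2) ∂κ ∂κ
        = ∫⁻ y, ∫⁻ y', (2 * (f (e - y - t) * f (e - y' - t))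
          + sqDiff (f (e - y - t)) (f (e - y' - t))) ∂κ ∂κ := by
      simp only [sq_add_sq_eq_two_mul_add_sqDiff]
    have h3 (y : ℝ) : ∫⁻ y', (f (e - y - t) ^ 2 + f (e - y' - t) ^ 2) ∂κ
        = f (e - y - t) ^ 2 + ∫⁻ y', f (e - y' - t) ^ 2 ∂κ := by
      rw [lintegral_add_left (by fun_prop)]
      simp
    have h4 (y : ℝ) : ∫⁻ y', (2 * (f (e - y - t) * f (e - y' - t))
          + sqDiff (f (e - y - t)) (f (e - y' - t))) ∂κ
        = 2 * (f (e - y - t) * siteAverage κ e f t)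
          + ∫⁻ y', sqDiff (f (e - y - t)) (f (e - y' - t)) ∂κ := by
      rw [lintegral_add_left (by fun_prop), lintegral_const_mul _ (by fun_prop),
        lintegral_const_mul _ (by fun_prop), siteAverage]
    simp only [h3, h4] at h2
    rw [lintegral_add_left (by fun_prop), lintegral_add_left (by fun_prop),
      lintegral_const_mul _ (by fun_prop), lintegral_mul_const _ (by fun_prop)] at h2
    simp only [lintegral_const, measure_univ, mul_one] at h2
    rw [two_mul, h2, ← siteAverage, sq]
  have h5 : ∫⁻ t, ∫⁻ y, f (e - y - t) ^ 2 ∂κ = sqNorm f := by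
    rw [lintegral_lintegral_swap (by fun_prop)]
    have (y : ℝ) : ∫⁻ t, f (e - y - t) ^ 2 = sqNorm f :=
      lintegral_reflect (fun x => f x ^ 2) (e - y)
    simp [this]
  have h6 : ∫⁻ t, ∫⁻ y, ∫⁻ y', sqDiff (f (e - y - t)) (f (e - y' - t)) ∂κ ∂κ
      = pairEnergy κ f := by
    rw [lintegral_lintegral_swap (by
      refine Measurable.aemeasurable ?_
      refine Measurable.lintegral_prod_right'
        (f := fun q : (ℝ × ℝ) × ℝ => sqDiff (f (e - q.1.2 - q.1.1)) (f (e - q.2 - q.1.1))) ?_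
      fun_prop)]
    refine lintegral_congr fun y => ?_
    rw [lintegral_lintegral_swap (by fun_prop)]
    refine lintegral_congr fun y' => ?_
    rw [shiftEnergy, ← lintegral_reflect (fun x => sqDiff (f x) (f (x + (y - y')))) (e - y)]
    refine lintegral_congr fun t => ?_
    rw [show e - y - t + (y - y') = e - y' - t by ring]
  rw [← h5, ← lintegral_const_mul _ (Measurable.lintegral_prod_right'
    (f := fun p : ℝ × ℝ => f (e - p.2 - p.1) ^ 2) (by fun_prop))]
  simp only [h1]
  rw [lintegral_add_left (by fun_prop), lintegral_const_mul _ (by fun_prop), h6, sqNorm]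

theorem sqNorm_siteAverage_le (κ : Measure ℝ) [IsProbabilityMeasure κ] (e : ℝ)
    {f : ℝ → ℝ≥0∞} (hf : Measurable f) : sqNorm (siteAverage κ e f) ≤ sqNorm f := by
  have h : 2 * sqNorm (siteAverage κ e f) ≤ 2 * sqNorm f := by
    rw [two_mul_sqNorm_eq κ e hf]; exact le_self_add
  exact (ENNReal.mul_le_mul_iff_right (by norm_num) (by norm_num)).1 h

theorem siteAverage_sq_le_lintegral (κ : Measure ℝ) [IsProbabilityMeasure κ] (e : ℝ)
    {f : ℝ → ℝ≥0∞} (hf : Measurable f) (t : ℝ) :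
    siteAverage κ e f t ^ 2 ≤ ∫⁻ y, f (e - y - t) ^ 2 ∂κ := by
  have h := ENNReal.lintegral_mul_le_Lp_mul_Lq κ (p := 2) (q := 2)
    ((Real.holderConjugate_iff).2 (by norm_num)) (f := fun y => f (e - y - t)) (g := fun _ => 1)
    (by fun_prop) (by fun_prop)
  simp only [Pi.mul_apply, mul_one, ENNReal.one_rpow, lintegral_const, measure_univ] at h
  calc siteAverage κ e f t ^ 2 ≤ ((∫⁻ y, f (e - y - t) ^ (2 : ℝ) ∂κ) ^ (1 / 2 : ℝ)) ^ 2 :=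
        pow_le_pow_left' h 2
    _ = ∫⁻ y, f (e - y - t) ^ 2 ∂κ := by
        rw [← ENNReal.rpow_natCast, ← ENNReal.rpow_mul]
        norm_num

/-- A bounded density of the random site gives a pointwise bound on averages. -/
theorem siteAverage_sq_le {κ : Measure ℝ} [IsProbabilityMeasure κ] {M : ℝ≥0∞}
    (hκ : κ ≤ M • volume) (e : ℝ) {f : ℝ → ℝ≥0∞} (hf : Measurable f) (t : ℝ) :
    siteAverage κ e f t ^ 2 ≤ M * sqNorm f := by
  refine (siteAverage_sq_le_lintegral κ e hf t).trans ?_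
  calc ∫⁻ y, f (e - y - t) ^ 2 ∂κ ≤ ∫⁻ y, f (e - y - t) ^ 2 ∂(M • volume) :=
        lintegral_mono' hκ le_rfl
    _ = M * ∫⁻ y, f ((e - t) - y) ^ 2 := by
        rw [lintegral_smul_measure, smul_eq_mul]
        congr 2 with y
        ring_nf
    _ = _ := by rw [lintegral_reflect (fun x => f x ^ 2), sqNorm]

/-- The excluded interval has length `1 / (2 * M)`, hence mass at most `1 / 2` under a density
bounded by `M`. -/
theorem half_le_measure_far {κ : Measure ℝ} [IsProbabilityMeasure κ] {M : ℝ} (hM : 1 ≤ M)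
    (hκ : κ ≤ ENNReal.ofReal M • volume) (y : ℝ) :
    1 / 2 ≤ κ {y' | 1 / (4 * M) ≤ |y - y'|} := by
  have h1 : κ {y' | 1 / (4 * M) ≤ |y - y'|}ᶜ ≤ 1 / 2 := by
    have hsub : {y' | 1 / (4 * M) ≤ |y - y'|}ᶜ
        ⊆ Set.Icc (y - 1 / (4 * M)) (y + 1 / (4 * M)) := by
      intro y' hy'
      have hy' : ¬ 1 / (4 * M) ≤ |y - y'| := hy'
      rw [not_le, abs_lt] at hy'
      constructor <;> linarith [hy'.1, hy'.2]
    calc _ ≤ κ (Set.Icc (y - 1 / (4 * M)) (y + 1 / (4 * M))) := measure_mono hsub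
      _ ≤ (ENNReal.ofReal M • volume) (Set.Icc (y - 1 / (4 * M)) (y + 1 / (4 * M))) := hκ _
      _ = ENNReal.ofReal (1 / 2) := by
        rw [Measure.smul_apply, Real.volume_Icc, smul_eq_mul, ← ENNReal.ofReal_mul (by linarith)]
        congr 1
        field_simp
        ring
      _ = 1 / 2 := by
        rw [ENNReal.ofReal_div_of_pos (by norm_num)]; simp
  have hmeas : MeasurableSet {y' | 1 / (4 * M) ≤ |y - y'|} :=
    measurableSet_le measurable_const (by fun_prop)
  have h2 := prob_add_prob_compl (μ := κ) hmeas
  have h3 : (1 : ℝ≥0∞) ≤ κ {y' | 1 / (4 * M) ≤ |y - y'|} + 1 / 2 := by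
    exact h2.symm.le.trans (add_le_add le_rfl h1)
  have h4 : (1 : ℝ≥0∞) - 1 / 2 = 1 / 2 := by norm_num
  rw [← h4]
  exact tsub_le_iff_right.2 h3

/-- Two independent sites are at distance at least `1 / (4 * M)` with probability at least one half.
The bound by a single shift energy is averaged over that event, at the cost of a factor two. -/
theorem setLIntegral_sq_le_pairEnergy {κ : Measure ℝ} [IsProbabilityMeasure κ] {M ℓ : ℝ}
    (hM : 1 ≤ M) (hℓ : 0 ≤ ℓ) (hκ : κ ≤ ENNReal.ofReal M • volume) {f : ℝ → ℝ≥0∞}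
    (hf : Measurable f) (c : ℝ) :
    ∫⁻ x in Set.Icc c (c + ℓ), f x ^ 2
      ≤ ENNReal.ofReal (4 ^ 18 * (1 + 4 * ℓ) ^ 2 * M ^ 2) * pairEnergy κ f + sqNorm f / 4 := by
  set m := ∫⁻ x in Set.Icc c (c + ℓ), f x ^ 2
  set C := ENNReal.ofReal (2 * 4 ^ 17 * (1 + 4 * ℓ) ^ 2 * M ^ 2)
  have h1 (y : ℝ) : m * (1 / 2) ≤ ∫⁻ y', (C * shiftEnergy f (y - y') + sqNorm f / 8) ∂κ := by
    have hmeas : MeasurableSet {y' | 1 / (4 * M) ≤ |y - y'|} :=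
      measurableSet_le measurable_const (by fun_prop)
    calc m * (1 / 2) ≤ m * κ {y' | 1 / (4 * M) ≤ |y - y'|} := by
          gcongr; exact half_le_measure_far hM hκ y
      _ = ∫⁻ y' in {y' | 1 / (4 * M) ≤ |y - y'|}, m ∂κ := by rw [setLIntegral_const]
      _ ≤ ∫⁻ y' in {y' | 1 / (4 * M) ≤ |y - y'|},
            (C * shiftEnergy f (y - y') + sqNorm f / 8) ∂κ :=
          setLIntegral_mono' hmeas fun y' hy' =>
            setLIntegral_sq_le_shiftEnergy hf c hℓ hM hy'
      _ ≤ _ := setLIntegral_le_lintegral _ _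
  have hme : Measurable (shiftEnergy f) := by
    unfold shiftEnergy
    exact Measurable.lintegral_prod_right' (f := fun p : ℝ × ℝ => sqDiff (f p.2) (f (p.2 + p.1)))
      (by fun_prop)
  have hme' : Measurable fun y => ∫⁻ y', shiftEnergy f (y - y') ∂κ :=
    Measurable.lintegral_prod_right' (f := fun p : ℝ × ℝ => shiftEnergy f (p.1 - p.2))
      (by fun_prop)
  have h2 : m * (1 / 2) ≤ C * pairEnergy κ f + sqNorm f / 8 := by
    calc m * (1 / 2) = ∫⁻ y, m * (1 / 2) ∂κ := by simp
      _ ≤ ∫⁻ y, ∫⁻ y', (C * shiftEnergy f (y - y') + sqNorm f / 8) ∂κ ∂κ := lintegral_mono h1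
      _ = _ := by
        have (y : ℝ) : ∫⁻ y', (C * shiftEnergy f (y - y') + sqNorm f / 8) ∂κ
            = C * ∫⁻ y', shiftEnergy f (y - y') ∂κ + sqNorm f / 8 := by
          rw [lintegral_add_left (by fun_prop), lintegral_const_mul _ (by fun_prop)]
          simp
        simp only [this]
        rw [lintegral_add_left (by fun_prop), lintegral_const_mul _ (by fun_prop), pairEnergy]
        simp
  have h3 : m = 2 * (m * (1 / 2)) := by
    rw [mul_comm m, ← mul_assoc, one_div, ENNReal.mul_inv_cancel (by norm_num) (by norm_num),
      one_mul]
  rw [h3]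
  calc 2 * (m * (1 / 2)) ≤ 2 * (C * pairEnergy κ f + sqNorm f / 8) := by gcongr
    _ = (ENNReal.ofReal 2 * C) * pairEnergy κ f + sqNorm f * (2 * 8⁻¹) := by
        rw [ENNReal.div_eq_inv_mul]; norm_num; ring
    _ = _ := by
        rw [← ENNReal.ofReal_mul (by norm_num), ENNReal.div_eq_inv_mul, mul_comm (sqNorm f),
          show (8 : ℝ≥0∞) = 2 * 4 by norm_num, ENNReal.mul_inv (by norm_num) (by norm_num),
          ← mul_assoc 2 2⁻¹, ENNReal.mul_inv_cancel (by norm_num) (by norm_num), one_mul,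
          show 2 * (2 * 4 ^ 17 * (1 + 4 * ℓ) ^ 2 * M ^ 2) = 4 ^ 18 * (1 + 4 * ℓ) ^ 2 * M ^ 2 by
            ring]

/-! ### Inversion -/

/-- The `L²`-isometric action of the inversion `z ↦ α² / z`. -/
def inversion (α : ℝ) (f : ℝ → ℝ≥0∞) (z : ℝ) : ℝ≥0∞ :=
  ENNReal.ofReal |α / z| * f (α ^ 2 / z)

@[fun_prop]
theorem measurable_inversion (α : ℝ) {f : ℝ → ℝ≥0∞} (hf : Measurable f) :
    Measurable (inversion α f) := by
  unfold inversion
  fun_prop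

/-- The Jacobian of `z ↦ α ^ 2 / z` is `|α / z| ^ 2` in absolute value, the square of the weight in
`inversion`. -/
theorem setLIntegral_inversion_sq {α : ℝ} (hα : 0 < α) (f : ℝ → ℝ≥0∞) {s : Set ℝ}
    (hs : MeasurableSet s) (h0 : (0 : ℝ) ∉ s) :
    ∫⁻ z in s, inversion α f z ^ 2 = ∫⁻ x in (fun z => α ^ 2 / z) '' s, f x ^ 2 := by
  have hne {z : ℝ} (hz : z ∈ s) : z ≠ 0 := fun h => h0 (h ▸ hz)
  rw [lintegral_image_eq_lintegral_abs_deriv_mul hs (f' := fun z => -(α ^ 2) / z ^ 2)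
    (fun z hz => ?_) (fun z hz w hw h => ?_) (fun x => f x ^ 2)]
  · refine setLIntegral_congr_fun hs fun z hz => ?_
    have h1 : |-(α ^ 2) / z ^ 2| = |α / z| ^ 2 := by
      rw [abs_div, abs_neg, abs_div, div_pow, abs_pow, abs_pow]
    simp only [inversion]
    rw [h1, mul_pow, ENNReal.ofReal_pow (abs_nonneg _)]
  · have h := ((hasDerivAt_inv (hne hz)).const_mul (α ^ 2)).hasDerivWithinAt (s := s)
    refine h.congr_deriv ?_ |>.congr (fun y _ => ?_) ?_
    · ring
    · rw [div_eq_mul_inv]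
    · rw [div_eq_mul_inv]
  · have hz := hne hz
    have hw := hne hw
    have hα' := hα.ne'
    have h : α ^ 2 / z = α ^ 2 / w := h
    field_simp at h
    exact h.symm

theorem sqNorm_eq_setLIntegral_compl_zero (f : ℝ → ℝ≥0∞) :
    sqNorm f = ∫⁻ x in {(0 : ℝ)}ᶜ, f x ^ 2 := by
  rw [sqNorm, Measure.restrict_eq_self_of_ae_mem]
  exact compl_mem_ae_iff.2 (measure_singleton 0)

theorem sqNorm_inversion {α : ℝ} (hα : 0 < α) (f : ℝ → ℝ≥0∞) :
    sqNorm (inversion α f) = sqNorm f := by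
  rw [sqNorm_eq_setLIntegral_compl_zero, sqNorm_eq_setLIntegral_compl_zero,
    setLIntegral_inversion_sq hα f (measurableSet_singleton 0).compl (by simp)]
  congr 2
  ext x
  simp only [Set.mem_image, Set.mem_compl_iff, Set.mem_singleton_iff]
  have hα' := hα.ne'
  constructor
  · rintro ⟨z, hz, rfl⟩
    positivity
  · intro hx
    exact ⟨α ^ 2 / x, by positivity, by field_simp⟩

/-- If `|x| > B ≥ α` then `|α ^ 2 / x| ≤ B`: the inversion carries the mass near infinity into a
bounded interval, where translation energy controls it. -/
theorem setLIntegral_compl_sq_le_inversion {α B : ℝ} (hα : 0 < α) (hαB : α ≤ B)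
    (f : ℝ → ℝ≥0∞) :
    ∫⁻ x in (Set.Icc (-B) B)ᶜ, f x ^ 2 ≤ ∫⁻ z in Set.Icc (-B) B, inversion α f z ^ 2 := by
  calc ∫⁻ x in (Set.Icc (-B) B)ᶜ, f x ^ 2
      ≤ ∫⁻ x in (fun z => α ^ 2 / z) '' (Set.Icc (-B) B \ {0}), f x ^ 2 := by
        refine lintegral_mono_set fun x hx => ?_
        have hB : B < |x| := by
          by_contra h
          exact hx (abs_le.1 (not_lt.1 h))
        have hx0 : x ≠ 0 := by
          rintro rfl
          rw [abs_zero] at hB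
          linarith
        have hα' := hα.ne'
        refine ⟨α ^ 2 / x, ⟨abs_le.1 ?_, ?_⟩, by field_simp⟩
        · rw [abs_div, abs_of_pos (by positivity : 0 < α ^ 2), div_le_iff₀ (by linarith)]
          nlinarith
        · simp [hα', hx0]
    _ = ∫⁻ z in Set.Icc (-B) B \ {0}, inversion α f z ^ 2 :=
        (setLIntegral_inversion_sq hα f (measurableSet_Icc.diff (measurableSet_singleton 0))
          (by simp)).symm
    _ ≤ _ := lintegral_mono_set Set.sdiff_subset

/-! ### The transfer step and its two-step contraction -/

/-- One step of the transfer recursion: inversion followed by averaging over a random site. -/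
def transferStep (κ : Measure ℝ) (α e : ℝ) (f : ℝ → ℝ≥0∞) : ℝ → ℝ≥0∞ :=
  siteAverage κ e (inversion α f)

@[fun_prop]
theorem measurable_transferStep (κ : Measure ℝ) [SFinite κ] (α e : ℝ) {f : ℝ → ℝ≥0∞}
    (hf : Measurable f) : Measurable (transferStep κ α e f) := by
  unfold transferStep
  fun_prop

theorem sqNorm_transferStep_le (κ : Measure ℝ) [IsProbabilityMeasure κ] {α : ℝ} (hα : 0 < α)
    (e : ℝ) {f : ℝ → ℝ≥0∞} (hf : Measurable f) :
    sqNorm (transferStep κ α e f) ≤ sqNorm f :=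
  (sqNorm_siteAverage_le κ e (by fun_prop)).trans_eq (sqNorm_inversion hα f)

/-- By Cauchy–Schwarz the mass of the average is at most the average mass of `f` on reflected and
translated intervals. The bound of `setLIntegral_sq_le_pairEnergy` does not depend on the position
of the interval. -/
theorem setLIntegral_siteAverage_sq_le {κ : Measure ℝ} [IsProbabilityMeasure κ] {M ℓ : ℝ}
    (hM : 1 ≤ M) (hℓ : 0 ≤ ℓ) (hκ : κ ≤ ENNReal.ofReal M • volume) (e : ℝ) {f : ℝ → ℝ≥0∞}
    (hf : Measurable f) (c : ℝ) :
    ∫⁻ x in Set.Icc c (c + ℓ), siteAverage κ e f x ^ 2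
      ≤ ENNReal.ofReal (4 ^ 18 * (1 + 4 * ℓ) ^ 2 * M ^ 2) * pairEnergy κ f + sqNorm f / 4 := by
  calc ∫⁻ t in Set.Icc c (c + ℓ), siteAverage κ e f t ^ 2
      ≤ ∫⁻ t in Set.Icc c (c + ℓ), ∫⁻ y, f (e - y - t) ^ 2 ∂κ :=
        lintegral_mono fun t => siteAverage_sq_le_lintegral κ e hf t
    _ = ∫⁻ y, (∫⁻ t in Set.Icc c (c + ℓ), f (e - y - t) ^ 2) ∂κ :=
        lintegral_lintegral_swap (f := fun t y => f (e - y - t) ^ 2) (by fun_prop)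
    _ ≤ ∫⁻ _, (ENNReal.ofReal (4 ^ 18 * (1 + 4 * ℓ) ^ 2 * M ^ 2) * pairEnergy κ f
          + sqNorm f / 4) ∂κ := by
        refine lintegral_mono fun y => ?_
        refine le_trans (le_of_eq ?_)
          (setLIntegral_sq_le_pairEnergy hM hℓ hκ hf (e - y - (c + ℓ)))
        rw [← lintegral_indicator measurableSet_Icc, ← lintegral_indicator measurableSet_Icc,
          ← lintegral_reflect ((Set.Icc (e - y - (c + ℓ)) (e - y - (c + ℓ) + ℓ)).indicator
            fun x => f x ^ 2) (e - y)]
        congr 1 with t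
        have : e - y - t ∈ Set.Icc (e - y - (c + ℓ)) (e - y - (c + ℓ) + ℓ)
            ↔ t ∈ Set.Icc c (c + ℓ) := by
          simp only [Set.mem_Icc]; constructor <;> rintro ⟨h, h'⟩ <;> constructor <;> linarith
        by_cases ht : t ∈ Set.Icc c (c + ℓ)
        · rw [Set.indicator_of_mem ht, Set.indicator_of_mem (this.2 ht)]
        · rw [Set.indicator_of_notMem ht, Set.indicator_of_notMem (mt this.1 ht)]
    _ = _ := by simp

/-- Two consecutive transfer steps contract the `L²` norm: a function and its inversion cannot
both be almost invariant under translations. -/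
theorem exists_two_step_contraction (B : ℝ) (hB : 0 < B) :
    ∃ η : ℝ, 0 < η ∧ η ≤ 1 / 2 ∧ ∀ (M : ℝ) (κ κ' : Measure ℝ) (α α' e e' : ℝ) (f : ℝ → ℝ≥0∞),
      1 ≤ M → IsProbabilityMeasure κ → IsProbabilityMeasure κ' →
      κ ≤ ENNReal.ofReal M • volume → κ' ≤ ENNReal.ofReal M • volume →
      0 < α → 0 < α' → α' ≤ B → Measurable f → sqNorm f ≠ ∞ →
      sqNorm (transferStep κ' α' e' (transferStep κ α e f))
        ≤ ENNReal.ofReal (1 - η / M ^ 2) * sqNorm f := by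
  set C : ℝ := 4 ^ 18 * (1 + 4 * (2 * B)) ^ 2 with hC
  have hC0 : 0 < C := by positivity
  -- The two pair energies satisfy `F - H = (p1 + p2) / 2`, where `F` and `H` are the squared norms
  -- before and after both steps. The estimate `e3` will give `F ≤ (2 * C + 1) * M ^ 2 * (p1 + p2)`;
  -- combining the two produces this constant.
  refine ⟨1 / (2 * (2 * C + 1)), by positivity, ?_, ?_⟩
  · rw [div_le_div_iff₀ (by positivity) (by norm_num)]; linarith
  intro M κ κ' α α' e e' f hM _ _ hκ hκ' hα hα' hαB hf hfin
  have hV : Measurable (inversion α f) := by fun_prop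
  set g := transferStep κ α e f with hg
  have hgm : Measurable g := by fun_prop
  have hVg : Measurable (inversion α' g) := by fun_prop
  set h := transferStep κ' α' e' g with hh
  have e1 : 2 * sqNorm f = 2 * sqNorm g + pairEnergy κ (inversion α f) := by
    rw [← sqNorm_inversion hα f, two_mul_sqNorm_eq κ e hV]; rfl
  have e2 : 2 * sqNorm g = 2 * sqNorm h + pairEnergy κ' (inversion α' g) := by
    rw [← sqNorm_inversion hα' g, two_mul_sqNorm_eq κ' e' hVg]; rfl
  set P1 := pairEnergy κ (inversion α f)
  set P2 := pairEnergy κ' (inversion α' g)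
  have hgf : sqNorm g ≤ sqNorm f := sqNorm_transferStep_le κ hα e hf
  have hhg : sqNorm h ≤ sqNorm g := sqNorm_transferStep_le κ' hα' e' hgm
  have hgfin : sqNorm g ≠ ∞ := ne_top_of_le_ne_top hfin hgf
  have hhfin : sqNorm h ≠ ∞ := ne_top_of_le_ne_top hgfin hhg
  have hP1 : P1 ≠ ∞ := by
    refine ne_top_of_le_ne_top (ENNReal.mul_ne_top (by norm_num : (2 : ℝ≥0∞) ≠ ∞) hfin) ?_
    rw [e1]; exact le_add_self
  have hP2 : P2 ≠ ∞ := by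
    refine ne_top_of_le_ne_top (ENNReal.mul_ne_top (by norm_num : (2 : ℝ≥0∞) ≠ ∞) hgfin) ?_
    rw [e2]; exact le_add_self
  -- Mass inside `[-B, B]` is charged to the energy of the first step, mass outside to that of the
  -- second, after inversion.
  have e3 : sqNorm g ≤ (ENNReal.ofReal (C * M ^ 2) * P1 + sqNorm f / 4)
      + (ENNReal.ofReal (C * M ^ 2) * P2 + sqNorm f / 4) := by
    rw [sqNorm, ← lintegral_add_compl _ (measurableSet_Icc (a := -B) (b := B))]
    refine add_le_add ?_ ?_
    · have := setLIntegral_siteAverage_sq_le hM (by positivity : 0 ≤ 2 * B) hκ e hV (-B)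
      rw [show -B + 2 * B = B by ring, sqNorm_inversion hα] at this
      exact this
    · refine (setLIntegral_compl_sq_le_inversion hα' hαB g).trans ?_
      have := setLIntegral_sq_le_pairEnergy hM (by positivity : 0 ≤ 2 * B) hκ' hVg (-B)
      rw [show -B + 2 * B = B by ring, sqNorm_inversion hα'] at this
      refine this.trans ?_
      gcongr
  lift sqNorm f to ℝ≥0 using hfin with F
  lift sqNorm g to ℝ≥0 using hgfin with G
  lift sqNorm h to ℝ≥0 using hhfin with H
  lift P1 to ℝ≥0 using hP1 with p1
  lift P2 to ℝ≥0 using hP2 with p2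
  have hM2 : 1 ≤ M ^ 2 := by nlinarith
  have hx : 0 ≤ 1 - 1 / (2 * (2 * C + 1)) / M ^ 2 := by
    rw [sub_nonneg, div_div, div_le_one (by positivity)]
    nlinarith
  have r1 : 2 * (F : ℝ) = 2 * G + p1 := by exact_mod_cast e1
  have r2 : 2 * (G : ℝ) = 2 * H + p2 := by exact_mod_cast e2
  have r3 : (G : ℝ) ≤ (C * M ^ 2 * p1 + F / 4) + (C * M ^ 2 * p2 + F / 4) := by
    have h1 := (ENNReal.toReal_le_toReal (by simp) (by
      simp [ENNReal.mul_eq_top, ENNReal.div_eq_top])).2 e3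
    rw [ENNReal.toReal_add, ENNReal.toReal_add, ENNReal.toReal_add] at h1
    · simpa [ENNReal.toReal_mul, ENNReal.toReal_ofReal (by positivity : 0 ≤ C * M ^ 2)] using h1
    all_goals simp [ENNReal.mul_eq_top, ENNReal.div_eq_top]
  have key : (H : ℝ) ≤ (1 - 1 / (2 * (2 * C + 1)) / M ^ 2) * F := by
    have hp1 : (0 : ℝ) ≤ p1 := p1.2
    have hp2 : (0 : ℝ) ≤ p2 := p2.2
    have h1 : (F : ℝ) ≤ (2 * C + 1) * M ^ 2 * (p1 + p2) := by
      nlinarith [mul_nonneg (sub_nonneg.2 hM2) hp1, mul_nonneg (sub_nonneg.2 hM2) hp2]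
    have h2 : (F : ℝ) / ((2 * C + 1) * M ^ 2) ≤ p1 + p2 := by
      rw [div_le_iff₀ (by positivity)]; linarith
    have h3 : 1 / (2 * (2 * C + 1)) / M ^ 2 * F = (F / ((2 * C + 1) * M ^ 2)) / 2 := by
      field_simp
    rw [sub_mul, h3]
    linarith
  have := ENNReal.ofReal_le_ofReal key
  rw [ENNReal.ofReal_mul hx, ENNReal.ofReal_coe_nnreal, ENNReal.ofReal_coe_nnreal] at this
  exact this

/-! ### Resampling coordinates of a product measure -/

section Resampling

variable {ι : Type*} {X : ι → Type*} [∀ i, MeasurableSpace (X i)]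

open Classical in
theorem measurable_piecewise_prod (R : Set ι) :
    Measurable fun p : (∀ i, X i) × (∀ i, X i) => R.piecewise p.2 p.1 := by
  refine measurable_pi_iff.2 fun i => ?_
  by_cases hi : i ∈ R
  · simp only [Set.piecewise_eq_of_mem _ _ _ hi]; fun_prop
  · simp only [Set.piecewise_eq_of_notMem _ _ _ hi]; fun_prop

variable (κ : ∀ i, Measure (X i)) [∀ i, IsProbabilityMeasure (κ i)]

-- On a cylinder box, the coordinates in `R` and those outside constrain different independent
-- copies, so the probability factorizes into the original product.
open Classical in
theorem map_piecewise_infinitePi (R : Set ι) :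
    ((Measure.infinitePi κ).prod (Measure.infinitePi κ)).map
      (fun p => R.piecewise p.2 p.1) = Measure.infinitePi κ := by
  refine Measure.eq_infinitePi κ fun s t ht => ?_
  rw [Measure.map_apply (measurable_piecewise_prod R)
    (MeasurableSet.pi s.countable_toSet fun i _ => ht i)]
  have hpre : (fun p : (∀ i, X i) × (∀ i, X i) => R.piecewise p.2 p.1) ⁻¹' (s : Set ι).pi t
      = ((s.filter (· ∉ R) : Finset ι) : Set ι).pi t
        ×ˢ ((s.filter (· ∈ R) : Finset ι) : Set ι).pi t := by
    ext p
    simp only [Set.mem_preimage, Set.mem_pi, Set.mem_prod, Finset.mem_coe, Finset.mem_filter]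
    constructor
    · intro h
      refine ⟨fun i hi => ?_, fun i hi => ?_⟩
      · simpa [Set.piecewise_eq_of_notMem _ _ _ hi.2] using h i hi.1
      · simpa [Set.piecewise_eq_of_mem _ _ _ hi.2] using h i hi.1
    · rintro ⟨h1, h2⟩ i hi
      by_cases hR : i ∈ R
      · rw [Set.piecewise_eq_of_mem _ _ _ hR]; exact h2 i ⟨hi, hR⟩
      · rw [Set.piecewise_eq_of_notMem _ _ _ hR]; exact h1 i ⟨hi, hR⟩
  rw [hpre, Measure.prod_prod, Measure.infinitePi_pi _ (fun i _ => ht i),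
    Measure.infinitePi_pi _ (fun i _ => ht i), mul_comm]
  exact Finset.prod_filter_mul_prod_filter_not s (· ∈ R) _

open Classical in
theorem lintegral_infinitePi_eq_piecewise (R : Set ι) {F : (∀ i, X i) → ℝ≥0∞}
    (hF : Measurable F) :
    ∫⁻ ω, F ω ∂Measure.infinitePi κ
      = ∫⁻ ω, ∫⁻ ω', F (R.piecewise ω' ω) ∂Measure.infinitePi κ ∂Measure.infinitePi κ := by
  conv_lhs => rw [← map_piecewise_infinitePi κ R]
  rw [lintegral_map hF (measurable_piecewise_prod R)]
  exact lintegral_prod (fun p => F (R.piecewise p.2 p.1))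
    (hF.comp (measurable_piecewise_prod R)).aemeasurable

theorem lintegral_infinitePi_eq_update [DecidableEq ι] (i : ι) {F : (∀ i, X i) → ℝ≥0∞}
    (hF : Measurable F) :
    ∫⁻ ω, F ω ∂Measure.infinitePi κ
      = ∫⁻ ω, ∫⁻ y, F (Function.update ω i y) ∂κ i ∂Measure.infinitePi κ := by
  classical
  rw [lintegral_infinitePi_eq_piecewise κ {i} hF]
  refine lintegral_congr fun ω => ?_
  rw [← (measurePreserving_eval_infinitePi κ i).map_eq]
  refine Eq.trans (lintegral_congr fun ω' => ?_)
    (lintegral_map (hF.comp (measurable_update ω)) (measurable_pi_apply i)).symm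
  refine congrArg F (funext fun j => ?_)
  by_cases hj : j = i
  · subst hj
    exact (if_pos (Set.mem_singleton j)).trans
      (Function.update_self j _ ω).symm
  · exact (if_neg (mt Set.mem_singleton_iff.1 hj)).trans
      (Function.update_of_ne hj _ ω).symm

end Resampling

/-! ### The chain of ratios of a solution -/

/-- Scaled ratios `α k * u (k + 1) / u k` of the solution of the eigenvalue equation with
shifted potential `b` that vanishes `j + 1` sites beyond `k`. -/
def ratioChain (α b : ℕ → ℝ) : ℕ → ℕ → ℝ
  | 0, _ => 0
  | j + 1, k => α k ^ 2 / (b (k + 1) - ratioChain α b j (k + 1))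

/-- The product `|u (k + n) / u k|` of `n` consecutive ratios, with `l` more sites beyond. -/
def chainWeight (α b : ℕ → ℝ) (l : ℕ) : ℕ → ℕ → ℝ
  | 0, _ => 1
  | n + 1, k => |α k / (b (k + 1) - ratioChain α b (l + n) (k + 1))| *
      chainWeight α b l n (k + 1)

/-- The chain at `k` reads only sites strictly beyond `k`. This is the independence that allows the
nearest site to be integrated while the rest stay fixed. -/
theorem ratioChain_congr (α : ℕ → ℝ) {b b' : ℕ → ℝ} (j k : ℕ) (h : ∀ i, k < i → b i = b' i) :
    ratioChain α b j k = ratioChain α b' j k := by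
  induction j generalizing k with
  | zero => rfl
  | succ j ih =>
    rw [ratioChain, ratioChain, h _ (Nat.lt_succ_self k), ih _ fun i hi => h i (by omega)]

theorem chainWeight_congr (α : ℕ → ℝ) {b b' : ℕ → ℝ} (l n k : ℕ) (h : ∀ i, k < i → b i = b' i) :
    chainWeight α b l n k = chainWeight α b' l n k := by
  induction n generalizing k with
  | zero => rfl
  | succ n ih =>
    rw [chainWeight, chainWeight, h _ (Nat.lt_succ_self k), ih _ fun i hi => h i (by omega),
      ratioChain_congr α _ _ fun i hi => h i (by omega)]

@[fun_prop]
theorem measurable_ratioChain {Ω : Type*} [MeasurableSpace Ω] (α : ℕ → ℝ) {b : Ω → ℕ → ℝ}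
    (hb : Measurable b) (j k : ℕ) : Measurable fun ω => ratioChain α (b ω) j k := by
  induction j generalizing k with
  | zero => exact measurable_const
  | succ j ih =>
    have := ih (k + 1)
    simp only [ratioChain]
    fun_prop

@[fun_prop]
theorem measurable_chainWeight {Ω : Type*} [MeasurableSpace Ω] (α : ℕ → ℝ) {b : Ω → ℕ → ℝ}
    (hb : Measurable b) (l n k : ℕ) : Measurable fun ω => chainWeight α (b ω) l n k := by
  induction n generalizing k with
  | zero => exact measurable_const
  | succ n ih =>
    have := ih (k + 1)
    simp only [chainWeight]
    refine Measurable.mul ?_ this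
    simp only [← Real.norm_eq_abs]
    fun_prop

/-! ### Expectation of the chain weight at fixed energy -/

/-- The iterated transfer steps along the sites `site (k + 1), …, site (k + n)`. -/
def transferIter (κ : ℤ → Measure ℝ) (site : ℕ → ℤ) (α : ℕ → ℝ) (E : ℝ) :
    ℕ → ℕ → (ℝ → ℝ≥0∞) → ℝ → ℝ≥0∞
  | 0, _, Φ => Φ
  | n + 1, k, Φ =>
      transferIter κ site α E n (k + 1) (transferStep (κ (site (k + 1))) (α k) E Φ)

variable {κ : ℤ → Measure ℝ} [∀ n, IsProbabilityMeasure (κ n)]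

/-- Resample the site `k + 1` with value `y`. If `t` is the ratio at `k + 1`, the ratio at `k` is `α
k ^ 2 / (E - y - t)` and the new weight is `|α k / (E - y - t)|`, so integrating over `y` is one
transfer step evaluated at `t`. The `l` sites beyond the last one integrated enter only through the
final argument. -/
theorem lintegral_chainWeight_eq {site : ℕ → ℤ} (hsite : Function.Injective site) (α : ℕ → ℝ)
    (E : ℝ) (l n k : ℕ) {Φ : ℝ → ℝ≥0∞} (hΦ : Measurable Φ) :
    ∫⁻ ω, Φ (ratioChain α (fun i => E - ω (site i)) (l + n) k) *
        ENNReal.ofReal (chainWeight α (fun i => E - ω (site i)) l n k) ∂Measure.infinitePi κ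
      = ∫⁻ ω, transferIter κ site α E n k Φ
          (ratioChain α (fun i => E - ω (site i)) l (k + n)) ∂Measure.infinitePi κ := by
  induction n generalizing k Φ with
  | zero => simp [chainWeight, transferIter]
  | succ n ih =>
    set b : (ℤ → ℝ) → ℕ → ℝ := fun ω i => E - ω (site i) with hb
    have hbm : Measurable b := by fun_prop
    have hstep : Measurable (transferStep (κ (site (k + 1))) (α k) E Φ) := by fun_prop
    have h1 := ih (k + 1) hstep
    rw [transferIter, show k + (n + 1) = k + 1 + n by ring, ← h1]
    have hF : Measurable fun ω : ℤ → ℝ => Φ (ratioChain α (b ω) (l + (n + 1)) k) *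
        ENNReal.ofReal (chainWeight α (b ω) l (n + 1) k) := by fun_prop
    rw [lintegral_infinitePi_eq_update κ (site (k + 1)) hF]
    refine lintegral_congr fun ω => ?_
    have hupd (y : ℝ) (i : ℕ) (hi : k + 1 < i) :
        b (Function.update ω (site (k + 1)) y) i = b ω i := by
      change E - _ = E - _
      rw [Function.update_of_ne fun h => hi.ne' (hsite h)]
    have hval (y : ℝ) : b (Function.update ω (site (k + 1)) y) (k + 1) = E - y := by
      simp [hb]
    have h2 (y : ℝ) : Φ (ratioChain α (b (Function.update ω (site (k + 1)) y)) (l + (n + 1)) k) *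
        ENNReal.ofReal (chainWeight α (b (Function.update ω (site (k + 1)) y)) l (n + 1) k)
        = inversion (α k) Φ (E - y - ratioChain α (b ω) (l + n) (k + 1)) *
          ENNReal.ofReal (chainWeight α (b ω) l n (k + 1)) := by
      rw [show l + (n + 1) = l + n + 1 by ring, ratioChain, chainWeight, hval,
        ratioChain_congr α (l + n) (k + 1) (hupd y), chainWeight_congr α l n (k + 1) (hupd y),
        inversion, ENNReal.ofReal_mul (abs_nonneg _)]
      ring
    refine (lintegral_congr h2).trans ?_
    rw [lintegral_mul_const _ (by fun_prop)]
    rfl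

/-- Uniform decay of the iterated transfer steps. -/
theorem exists_transferIter_bound (A : ℝ) (hA : 0 < A) :
    ∃ η : ℝ, 0 < η ∧ η ≤ 1 / 2 ∧ ∀ (κ : ℤ → Measure ℝ) (site : ℕ → ℤ) (α : ℕ → ℝ) (E M : ℝ)
      (n k : ℕ) (Φ : ℝ → ℝ≥0∞) (t : ℝ), (∀ i, IsProbabilityMeasure (κ i)) → 1 ≤ M →
      (∀ i, i ≤ k + n + 1 → κ (site i) ≤ ENNReal.ofReal M • volume) →
      (∀ i, 0 < α i) → (∀ i, α i ≤ A) → Measurable Φ → sqNorm Φ ≠ ∞ →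
      transferIter κ site α E (n + 1) k Φ t ^ 2
        ≤ ENNReal.ofReal M * (ENNReal.ofReal (1 - η / M ^ 2) ^ (n / 2) * sqNorm Φ) := by
  obtain ⟨η, hη0, hη1, hη⟩ := exists_two_step_contraction A hA
  refine ⟨η, hη0, hη1, fun κ site α E M n k Φ t hprob hM hκ hα hαA hΦ hfin => ?_⟩
  -- Of the `n + 1` steps, the last is spent on passing from `L²` to a pointwise bound through the
  -- bounded density. The other `n` contract in pairs, whence the exponent `n / 2`.
  have h1 (k : ℕ) (hk : κ (site (k + 1)) ≤ ENNReal.ofReal M • volume) (Φ : ℝ → ℝ≥0∞)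
      (hΦ : Measurable Φ) : transferIter κ site α E 1 k Φ t ^ 2
        ≤ ENNReal.ofReal M * sqNorm Φ := by
    refine (siteAverage_sq_le hk E (f := inversion (α k) Φ) (by fun_prop) t).trans_eq ?_
    rw [sqNorm_inversion (hα k)]
  induction n using Nat.twoStepInduction generalizing k Φ with
  | zero => simpa using h1 k (hκ _ (by omega)) Φ hΦ
  | one =>
    rw [transferIter]
    refine (h1 (k + 1) (hκ _ (by omega)) _ (by fun_prop)).trans ?_
    simp only [Nat.reduceDiv, pow_zero, one_mul]
    gcongr
    exact sqNorm_transferStep_le _ (hα k) E hΦ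
  | more n ih _ =>
    rw [transferIter, transferIter]
    have hc := hη M (κ (site (k + 1))) (κ (site (k + 1 + 1))) (α k) (α (k + 1)) E E Φ hM
      inferInstance inferInstance (hκ _ (by omega)) (hκ _ (by omega)) (hα _) (hα _) (hαA _) hΦ hfin
    refine (ih (k + 1 + 1) _ (fun i hi => hκ i (by omega)) (by fun_prop)
      (ne_top_of_le_ne_top (ENNReal.mul_ne_top ENNReal.ofReal_ne_top hfin) hc)).trans ?_
    rw [show (n + 2) / 2 = n / 2 + 1 by omega, pow_succ (ENNReal.ofReal _),
      mul_assoc (_ ^ _)]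
    gcongr

/-- The expected weight of the chain at a fixed energy, restricted to configurations for which
the energy is compatible with a bounded potential at the base site. -/
theorem exists_chainWeight_bound (A : ℝ) (hA : 0 < A) :
    ∃ η : ℝ, 0 < η ∧ η ≤ 1 / 2 ∧ ∀ (κ : ℤ → Measure ℝ) (site site' : ℕ → ℤ) (α α' : ℕ → ℝ)
      (E M B : ℝ) (l n N : ℕ) (D : ℝ≥0∞), (∀ i, IsProbabilityMeasure (κ i)) → 1 ≤ M → 0 ≤ B →
      Function.Injective site → (∀ i j, 0 < i → site j ≠ site' i) →
      (∀ i, i ≤ n + 1 → κ (site i) ≤ ENNReal.ofReal M • volume) →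
      (∀ i, 0 < α i) → (∀ i, α i ≤ A) →
      ENNReal.ofReal M * (ENNReal.ofReal (1 - η / M ^ 2) ^ (n / 2) * ENNReal.ofReal (2 * B))
        ≤ D ^ 2 →
      ∫⁻ ω, (Set.Icc (-B) B).indicator 1
          (E - ratioChain α (fun i => E - ω (site i)) (l + (n + 1)) 0
            - ratioChain α' (fun i => E - ω (site' i)) N 0) *
        ENNReal.ofReal (chainWeight α (fun i => E - ω (site i)) l (n + 1) 0)
        ∂Measure.infinitePi κ ≤ D := by
  classical
  obtain ⟨η, hη0, hη1, hη⟩ := exists_transferIter_bound A hA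
  refine ⟨η, hη0, hη1, fun κ site site' α α' E M B l n N D hprob hM hB hinj hdisj hκ hα hαA hD =>
    ?_⟩
  have hInd : Measurable ((Set.Icc (-B) B).indicator (1 : ℝ → ℝ≥0∞)) :=
    measurable_one.indicator measurableSet_Icc
  have hF : Measurable fun ω : ℤ → ℝ => (Set.Icc (-B) B).indicator (1 : ℝ → ℝ≥0∞)
          (E - ratioChain α (fun i => E - ω (site i)) (l + (n + 1)) 0
            - ratioChain α' (fun i => E - ω (site' i)) N 0) *
        ENNReal.ofReal (chainWeight α (fun i => E - ω (site i)) l (n + 1) 0) := by fun_prop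
  -- Only the ray along `site` is resampled. The ratio `s` of the other half-line is then a
  -- constant, and the indicator becomes a fixed function `Φ` of the near ratio.
  rw [lintegral_infinitePi_eq_piecewise κ (Set.range site) hF]
  refine (lintegral_mono (g := fun _ => D) fun ω => ?_).trans_eq (by simp)
  set s := ratioChain α' (fun i => E - ω (site' i)) N 0
  have h1 (ω' : ℤ → ℝ) : (fun i => E - (Set.range site).piecewise ω' ω (site i))
      = fun i => E - ω' (site i) := by
    funext i
    rw [Set.piecewise_eq_of_mem _ _ _ (Set.mem_range_self i)]
  have h2 (ω' : ℤ → ℝ) :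
      ratioChain α' (fun i => E - (Set.range site).piecewise ω' ω (site' i)) N 0 = s := by
    refine ratioChain_congr _ _ _ fun i hi => ?_
    rw [Set.piecewise_eq_of_notMem]
    rintro ⟨j, hj⟩
    exact hdisj i j hi hj
  simp only [h1, h2]
  set Φ : ℝ → ℝ≥0∞ := fun t => (Set.Icc (-B) B).indicator 1 (E - t - s) with hΦ
  have hΦm : Measurable Φ := by fun_prop
  have hΦn : sqNorm Φ = ENNReal.ofReal (2 * B) := by
    have : sqNorm Φ = ∫⁻ t, (Set.Icc (-B) B).indicator (1 : ℝ → ℝ≥0∞) ((E - s) - t) := by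
      refine lintegral_congr fun t => ?_
      simp only [hΦ, sub_right_comm E t s]
      by_cases ht : E - s - t ∈ Set.Icc (-B) B <;> simp [ht]
    rw [this, lintegral_reflect, lintegral_indicator_one measurableSet_Icc, Real.volume_Icc]
    congr 1
    ring
  have h3 := lintegral_chainWeight_eq (κ := κ) hinj α E l (n + 1) 0 hΦm
  refine (le_of_eq h3).trans ((lintegral_mono (g := fun _ => D) fun ω' => ?_).trans_eq (by simp))
  have h4 := hη κ site α E M n 0 Φ (ratioChain α (fun i => E - ω' (site i)) l (0 + (n + 1)))
    hprob hM (fun i hi => hκ i (by omega)) hα hαA hΦm (hΦn ▸ ENNReal.ofReal_ne_top)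
  rw [hΦn] at h4
  exact (ENNReal.pow_le_pow_left_iff (by norm_num)).1 (h4.trans hD)

/-! ### Change of variables for piecewise increasing functions -/

/-- The points outside `Z` with exactly `k` points of `Z` to their left. -/
def gapPiece (Z : Finset ℝ) (k : ℕ) : Set ℝ := {E | E ∉ Z ∧ (Z.filter (· < E)).card = k}

/-- The number of points of `Z` to the left is monotone and jumps past every point of `Z`, so two
points with equal counts have no point of `Z` between them. -/
theorem ordConnected_gapPiece (Z : Finset ℝ) (k : ℕ) : (gapPiece Z k).OrdConnected := by
  refine ⟨fun x hx y hy z hz => ?_⟩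
  have h1 : Z.filter (· < x) ⊆ Z.filter (· < z) :=
    Finset.monotone_filter_right _ fun _ _ h => lt_of_lt_of_le h hz.1
  have h2 : Z.filter (· < z) ⊆ Z.filter (· < y) :=
    Finset.monotone_filter_right _ fun _ _ h => lt_of_lt_of_le h hz.2
  have h3 : (Z.filter (· < z)).card = k :=
    le_antisymm ((Finset.card_le_card h2).trans_eq hy.2)
      (hx.2.symm.le.trans (Finset.card_le_card h1))
  refine ⟨fun hzZ => ?_, h3⟩
  have hzy : z < y := lt_of_le_of_ne hz.2 fun h => hy.1 (h ▸ hzZ)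
  have h4 : Z.filter (· < z) = Z.filter (· < y) :=
    Finset.eq_of_subset_of_card_le h2 (by rw [h3, hy.2])
  have h5 : z ∈ Z.filter (· < y) := Finset.mem_filter.2 ⟨hzZ, hzy⟩
  rw [← h4] at h5
  exact lt_irrefl _ (Finset.mem_filter.1 h5).2

theorem strictMonoOn_gapPiece {Z : Finset ℝ} {h h' : ℝ → ℝ}
    (hd : ∀ E ∉ Z, HasDerivAt h (h' E) E) (hpos : ∀ E ∉ Z, 0 < h' E) (k : ℕ) :
    StrictMonoOn h (gapPiece Z k) :=
  strictMonoOn_of_hasDerivWithinAt_pos (ordConnected_gapPiece Z k).convex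
    (fun E hE => (hd E hE.1).continuousAt.continuousWithinAt)
    (fun E hE => (hd E (interior_subset hE).1).hasDerivWithinAt)
    (fun E hE => hpos E (interior_subset hE).1)

/-- On each gap of `Z` the function `h` is strictly increasing, so `x = h E` is an injective change
of variables there, with Jacobian `h'`. A fibre meets each gap at most once, so the sum over `S` is
dominated by the sum over the inverse branches. -/
theorem setLIntegral_le_of_fiber_sum {Z : Finset ℝ} {h h' : ℝ → ℝ} (hm : Measurable h)
    (hm' : Measurable h') (hd : ∀ E ∉ Z, HasDerivAt h (h' E) E) (hpos : ∀ E ∉ Z, 0 < h' E)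
    {g : ℝ → ℝ≥0∞} (hg : Measurable g) {I T : Set ℝ} (hI : MeasurableSet I)
    (hT : MeasurableSet T) {F : ℝ → ℝ≥0∞}
    (hF : ∀ x ∈ T, ∃ S : Finset ℝ, (∀ E ∈ S, E ∈ I ∧ E ∉ Z ∧ h E = x) ∧
      F x ≤ ∑ E ∈ S, g E / ENNReal.ofReal (h' E)) :
    ∫⁻ x in T, F x ≤ ∫⁻ E in I, T.indicator 1 (h E) * g E := by
  classical
  set V : ℕ → Set ℝ := fun k => gapPiece Z k ∩ I with hV
  have hVm (k : ℕ) : MeasurableSet (V k) := (ordConnected_gapPiece Z k).measurableSet.inter hI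
  have hinj (k : ℕ) : Set.InjOn h (V k) :=
    (strictMonoOn_gapPiece hd hpos k).injOn.mono Set.inter_subset_left
  have hdV (k : ℕ) : ∀ E ∈ V k, HasDerivAt h (h' E) E := fun E hE => hd E hE.1.1
  have hemb (k : ℕ) : MeasurableEmbedding ((V k).domRestrict h) :=
    ContinuousOn.measurableEmbedding (hVm k)
      (fun E hE => (hdV k E hE).continuousAt.continuousWithinAt) (hinj k)
  set q : ℝ → ℝ≥0∞ := fun E => g E / ENNReal.ofReal (h' E) with hq
  have hqm : Measurable q := by fun_prop
  -- `G k` is the contribution of the `k`-th branch as a function of `x`, and is zero where that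
  -- branch takes no value.
  set G : ℕ → ℝ → ℝ≥0∞ := fun k => Function.extend ((V k).domRestrict h) (fun E => q E) 0 with hG
  have hGm (k : ℕ) : Measurable (G k) :=
    (hemb k).measurable_extend (by fun_prop) measurable_zero
  have hGval (k : ℕ) {E : ℝ} (hE : E ∈ V k) : G k (h E) = q E :=
    (hemb k).injective.extend_apply _ _ ⟨E, hE⟩
  have hGzero (k : ℕ) {x : ℝ} (hx : x ∉ h '' V k) : G k x = 0 := by
    refine Function.extend_apply' _ _ _ ?_
    rintro ⟨⟨E, hE⟩, rfl⟩
    exact hx ⟨E, hE, rfl⟩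
  have hGint (k : ℕ) : ∫⁻ x in T, G k x = ∫⁻ E in V k, T.indicator 1 (h E) * g E := by
    have hs : MeasurableSet (V k ∩ h ⁻¹' T) := (hVm k).inter (hm hT)
    have himg : h '' (V k ∩ h ⁻¹' T) = T ∩ h '' V k := by
      rw [Set.image_inter_preimage, Set.inter_comm]
    have hVim : MeasurableSet (h '' V k) := by
      have := (hemb k).measurableSet_range
      rwa [Set.range_domRestrict] at this
    have h1 : ∫⁻ x in T, G k x = ∫⁻ x in h '' (V k ∩ h ⁻¹' T), G k x := by
      rw [himg, Set.inter_comm, ← Measure.restrict_restrict hVim]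
      refine (setLIntegral_eq_of_support_subset ?_).symm
      intro x hx
      by_contra hx'
      exact hx (hGzero k hx')
    rw [h1, lintegral_image_eq_lintegral_abs_deriv_mul hs
      (fun E hE => (hdV k E hE.1).hasDerivWithinAt)
      ((hinj k).mono Set.inter_subset_left)]
    have h2 : ∫⁻ E in V k ∩ h ⁻¹' T, ENNReal.ofReal |h' E| * G k (h E)
        = ∫⁻ E in V k ∩ h ⁻¹' T, g E := by
      refine setLIntegral_congr_fun hs fun E hE => ?_
      have hp : 0 < h' E := hpos E hE.1.1.1
      rw [hGval k hE.1, abs_of_pos hp, hq]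
      exact ENNReal.mul_div_cancel (by simpa using hp) ENNReal.ofReal_ne_top
    rw [h2, Set.inter_comm, ← Measure.restrict_restrict (hm hT),
      ← lintegral_indicator (hm hT)]
    refine lintegral_congr fun E => ?_
    by_cases hE : h E ∈ T
    · rw [Set.indicator_of_mem (show E ∈ h ⁻¹' T from hE), Set.indicator_of_mem hE]; simp
    · rw [Set.indicator_of_notMem (show E ∉ h ⁻¹' T from hE), Set.indicator_of_notMem hE]; simp
  set K := Finset.range (Z.card + 1)
  have hle : ∀ x ∈ T, F x ≤ ∑ k ∈ K, G k x := by
    intro x hx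
    obtain ⟨S, hS, hFS⟩ := hF x hx
    refine hFS.trans ?_
    set c : ℝ → ℕ := fun E => (Z.filter (· < E)).card
    have hmem : ∀ E ∈ S, E ∈ V (c E) := fun E hE => ⟨⟨(hS E hE).2.1, rfl⟩, (hS E hE).1⟩
    have hcinj : Set.InjOn c S := by
      intro E hE E' hE' hc
      have h1 := hmem E hE
      rw [hc] at h1
      exact hinj _ h1 (hmem E' hE') ((hS E hE).2.2.trans (hS E' hE').2.2.symm)
    calc ∑ E ∈ S, q E = ∑ E ∈ S, G (c E) x := by
          refine Finset.sum_congr rfl fun E hE => ?_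
          rw [← (hS E hE).2.2, hGval _ (hmem E hE)]
      _ = ∑ k ∈ S.image c, G k x :=
          (Finset.sum_image (f := fun k => G k x) hcinj).symm
      _ ≤ ∑ k ∈ K, G k x := by
          refine Finset.sum_le_sum_of_subset fun k hk => ?_
          obtain ⟨E, -, rfl⟩ := Finset.mem_image.1 hk
          exact Finset.mem_range.2 (Nat.lt_succ_of_le (Finset.card_filter_le _ _))
  calc ∫⁻ x in T, F x ≤ ∫⁻ x in T, ∑ k ∈ K, G k x := setLIntegral_mono' hT hle
    _ = ∑ k ∈ K, ∫⁻ E in V k, T.indicator 1 (h E) * g E := by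
        rw [lintegral_finsetSum _ fun k _ => hGm k]
        exact Finset.sum_congr rfl fun k _ => hGint k
    _ = ∫⁻ E in ⋃ k ∈ K, V k, T.indicator 1 (h E) * g E := by
        refine (lintegral_biUnion_finset ?_ (fun k _ => hVm k) _).symm
        intro i _ j _ hij
        rw [Function.onFun, Set.disjoint_left]
        exact fun E hE hE' => hij (hE.1.2.symm.trans hE'.1.2)
    _ ≤ _ := lintegral_mono_set (Set.iUnion₂_subset fun k _ => Set.inter_subset_right)

/-! ### Jacobi operators on arbitrary sequences -/

/-- The Jacobi difference expression acting on arbitrary real sequences. -/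
def formalJacobi (a b : ℤ → ℝ) : Module.End ℝ (ℤ → ℝ) where
  toFun φ n := a n * φ (n + 1) + a (n - 1) * φ (n - 1) + b n * φ n
  map_add' φ ψ := by ext n; simp only [Pi.add_apply]; ring
  map_smul' z φ := by ext n; simp only [Pi.smul_apply, smul_eq_mul, RingHom.id_apply]; ring

theorem formalJacobi_apply (a b φ : ℤ → ℝ) (n : ℤ) :
    formalJacobi a b φ n = a n * φ (n + 1) + a (n - 1) * φ (n - 1) + b n * φ n := rfl

/-- The entries `⟨δ_n, p(J) δ_m⟩` of polynomials in the Jacobi difference expression. -/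
def polyEntry (a b : ℤ → ℝ) (p : Polynomial ℝ) (m n : ℤ) : ℝ :=
  Polynomial.aeval (formalJacobi a b) p (Pi.single m 1) n

/-- The box of radius `N` around `m`. -/
def box (m : ℤ) (N : ℕ) : Finset ℤ := Finset.Icc (m - N) (m + N)

/-- A complete orthonormal system of eigenfunctions of the restriction of the Jacobi operator to
a box with Dirichlet boundary conditions. -/
structure IsBoxEigensystem (a b : ℤ → ℝ) (m : ℤ) (N : ℕ) {ι : Type} [Fintype ι]
    (φ : ι → ℤ → ℝ) (ev : ι → ℝ) : Prop where
  eq_zero : ∀ i, ∀ n ∉ box m N, φ i n = 0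
  eigen : ∀ i, ∀ n ∈ box m N, formalJacobi a b (φ i) n = ev i * φ i n
  norm_one : ∀ i, ∑ n ∈ box m N, φ i n ^ 2 = 1
  orthogonal : ∀ i j, i ≠ j → ∑ n ∈ box m N, φ i n * φ j n = 0
  complete : ∀ n ∈ box m N, ∀ k ∈ box m N, ∑ i, φ i n * φ i k = if n = k then 1 else 0

/-- The restriction is a real symmetric tridiagonal matrix, so the finite-dimensional spectral
theorem applies; completeness is Parseval on coordinate vectors. -/
theorem exists_isBoxEigensystem (a b : ℤ → ℝ) (m : ℤ) (N : ℕ) :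
    ∃ (ι : Type) (_ : Fintype ι) (φ : ι → ℤ → ℝ) (ev : ι → ℝ),
      IsBoxEigensystem a b m N φ ev := by
  classical
  set S := box m N
  let e : ℤ → ℤ → ℝ := fun i j => (if j = i + 1 then a i else 0) +
    (if j = i - 1 then a (i - 1) else 0) + if j = i then b i else 0
  have he (φ : ℤ → ℝ) (hφ : ∀ n ∉ S, φ n = 0) (n : ℤ) :
      ∑ j ∈ S, e n j * φ j = formalJacobi a b φ n ∨ n ∉ S := by
    by_cases hn : n ∈ S
    · left
      have key (k : ℤ) (x : ℝ) : ∑ j ∈ S, (if j = k then x else 0) * φ j = x * φ k := by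
        by_cases hk : k ∈ S
        · simp [hk]
        · simp [hk, hφ k hk]
      simp only [e, add_mul, Finset.sum_add_distrib, key, formalJacobi_apply]
    · exact Or.inr hn
  let A : Matrix S S ℝ := fun i j => e i j
  have hA : A.IsHermitian := by
    refine Matrix.IsHermitian.ext fun i j => ?_
    simp only [A, e, star_trivial]
    obtain ⟨i, hi⟩ := i
    obtain ⟨j, hj⟩ := j
    simp only
    by_cases h1 : i = j
    · subst h1; simp
    · by_cases h2 : i = j + 1
      · subst h2; simp [show j ≠ j + 1 + 1 by omega, show j + 1 ≠ j - 1 by omega]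
      · by_cases h3 : j = i + 1
        · subst h3; simp [show i ≠ i + 1 + 1 by omega, show i + 1 ≠ i - 1 by omega]
        · simp [h1, h2, h3, Ne.symm h1, show i ≠ j - 1 by omega, show j ≠ i - 1 by omega]
  let v := hA.eigenvectorBasis
  let φ : S → ℤ → ℝ := fun i n => if h : n ∈ S then v i ⟨n, h⟩ else 0
  have hφ0 : ∀ i, ∀ n ∉ S, φ i n = 0 := fun i n hn => by simp [φ, hn]
  have hφv (i : S) (n : S) : φ i n = v i n := by simp [φ]
  have hinner (i j : S) : ∑ n ∈ S, φ i n * φ j n = inner ℝ (v i) (v j) := by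
    rw [← Finset.sum_coe_sort S (fun n => φ i n * φ j n)]
    simp only [hφv, PiLp.inner_apply]
    refine Finset.sum_congr rfl fun n _ => ?_
    simp [mul_comm]
  refine ⟨S, inferInstance, φ, hA.eigenvalues, hφ0, ?_, ?_, ?_, ?_⟩
  · intro i n hn
    have h1 := congrFun (hA.mulVec_eigenvectorBasis i) ⟨n, hn⟩
    rw [← (he (φ i) (hφ0 i) n).resolve_right (not_not.2 hn),
      ← Finset.sum_coe_sort S (fun j => e n j * φ i j)]
    simp only [hφv]
    rw [show φ i n = v i ⟨n, hn⟩ from hφv i ⟨n, hn⟩]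
    exact h1
  · intro i
    simp only [sq]
    rw [hinner, real_inner_self_eq_norm_sq, v.orthonormal.1 i, one_pow]
  · intro i j hij
    rw [hinner]
    exact v.orthonormal.2 hij
  · intro n hn k hk
    have h1 := v.sum_inner_mul_inner (EuclideanSpace.single ⟨n, hn⟩ 1)
      (EuclideanSpace.single ⟨k, hk⟩ 1)
    simp only [EuclideanSpace.inner_single_left, EuclideanSpace.inner_single_right] at h1
    simp only [show ∀ i, φ i n = v i ⟨n, hn⟩ from fun i => hφv i ⟨n, hn⟩,
      show ∀ i, φ i k = v i ⟨k, hk⟩ from fun i => hφv i ⟨k, hk⟩]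
    refine Eq.trans (Finset.sum_congr rfl fun i _ => ?_) (h1.trans ?_)
    · simp
    · simp [eq_comm]

section Box

variable {a b : ℤ → ℝ} {m : ℤ} {N : ℕ} {ι : Type} [Fintype ι] {φ : ι → ℤ → ℝ} {ev : ι → ℝ}

theorem mem_box {m n : ℤ} {N : ℕ} : n ∈ box m N ↔ m - N ≤ n ∧ n ≤ m + N := Finset.mem_Icc

theorem formalJacobi_pow_single_eq_zero (a b : ℤ → ℝ) (m : ℤ) (k : ℕ) {n : ℤ}
    (hn : n ∉ box m k) : ((formalJacobi a b) ^ k) (Pi.single m 1) n = 0 := by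
  induction k generalizing n with
  | zero =>
    have : n ≠ m := by
      rintro rfl
      exact hn (mem_box.2 (by simp))
    simp [this]
  | succ k ih =>
    rw [mem_box] at hn
    push_cast at hn
    rw [pow_succ', Module.End.mul_apply, formalJacobi_apply,
      ih (n := n + 1) (by rw [mem_box]; omega), ih (n := n - 1) (by rw [mem_box]; omega),
      ih (n := n) (by rw [mem_box]; omega)]
    simp

/-- The operator moves supports by one site, so for `k ≤ N` the iterate never leaves the box and
does not feel the Dirichlet truncation. -/
theorem IsBoxEigensystem.pow_single (h : IsBoxEigensystem a b m N φ ev) {k : ℕ} (hk : k ≤ N) :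
    ((formalJacobi a b) ^ k) (Pi.single m 1) = fun n => ∑ i, ev i ^ k * φ i m * φ i n := by
  induction k with
  | zero =>
    funext n
    simp only [pow_zero, Module.End.one_apply, one_mul]
    by_cases hn : n ∈ box m N
    · rw [h.complete m (mem_box.2 (by simp)) n hn]
      by_cases hmn : m = n
      · subst hmn; simp
      · rw [if_neg hmn, Pi.single_eq_of_ne (Ne.symm hmn)]
    · rw [Pi.single_eq_of_ne]
      · rw [Finset.sum_eq_zero fun i _ => by rw [h.eq_zero i n hn, mul_zero]]
      · rintro rfl
        exact hn (mem_box.2 (by simp))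
  | succ k ih =>
    funext n
    by_cases hn : n ∈ box m N
    · rw [pow_succ', Module.End.mul_apply, ih (by omega), formalJacobi_apply, Finset.mul_sum,
        Finset.mul_sum, Finset.mul_sum, ← Finset.sum_add_distrib, ← Finset.sum_add_distrib]
      refine Finset.sum_congr rfl fun i _ => ?_
      have := h.eigen i n hn
      rw [formalJacobi_apply] at this
      linear_combination (ev i ^ k * φ i m) * this
    · rw [formalJacobi_pow_single_eq_zero, Finset.sum_eq_zero fun i _ => by
        rw [h.eq_zero i n hn, mul_zero]]
      rw [mem_box] at hn ⊢
      push_cast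
      omega

theorem IsBoxEigensystem.polyEntry_eq (h : IsBoxEigensystem a b m N φ ev) {p : Polynomial ℝ}
    (hp : p.natDegree ≤ N) (n : ℤ) :
    polyEntry a b p m n = ∑ i, p.eval (ev i) * φ i m * φ i n := by
  rw [polyEntry, Polynomial.aeval_eq_sum_range, LinearMap.sum_apply, Finset.sum_apply]
  simp only [LinearMap.smul_apply, Pi.smul_apply, smul_eq_mul]
  have h1 : ∀ k ∈ Finset.range (p.natDegree + 1),
      p.coeff k * ((formalJacobi a b) ^ k) (Pi.single m 1) n
        = ∑ i, p.coeff k * ev i ^ k * φ i m * φ i n := by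
    intro k hk
    rw [h.pow_single (by have := Finset.mem_range.1 hk; omega), Finset.mul_sum]
    exact Finset.sum_congr rfl fun i _ => by ring
  rw [Finset.sum_congr rfl h1, Finset.sum_comm]
  refine Finset.sum_congr rfl fun i _ => ?_
  rw [Polynomial.eval_eq_sum_range, Finset.sum_mul, Finset.sum_mul]

/-- Read the eigenvalue equation at a site where `|φ i|` is maximal. -/
theorem IsBoxEigensystem.abs_ev_le (h : IsBoxEigensystem a b m N φ ev) {A B : ℝ}
    (ha : ∀ n, |a n| ≤ A) (hb : ∀ n ∈ box m N, |b n| ≤ B) (i : ι) : |ev i| ≤ 2 * A + B := by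
  have hne : (box m N).Nonempty := ⟨m, mem_box.2 (by simp)⟩
  obtain ⟨n, hn, hmax⟩ := Finset.exists_max_image (box m N) (fun n => |φ i n|) hne
  have hmax' (k : ℤ) : |φ i k| ≤ |φ i n| := by
    by_cases hk : k ∈ box m N
    · exact hmax k hk
    · rw [h.eq_zero i k hk, abs_zero]; exact abs_nonneg _
  have hpos : 0 < |φ i n| := by
    by_contra hcon
    have h0 : ∀ k, φ i k = 0 := fun k =>
      abs_nonpos_iff.1 ((hmax' k).trans (not_lt.1 hcon))
    have := h.norm_one i
    simp [h0] at this
  have hA : 0 ≤ A := (abs_nonneg _).trans (ha 0)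
  have h1 : |ev i| * |φ i n| ≤ (2 * A + B) * |φ i n| := by
    rw [← abs_mul, ← h.eigen i n hn, formalJacobi_apply]
    calc _ ≤ |a n * φ i (n + 1)| + |a (n - 1) * φ i (n - 1)| + |b n * φ i n| :=
          abs_add_three _ _ _
      _ ≤ A * |φ i n| + A * |φ i n| + B * |φ i n| := by
          simp only [abs_mul]
          exact add_le_add (add_le_add (mul_le_mul (ha _) (hmax' _) (abs_nonneg _) hA)
            (mul_le_mul (ha _) (hmax' _) (abs_nonneg _) hA))
            (mul_le_mul_of_nonneg_right (hb n hn) (abs_nonneg _))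
      _ = _ := by ring
  exact le_of_mul_le_mul_right h1 hpos

end Box

/-! ### Half-line solutions with a Dirichlet condition at the far end -/

/-- `u` is, as a polynomial in the energy, the solution of the Jacobi equation with couplings `α`
and potential `v` on the sites `0, …, N` of a half-line, normalized at `N` and vanishing at
`N + 1`. -/
structure IsHalfSolution (α v : ℕ → ℝ) (N : ℕ) (u : ℕ → Polynomial ℝ) : Prop where
  end_zero : u (N + 1) = 0
  end_one : u N = 1
  step : ∀ k < N, Polynomial.C (α k) * u k
    = (Polynomial.X - Polynomial.C (v (k + 1))) * u (k + 1) - Polynomial.C (α (k + 1)) * u (k + 2)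

theorem exists_isHalfSolution {α : ℕ → ℝ} (hα : ∀ k, α k ≠ 0) (v : ℕ → ℝ) (N : ℕ) :
    ∃ u, IsHalfSolution α v N u := by
  induction N generalizing α v with
  | zero => exact ⟨fun k => if k = 0 then 1 else 0, by simp, by simp, by simp⟩
  | succ N ih =>
    obtain ⟨u, hu⟩ := ih (α := fun k => α (k + 1)) (fun k => hα _) (fun k => v (k + 1))
    refine ⟨fun k => Nat.casesOn k (Polynomial.C (α 0)⁻¹ *
      ((Polynomial.X - Polynomial.C (v 1)) * u 0 - Polynomial.C (α 1) * u 1)) u,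
      hu.end_zero, hu.end_one, fun k hk => ?_⟩
    cases k with
    | zero =>
      change Polynomial.C (α 0) * (Polynomial.C (α 0)⁻¹ * _) = _
      rw [← mul_assoc, ← Polynomial.C_mul, mul_inv_cancel₀ (hα 0), Polynomial.C_1, one_mul]
    | succ k => exact hu.step k (by omega)

namespace IsHalfSolution

variable {α v : ℕ → ℝ} {N : ℕ} {u : ℕ → Polynomial ℝ}

theorem eval_step (h : IsHalfSolution α v N u) (E : ℝ) {k : ℕ} (hk : k < N) :
    α k * (u k).eval E
      = (E - v (k + 1)) * (u (k + 1)).eval E - α (k + 1) * (u (k + 2)).eval E := by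
  simpa using congrArg (Polynomial.eval E) (h.step k hk)

theorem eval_derivative_step (h : IsHalfSolution α v N u) (E : ℝ) {k : ℕ} (hk : k < N) :
    α k * (u k).derivative.eval E
      = (u (k + 1)).eval E + (E - v (k + 1)) * (u (k + 1)).derivative.eval E
        - α (k + 1) * (u (k + 2)).derivative.eval E := by
  simpa using congrArg (Polynomial.eval E) (congrArg Polynomial.derivative (h.step k hk))

/-- This is the Christoffel–Darboux identity: the recursion and its energy derivative are combined
and telescoped from the far end, where `u (N + 1) = 0`. It makes the derivative of `u 1 / u 0` minus
a sum of squares, up to a factor. -/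
theorem wronskian (h : IsHalfSolution α v N u) (E : ℝ) (i k : ℕ) (hik : k + i = N) :
    α k * ((u (k + 1)).derivative.eval E * (u k).eval E
        - (u (k + 1)).eval E * (u k).derivative.eval E)
      = -∑ j ∈ Finset.range i, (u (k + 1 + j)).eval E ^ 2 := by
  induction i generalizing k with
  | zero =>
    obtain rfl : k = N := by omega
    simp [h.end_zero]
  | succ i ih =>
    have h1 := ih (k + 1) (by omega)
    have h2 := h.eval_step E (k := k) (by omega)
    have h3 := h.eval_derivative_step E (k := k) (by omega)
    have h4 : ∑ j ∈ Finset.range i, (u (k + 1 + (j + 1))).eval E ^ 2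
        = ∑ j ∈ Finset.range i, (u (k + 1 + 1 + j)).eval E ^ 2 :=
      Finset.sum_congr rfl fun j _ => by rw [show k + 1 + (j + 1) = k + 1 + 1 + j by ring]
    rw [Finset.sum_range_succ', h4, add_zero]
    linear_combination h1 + (u (k + 1)).derivative.eval E * h2 - (u (k + 1)).eval E * h3

/-- If `u k` vanished identically, the Wronskian identity at one energy (here `0`) would kill a sum
of squares containing `u N = 1`. -/
theorem ne_zero (h : IsHalfSolution α v N u) {k : ℕ} (hk : k ≤ N) : u k ≠ 0 := by
  intro h0
  rcases hk.eq_or_lt with rfl | hk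
  · rw [h.end_one] at h0
    exact one_ne_zero h0
  · have h1 := h.wronskian 0 (N - k) k (by omega)
    rw [h0] at h1
    simp only [Polynomial.derivative_zero, Polynomial.eval_zero, mul_zero, sub_zero] at h1
    have h2 : ∀ j ∈ Finset.range (N - k), (u (k + 1 + j)).eval (0 : ℝ) ^ 2 = 0 :=
      (Finset.sum_eq_zero_iff_of_nonneg fun j _ => sq_nonneg _).1 (by linarith)
    have h3 := h2 (N - k - 1) (Finset.mem_range.2 (by omega))
    rw [show k + 1 + (N - k - 1) = N by omega, h.end_one] at h3
    simp at h3

theorem ratioChain_eq (h : IsHalfSolution α v N u) {E : ℝ} (hα : ∀ k, α k ≠ 0)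
    (hE : ∀ k ≤ N, (u k).eval E ≠ 0) (i k : ℕ) (hik : k + i = N) :
    ratioChain α (fun j => E - v j) i k = α k * ((u (k + 1)).eval E / (u k).eval E) := by
  induction i generalizing k with
  | zero =>
    obtain rfl : k = N := by omega
    simp [ratioChain, h.end_zero]
  | succ i ih =>
    rw [ratioChain, ih (k + 1) (by omega)]
    have h2 := h.eval_step E (k := k) (by omega)
    have h3 := hE k (by omega)
    have h4 := hE (k + 1) (by omega)
    have h5 : E - v (k + 1) - α (k + 1) * ((u (k + 1 + 1)).eval E / (u (k + 1)).eval E)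
        = α k * (u k).eval E / (u (k + 1)).eval E := by
      field_simp
      linear_combination -h2
    have h6 := hα k
    rw [h5]
    field_simp

theorem chainWeight_eq (h : IsHalfSolution α v N u) {E : ℝ} (hα : ∀ k, α k ≠ 0)
    (hE : ∀ k ≤ N, (u k).eval E ≠ 0) (l n k : ℕ) (hk : k + (l + n) = N) :
    chainWeight α (fun j => E - v j) l n k = |(u (k + n)).eval E / (u k).eval E| := by
  induction n generalizing k with
  | zero => simp [chainWeight, hE k (by omega)]
  | succ n ih =>
    rw [chainWeight, ih (k + 1) (by omega), h.ratioChain_eq hα hE (l + n) (k + 1) (by omega)]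
    have h2 := h.eval_step E (k := k) (by omega)
    have h3 := hE k (by omega)
    have h4 := hE (k + 1) (by omega)
    have h5 : E - v (k + 1) - α (k + 1) * ((u (k + 1 + 1)).eval E / (u (k + 1)).eval E)
        = α k * (u k).eval E / (u (k + 1)).eval E := by
      field_simp
      linear_combination -h2
    have h6 := hα k
    rw [h5, ← abs_mul, show k + 1 + n = k + (n + 1) by ring]
    congr 1
    field_simp

/-- The Dirichlet condition at `N + 1` and the value at `N` determine a solution by backward
recursion. -/
theorem eq_mul_eval (h : IsHalfSolution α v N u) (hα : ∀ k, α k ≠ 0) {E : ℝ} {f : ℕ → ℝ}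
    (hf0 : f (N + 1) = 0)
    (hf : ∀ k < N, α k * f k = (E - v (k + 1)) * f (k + 1) - α (k + 1) * f (k + 2))
    (i k : ℕ) (hik : k + i = N) :
    f k = f N * (u k).eval E ∧ f (k + 1) = f N * (u (k + 1)).eval E := by
  induction i generalizing k with
  | zero =>
    obtain rfl : k = N := by omega
    simp [h.end_zero, h.end_one, hf0]
  | succ i ih =>
    obtain ⟨h1, h2⟩ := ih (k + 1) (by omega)
    refine ⟨?_, h1⟩
    have h3 := h.eval_step E (k := k) (by omega)
    have h4 := hf k (by omega)
    refine mul_left_cancel₀ (hα k) ?_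
    rw [h4, h1, h2]
    linear_combination -(f N) * h3

end IsHalfSolution

/-! ### The two half-lines at a base site -/

/-- The `k`-th site to the right (`σ = 1`) or left (`σ = -1`) of `m`. -/
def raySite (m σ : ℤ) (k : ℕ) : ℤ := m + σ * k

/-- The coupling between the `k`-th and the `k + 1`-st site of a half-line. -/
def rayCoupling (a : ℤ → ℝ) (m σ : ℤ) (k : ℕ) : ℝ :=
  a (min (raySite m σ k) (raySite m σ (k + 1)))

section Ray

variable {σ : ℤ} (hσ : σ = 1 ∨ σ = -1)
include hσ

theorem raySite_injective (m : ℤ) : Function.Injective (raySite m σ) := by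
  intro i j h
  unfold raySite at h
  rcases hσ with rfl | rfl <;> omega

theorem raySite_ne (m : ℤ) (i j : ℕ) (hi : 0 < i) : raySite m σ j ≠ raySite m (-σ) i := by
  unfold raySite
  rcases hσ with rfl | rfl <;> omega

theorem raySite_succ_ne (m : ℤ) (k : ℕ) : raySite m σ (k + 1) ≠ m := by
  unfold raySite
  rcases hσ with rfl | rfl <;> omega

theorem raySite_mem_box (m : ℤ) {k N : ℕ} : raySite m σ k ∈ box m N ↔ k ≤ N := by
  rw [mem_box]
  unfold raySite
  rcases hσ with rfl | rfl <;> omega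

theorem formalJacobi_raySite (a b φ : ℤ → ℝ) (m : ℤ) (k : ℕ) :
    formalJacobi a b φ (raySite m σ (k + 1))
      = rayCoupling a m σ (k + 1) * φ (raySite m σ (k + 2))
        + rayCoupling a m σ k * φ (raySite m σ k)
        + b (raySite m σ (k + 1)) * φ (raySite m σ (k + 1)) := by
  rw [formalJacobi_apply]
  unfold rayCoupling
  rcases hσ with rfl | rfl
  · rw [show min (raySite m 1 (k + 1)) (raySite m 1 (k + 1 + 1)) = raySite m 1 (k + 1) by
        unfold raySite; omega,
      show min (raySite m 1 k) (raySite m 1 (k + 1)) = raySite m 1 (k + 1) - 1 by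
        unfold raySite; omega,
      show raySite m 1 (k + 1) + 1 = raySite m 1 (k + 2) by unfold raySite; push_cast; ring,
      show raySite m 1 (k + 1) - 1 = raySite m 1 k by unfold raySite; push_cast; ring]
  · rw [show min (raySite m (-1) (k + 1)) (raySite m (-1) (k + 1 + 1))
          = raySite m (-1) (k + 1) - 1 by unfold raySite; omega,
      show min (raySite m (-1) k) (raySite m (-1) (k + 1)) = raySite m (-1) (k + 1) by
        unfold raySite; omega,
      show raySite m (-1) (k + 1) + 1 = raySite m (-1) k by unfold raySite; push_cast; ring,
      show raySite m (-1) (k + 1) - 1 = raySite m (-1) (k + 2) by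
        unfold raySite; push_cast; ring]
    ring

theorem formalJacobi_base (a b φ : ℤ → ℝ) (m : ℤ) :
    formalJacobi a b φ m
      = rayCoupling a m σ 0 * φ (raySite m σ 1)
        + rayCoupling a m (-σ) 0 * φ (raySite m (-σ) 1) + b m * φ m := by
  have h0 (τ : ℤ) : raySite m τ 0 = m := by simp [raySite]
  have h1 : raySite m 1 1 = m + 1 := by simp [raySite]
  have h2 : raySite m (-1) 1 = m - 1 := by simp [raySite]; ring
  rw [formalJacobi_apply]
  unfold rayCoupling
  rcases hσ with rfl | rfl
  · rw [zero_add, h0, h1, h0, h2, min_eq_left (by omega), min_eq_right (by omega)]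
  · rw [neg_neg, zero_add, h0, h1, h0, h2, min_eq_right (by omega), min_eq_left (by omega)]
    ring

theorem sum_box_eq (g : ℤ → ℝ) (m : ℤ) (N : ℕ) :
    ∑ n ∈ box m N, g n = g m + ∑ k ∈ Finset.range N, g (raySite m σ (k + 1))
      + ∑ k ∈ Finset.range N, g (raySite m (-σ) (k + 1)) := by
  wlog h : σ = 1 generalizing σ
  · have hσ' : -σ = 1 ∨ -σ = -1 := by omega
    have := this hσ' (by omega)
    rw [this, neg_neg]
    ring
  subst h
  induction N with
  | zero => simp [box]
  | succ N ih =>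
    have h1 : box m (N + 1) = insert (raySite m 1 (N + 1))
        (insert (raySite m (-1) (N + 1)) (box m N)) := by
      ext n
      simp only [Finset.mem_insert, mem_box, raySite]
      push_cast
      omega
    rw [h1, Finset.sum_insert, Finset.sum_insert, ih, Finset.sum_range_succ,
      Finset.sum_range_succ]
    · ring
    · rw [mem_box]; unfold raySite; push_cast; omega
    · rw [Finset.mem_insert, mem_box]; unfold raySite; push_cast; omega

end Ray

section RayEigen

variable {a b : ℤ → ℝ} {m : ℤ} {N : ℕ} {ι : Type} [Fintype ι] {φ : ι → ℤ → ℝ} {ev : ι → ℝ}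

/-- On a half-line an eigenfunction is a multiple of the half-line solution. -/
theorem IsBoxEigensystem.eq_on_ray (h : IsBoxEigensystem a b m N φ ev) {σ : ℤ}
    (hσ : σ = 1 ∨ σ = -1) (ha : ∀ n, 0 < a n) {v : ℕ → ℝ}
    (hv : ∀ k, v (k + 1) = b (raySite m σ (k + 1))) {u : ℕ → Polynomial ℝ}
    (hu : IsHalfSolution (rayCoupling a m σ) v N u) (i : ι) (him : φ i m ≠ 0) :
    (u 0).eval (ev i) ≠ 0 ∧ ∀ k ≤ N, φ i (raySite m σ k)
      = φ i m * ((u k).eval (ev i) / (u 0).eval (ev i)) := by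
  have hα : ∀ k, rayCoupling a m σ k ≠ 0 := fun k => (ha _).ne'
  have key := hu.eq_mul_eval hα (E := ev i) (f := fun k => φ i (raySite m σ k))
    (h.eq_zero i _ fun hm => by rw [raySite_mem_box hσ] at hm; omega)
    (fun k hk => by
      have h1 := h.eigen i (raySite m σ (k + 1)) ((raySite_mem_box hσ m).2 (by omega))
      rw [formalJacobi_raySite hσ] at h1
      rw [hv]
      linear_combination h1)
  have h0 : φ i m = φ i (raySite m σ N) * (u 0).eval (ev i) := by
    simpa [raySite] using (key N 0 (by omega)).1
  have hu0 : (u 0).eval (ev i) ≠ 0 := fun h' => him (by rw [h0, h', mul_zero])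
  refine ⟨hu0, fun k hk => ?_⟩
  rw [(key (N - k) k (by omega)).1, h0]
  field_simp

end RayEigen

/-! ### Spectral averaging over the potential at the base site -/

/-- The value of the potential at the base site for which `E` is an eigenvalue, in terms of the
half-line solutions. -/
def baseValue (α β : ℝ) (u w : ℕ → Polynomial ℝ) (E : ℝ) : ℝ :=
  E - α * ((u 1).eval E / (u 0).eval E) - β * ((w 1).eval E / (w 0).eval E)

/-- The derivative of `baseValue`. -/
def baseSlope (N : ℕ) (u w : ℕ → Polynomial ℝ) (E : ℝ) : ℝ :=
  1 + ∑ k ∈ Finset.range N, ((u (k + 1)).eval E / (u 0).eval E) ^ 2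
    + ∑ k ∈ Finset.range N, ((w (k + 1)).eval E / (w 0).eval E) ^ 2

theorem IsHalfSolution.hasDerivAt_ratio {α v : ℕ → ℝ} {N : ℕ} {u : ℕ → Polynomial ℝ}
    (h : IsHalfSolution α v N u) {E : ℝ} (hE : (u 0).eval E ≠ 0) :
    HasDerivAt (fun E => α 0 * ((u 1).eval E / (u 0).eval E))
      (-∑ k ∈ Finset.range N, ((u (k + 1)).eval E / (u 0).eval E) ^ 2) E := by
  have h1 := (((u 1).hasDerivAt E).div ((u 0).hasDerivAt E) hE).const_mul (α 0)
  refine h1.congr_deriv ?_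
  have h2 := h.wronskian E N 0 (by omega)
  simp only [zero_add] at h2
  simp only [div_pow, ← Finset.sum_div]
  rw [← neg_div, show (∑ k ∈ Finset.range N, (u (k + 1)).eval E ^ 2)
    = ∑ k ∈ Finset.range N, (u (1 + k)).eval E ^ 2 from
      Finset.sum_congr rfl fun k _ => by rw [add_comm], ← h2, mul_div_assoc]

theorem hasDerivAt_baseValue {α β v v' : ℕ → ℝ} {N : ℕ} {u w : ℕ → Polynomial ℝ}
    (hu : IsHalfSolution α v N u) (hw : IsHalfSolution β v' N w) {E : ℝ}
    (hEu : (u 0).eval E ≠ 0) (hEw : (w 0).eval E ≠ 0) :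
    HasDerivAt (baseValue (α 0) (β 0) u w) (baseSlope N u w E) E := by
  refine (((hasDerivAt_id E).sub (hu.hasDerivAt_ratio hEu)).sub
    (hw.hasDerivAt_ratio hEw)).congr_deriv ?_
  rw [baseSlope]
  ring

theorem baseSlope_pos (N : ℕ) (u w : ℕ → Polynomial ℝ) (E : ℝ) : 0 < baseSlope N u w E := by
  have h1 : 0 ≤ ∑ k ∈ Finset.range N, ((u (k + 1)).eval E / (u 0).eval E) ^ 2 :=
    Finset.sum_nonneg fun k _ => sq_nonneg _
  have h2 : 0 ≤ ∑ k ∈ Finset.range N, ((w (k + 1)).eval E / (w 0).eval E) ^ 2 :=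
    Finset.sum_nonneg fun k _ => sq_nonneg _
  rw [baseSlope]
  linarith

section Eigen

variable {a b : ℤ → ℝ} {m : ℤ} {N : ℕ} {ι : Type} [Fintype ι] {φ : ι → ℤ → ℝ} {ev : ι → ℝ}
  {σ : ℤ} {v v' : ℕ → ℝ} {u w : ℕ → Polynomial ℝ}

/-- This is the normalization of `φ i` with `φ i m ^ 2` factored out along both rays. It identifies
the eigenvector weight at the base site with the reciprocal Jacobian of `baseValue`. -/
theorem IsBoxEigensystem.sq_mul_baseSlope (h : IsBoxEigensystem a b m N φ ev)
    (hσ : σ = 1 ∨ σ = -1) (ha : ∀ n, 0 < a n)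
    (hv : ∀ k, v (k + 1) = b (raySite m σ (k + 1)))
    (hv' : ∀ k, v' (k + 1) = b (raySite m (-σ) (k + 1)))
    (hu : IsHalfSolution (rayCoupling a m σ) v N u)
    (hw : IsHalfSolution (rayCoupling a m (-σ)) v' N w) (i : ι) (him : φ i m ≠ 0) :
    φ i m ^ 2 * baseSlope N u w (ev i) = 1 := by
  have hσ' : -σ = 1 ∨ -σ = -1 := by omega
  rw [← h.norm_one i, sum_box_eq hσ, baseSlope, mul_add, mul_add, mul_one, Finset.mul_sum,
    Finset.mul_sum]
  refine congrArg₂ (· + ·) (congrArg₂ (· + ·) rfl ?_) ?_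
  · refine Finset.sum_congr rfl fun k hk => ?_
    rw [(h.eq_on_ray hσ ha hv hu i him).2 _ (Finset.mem_range.1 hk), mul_pow]
  · refine Finset.sum_congr rfl fun k hk => ?_
    rw [(h.eq_on_ray hσ' ha hv' hw i him).2 _ (Finset.mem_range.1 hk), mul_pow]

theorem IsBoxEigensystem.baseValue_eq (h : IsBoxEigensystem a b m N φ ev)
    (hσ : σ = 1 ∨ σ = -1) (ha : ∀ n, 0 < a n)
    (hv : ∀ k, v (k + 1) = b (raySite m σ (k + 1)))
    (hv' : ∀ k, v' (k + 1) = b (raySite m (-σ) (k + 1)))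
    (hu : IsHalfSolution (rayCoupling a m σ) v N u)
    (hw : IsHalfSolution (rayCoupling a m (-σ)) v' N w) (hN : 1 ≤ N) (i : ι)
    (him : φ i m ≠ 0) :
    baseValue (rayCoupling a m σ 0) (rayCoupling a m (-σ) 0) u w (ev i) = b m := by
  have hσ' : -σ = 1 ∨ -σ = -1 := by omega
  have h1 := h.eigen i m (mem_box.2 (by simp))
  rw [formalJacobi_base hσ, (h.eq_on_ray hσ ha hv hu i him).2 1 hN,
    (h.eq_on_ray hσ' ha hv' hw i him).2 1 hN] at h1
  rw [baseValue]
  refine mul_left_cancel₀ him ?_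
  linear_combination -h1

/-- Two eigenfunctions with the same eigenvalue, both nonzero at `m`, are multiples of the same pair
of half-line solutions, contradicting orthogonality. -/
theorem IsBoxEigensystem.injOn_ev (h : IsBoxEigensystem a b m N φ ev) (ha : ∀ n, 0 < a n) :
    Set.InjOn ev {i | φ i m ≠ 0} := by
  intro i hi j hj hij
  by_contra hne
  have hi : φ i m ≠ 0 := hi
  have hj : φ j m ≠ 0 := hj
  have h1 : (1 : ℤ) = 1 ∨ (1 : ℤ) = -1 := Or.inl rfl
  have h2 : -(1 : ℤ) = 1 ∨ -(1 : ℤ) = -1 := Or.inr rfl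
  obtain ⟨u, hu⟩ := exists_isHalfSolution (α := rayCoupling a m 1) (fun k => (ha _).ne')
    (fun k => b (raySite m 1 k)) N
  obtain ⟨w, hw⟩ := exists_isHalfSolution (α := rayCoupling a m (-1)) (fun k => (ha _).ne')
    (fun k => b (raySite m (-1) k)) N
  have key : ∑ n ∈ box m N, φ i n * φ j n = φ j m / φ i m * ∑ n ∈ box m N, φ i n ^ 2 := by
    rw [Finset.mul_sum]
    have hprop : ∀ n ∈ box m N, φ j n = φ j m / φ i m * φ i n := by
      intro n hn
      rw [mem_box] at hn
      rcases le_total m n with hmn | hmn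
      · obtain ⟨k, rfl⟩ := Int.le.dest hmn
        have hs : m + (k : ℤ) = raySite m 1 k := by simp [raySite]
        rw [hs, (h.eq_on_ray h1 ha (fun _ => rfl) hu i hi).2 k (by omega),
          (h.eq_on_ray h1 ha (fun _ => rfl) hu j hj).2 k (by omega), hij]
        field_simp
      · obtain ⟨k, hk⟩ := Int.le.dest hmn
        have hs : n = raySite m (-1) k := by simp only [raySite]; omega
        rw [hs, (h.eq_on_ray h2 ha (fun _ => rfl) hw i hi).2 k (by omega),
          (h.eq_on_ray h2 ha (fun _ => rfl) hw j hj).2 k (by omega), hij]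
        field_simp
    refine Finset.sum_congr rfl fun n hn => ?_
    rw [hprop n hn]
    ring
  rw [h.orthogonal i j hne, h.norm_one i, mul_one] at key
  exact div_ne_zero hj hi key.symm

end Eigen

/-- Averaging the eigenfunction correlator over the potential at the base site turns it into an
integral over energies of the weight of the chain of ratios. -/
theorem setLIntegral_correlator_le {a : ℤ → ℝ} (ha : ∀ n, 0 < a n) {σ : ℤ}
    (hσ : σ = 1 ∨ σ = -1) (b : ℤ → ℝ) (m : ℤ) (l n : ℕ) {I T : Set ℝ}
    (hI : MeasurableSet I) (hT : MeasurableSet T) {F : ℝ → ℝ≥0∞}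
    (hF : ∀ x ∈ T, ∀ (ι : Type) (_ : Fintype ι) (φ : ι → ℤ → ℝ) (ev : ι → ℝ),
      IsBoxEigensystem a (Function.update b m x) m (l + (n + 1)) φ ev →
      (∀ i, ev i ∈ I) ∧ F x ≤ ∑ i, ENNReal.ofReal |φ i m * φ i (raySite m σ (n + 1))|) :
    ∫⁻ x in T, F x ≤ ∫⁻ E in I, T.indicator 1
        (E - ratioChain (rayCoupling a m σ) (fun k => E - b (raySite m σ k)) (l + (n + 1)) 0
          - ratioChain (rayCoupling a m (-σ)) (fun k => E - b (raySite m (-σ) k))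
              (l + (n + 1)) 0) *
      ENNReal.ofReal (chainWeight (rayCoupling a m σ) (fun k => E - b (raySite m σ k)) l
        (n + 1) 0) := by
  classical
  have hσ' : -σ = 1 ∨ -σ = -1 := by omega
  set N := l + (n + 1) with hN
  have hα : ∀ k, rayCoupling a m σ k ≠ 0 := fun k => (ha _).ne'
  have hβ : ∀ k, rayCoupling a m (-σ) k ≠ 0 := fun k => (ha _).ne'
  obtain ⟨u, hu⟩ := exists_isHalfSolution hα (fun k => b (raySite m σ k)) N
  obtain ⟨w, hw⟩ := exists_isHalfSolution hβ (fun k => b (raySite m (-σ) k)) N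
  -- These are the possible poles of `baseValue`; its increasing branches live on the gaps between
  -- them.
  set Z : Finset ℝ := (u 0).roots.toFinset ∪ (w 0).roots.toFinset with hZ
  have hZmem (E : ℝ) : E ∉ Z ↔ (u 0).eval E ≠ 0 ∧ (w 0).eval E ≠ 0 := by
    rw [hZ, Finset.mem_union, Multiset.mem_toFinset, Multiset.mem_toFinset, not_or,
      Polynomial.mem_roots (hu.ne_zero (Nat.zero_le _)),
      Polynomial.mem_roots (hw.ne_zero (Nat.zero_le _)), Polynomial.IsRoot, Polynomial.IsRoot]
  have hpm (p : Polynomial ℝ) : Measurable fun E => p.eval E := p.continuous.measurable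
  set h := baseValue (rayCoupling a m σ 0) (rayCoupling a m (-σ) 0) u w with hh
  set h' := baseSlope N u w with hh'
  have hm : Measurable h := by
    simp only [hh]; unfold baseValue; fun_prop
  have hm' : Measurable h' := by
    simp only [hh']; unfold baseSlope; fun_prop
  set g : ℝ → ℝ≥0∞ := fun E => ENNReal.ofReal |(u (n + 1)).eval E / (u 0).eval E| with hg
  have hgm : Measurable g := by
    simp only [hg, ← Real.norm_eq_abs]; fun_prop
  have hfib : ∀ x ∈ T, ∃ S : Finset ℝ, (∀ E ∈ S, E ∈ I ∧ E ∉ Z ∧ h E = x) ∧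
      F x ≤ ∑ E ∈ S, g E / ENNReal.ofReal (h' E) := by
    intro x hx
    obtain ⟨ι, hι, φ, ev, hsys⟩ := exists_isBoxEigensystem a (Function.update b m x) m N
    obtain ⟨hevI, hFx⟩ := hF x hx ι hι φ ev hsys
    have hv (k : ℕ) : b (raySite m σ (k + 1))
        = Function.update b m x (raySite m σ (k + 1)) := by
      rw [Function.update_of_ne (raySite_succ_ne hσ m k)]
    have hv' (k : ℕ) : b (raySite m (-σ) (k + 1))
        = Function.update b m x (raySite m (-σ) (k + 1)) := by
      rw [Function.update_of_ne (raySite_succ_ne hσ' m k)]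
    -- Eigenfunctions vanishing at `m` contribute nothing to the correlator, and only for the others
    -- is the eigenvalue tied to `x` through `baseValue`.
    set J : Finset ι := Finset.univ.filter fun i => φ i m ≠ 0 with hJ
    have hJm {i : ι} (hi : i ∈ J) : φ i m ≠ 0 := (Finset.mem_filter.1 hi).2
    refine ⟨J.image ev, fun E hE => ?_, hFx.trans ?_⟩
    · obtain ⟨i, hi, rfl⟩ := Finset.mem_image.1 hE
      refine ⟨hevI i, (hZmem _).2 ⟨?_, ?_⟩, ?_⟩
      · exact (hsys.eq_on_ray hσ ha hv hu i (hJm hi)).1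
      · exact (hsys.eq_on_ray hσ' ha hv' hw i (hJm hi)).1
      · rw [hh, hsys.baseValue_eq hσ ha hv hv' hu hw (by omega) i (hJm hi),
          Function.update_self]
    · rw [Finset.sum_image ((hsys.injOn_ev ha).mono fun i hi => hJm hi)]
      rw [← Finset.sum_subset (Finset.subset_univ J) fun i _ hi => ?_]
      · refine Finset.sum_le_sum fun i hi => le_of_eq ?_
        have h1 := hsys.sq_mul_baseSlope hσ ha hv hv' hu hw i (hJm hi)
        have h2 := baseSlope_pos N u w (ev i)
        rw [hg, ← ENNReal.ofReal_div_of_pos h2,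
          (hsys.eq_on_ray hσ ha hv hu i (hJm hi)).2 (n + 1) (by omega), ← mul_assoc, abs_mul,
          ← sq, abs_of_nonneg (sq_nonneg _), eq_div_of_mul_eq h2.ne' h1]
        congr 1
        ring
      · have : φ i m = 0 := by
          by_contra hne
          exact hi (Finset.mem_filter.2 ⟨Finset.mem_univ i, hne⟩)
        simp [this]
  refine (setLIntegral_le_of_fiber_sum hm hm'
    (fun E hE => hasDerivAt_baseValue hu hw ((hZmem E).1 hE).1 ((hZmem E).1 hE).2)
    (fun E _ => baseSlope_pos N u w E) hgm hI hT hfib).trans (le_of_eq ?_)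
  refine lintegral_congr_ae (ae_restrict_of_ae ?_)
  -- The Riccati chain can be read as ratios of `u` and `w` only where none of their terms vanishes;
  -- the exceptional energies form a null set.
  have hfin : (⋃ k ∈ Finset.range (N + 1), {E | (u k).eval E = 0 ∨ (w k).eval E = 0}).Finite := by
    refine Set.Finite.biUnion (Finset.finite_toSet _) fun k hk => ?_
    have hk : k ≤ N := Nat.lt_succ_iff.1 (Finset.mem_range.1 hk)
    exact (Polynomial.finite_setOfPred_isRoot (hu.ne_zero hk)).union
      (Polynomial.finite_setOfPred_isRoot (hw.ne_zero hk))
  have hae := compl_mem_ae_iff.2 (hfin.measure_zero volume)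
  filter_upwards [hae] with E hE
  simp only [Set.mem_compl_iff, Set.mem_iUnion, not_exists] at hE
  have hEu : ∀ k ≤ N, (u k).eval E ≠ 0 := fun k hk h0 =>
    hE k (Finset.mem_range.2 (by omega)) (Or.inl h0)
  have hEw : ∀ k ≤ N, (w k).eval E ≠ 0 := fun k hk h0 =>
    hE k (Finset.mem_range.2 (by omega)) (Or.inr h0)
  rw [hu.ratioChain_eq hα hEu N 0 (by omega), hw.ratioChain_eq hβ hEw N 0 (by omega),
    hu.chainWeight_eq hα hEu l (n + 1) 0 (by omega), hh, baseValue]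
  simp only [zero_add, hg]

/-! ### The eigenfunction correlator -/

/-- Rational polynomials bounded by one on `[-K, K]`. -/
def unitPolys (K : ℝ) : Set (Polynomial ℚ) :=
  {p | ∀ x ∈ Set.Icc (-K) K, |(p.map (algebraMap ℚ ℝ)).eval x| ≤ 1}

/-- The supremum of `|⟨δ_n, p(J_ω) δ_m⟩|` over rational polynomials bounded by one on `[-K, K]`. -/
def correlator (a : ℤ → ℝ) (K : ℝ) (m n : ℤ) (ω : ℤ → ℝ) : ℝ≥0∞ :=
  ⨆ p : unitPolys K, ENNReal.ofReal |polyEntry a ω (p.1.map (algebraMap ℚ ℝ)) m n|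

theorem measurable_polyEntry (a : ℤ → ℝ) (p : Polynomial ℝ) (m n : ℤ) :
    Measurable fun ω => polyEntry a ω p m n := by
  have h (k : ℕ) (n : ℤ) :
      Measurable fun ω => ((formalJacobi a ω) ^ k) (Pi.single m 1) n := by
    induction k generalizing n with
    | zero => simp
    | succ k ih =>
      simp only [pow_succ', Module.End.mul_apply, formalJacobi_apply]
      exact (((ih (n + 1)).const_mul _).add ((ih (n - 1)).const_mul _)).add
        ((measurable_pi_apply n).mul (ih n))
  simp only [polyEntry, Polynomial.aeval_eq_sum_range, LinearMap.sum_apply, Finset.sum_apply,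
    LinearMap.smul_apply, Pi.smul_apply, smul_eq_mul]
  exact Finset.measurable_fun_sum _ fun k _ => (h k n).const_mul _

theorem measurable_ofReal_abs_polyEntry (a : ℤ → ℝ) (p : Polynomial ℝ) (m n : ℤ) :
    Measurable fun ω => ENNReal.ofReal |polyEntry a ω p m n| := by
  have := measurable_polyEntry a p m n
  simp only [← Real.norm_eq_abs]
  fun_prop

instance : Countable (Polynomial ℚ) :=
  Cardinal.mk_le_aleph0_iff.1 (Polynomial.cardinalMk_le_max.trans (by simp))

theorem measurable_correlator (a : ℤ → ℝ) (K : ℝ) (m n : ℤ) :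
    Measurable (correlator a K m n) :=
  Measurable.iSup fun _ => measurable_ofReal_abs_polyEntry _ _ _ _

theorem IsBoxEigensystem.abs_polyEntry_le {a b : ℤ → ℝ} {m : ℤ} {N : ℕ} {ι : Type} [Fintype ι]
    {φ : ι → ℤ → ℝ} {ev : ι → ℝ} (h : IsBoxEigensystem a b m N φ ev) {K : ℝ}
    (hev : ∀ i, ev i ∈ Set.Icc (-K) K) {p : Polynomial ℚ} (hp : p ∈ unitPolys K)
    (hdeg : p.natDegree ≤ N) (n : ℤ) :
    ENNReal.ofReal |polyEntry a b (p.map (algebraMap ℚ ℝ)) m n|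
      ≤ ∑ i, ENNReal.ofReal |φ i m * φ i n| := by
  rw [h.polyEntry_eq (Polynomial.natDegree_map_le.trans hdeg),
    ← ENNReal.ofReal_sum_of_nonneg fun i _ => abs_nonneg _]
  refine ENNReal.ofReal_le_ofReal ((Finset.abs_sum_le_sum_abs _ _).trans
    (Finset.sum_le_sum fun i _ => ?_))
  rw [mul_assoc, abs_mul]
  exact mul_le_of_le_one_left (abs_nonneg _) (hp _ (hev i))

/-- Monotone convergence along finite subsets. A finite family of polynomials has a common degree
bound, so one box serves all of them. -/
theorem lintegral_iSup_le_of_finset {Ω ι : Type*} [MeasurableSpace Ω] [Countable ι]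
    {μ : Measure Ω} {f : ι → Ω → ℝ≥0∞} (hf : ∀ i, Measurable (f i)) {D : ℝ≥0∞}
    (h : ∀ s : Finset ι, ∫⁻ ω, ⨆ i ∈ s, f i ω ∂μ ≤ D) : ∫⁻ ω, ⨆ i, f i ω ∂μ ≤ D := by
  classical
  have h1 : ∫⁻ ω, ⨆ i, f i ω ∂μ = ⨆ s : Finset ι, ∫⁻ ω, ⨆ i ∈ s, f i ω ∂μ := by
    rw [← lintegral_iSup_directed
      (fun s => (Measurable.iSup fun i => Measurable.iSup fun _ => hf i).aemeasurable)]
    · exact lintegral_congr fun ω => iSup_eq_iSup_finset _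
    · intro s t
      exact ⟨s ∪ t, fun ω => biSup_mono fun i hi => Finset.mem_union_left _ hi,
        fun ω => biSup_mono fun i hi => Finset.mem_union_right _ hi⟩
  rw [h1]
  exact iSup_le h

theorem restrict_le_of_compl_null {κ : Measure ℝ} {M : ℝ≥0∞} {T : Set ℝ} (hκ : κ ≤ M • volume)
    (hT : κ Tᶜ = 0) : κ ≤ M • volume.restrict T := by
  calc κ = κ.restrict T := (Measure.restrict_eq_self_of_ae_mem (mem_ae_iff.2 hT)).symm
    _ ≤ (M • volume).restrict T := Measure.restrict_mono le_rfl hκ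
    _ = _ := Measure.restrict_smul _ _ _

/-- The Kunz-Souillard bound on the expected eigenfunction correlator. -/
theorem exists_lintegral_correlator_bound (A B : ℝ) (hA : 0 < A) (hB : 0 ≤ B) :
    ∃ η : ℝ, 0 < η ∧ η ≤ 1 / 2 ∧ ∀ (κ : ℤ → Measure ℝ) (a : ℤ → ℝ) (M : ℝ) (m σ : ℤ) (n : ℕ)
      (D : ℝ≥0∞), (∀ i, IsProbabilityMeasure (κ i)) → (∀ i, κ i (Set.Icc (-B) B)ᶜ = 0) →
      (∀ i, 0 < a i) → (∀ i, a i ≤ A) → 1 ≤ M → (σ = 1 ∨ σ = -1) →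
      (∀ i, i ≤ n + 1 → κ (raySite m σ i) ≤ ENNReal.ofReal M • volume) →
      ENNReal.ofReal M * (ENNReal.ofReal (1 - η / M ^ 2) ^ (n / 2) * ENNReal.ofReal (2 * B))
        ≤ D ^ 2 →
      ∫⁻ ω, correlator a (2 * A + B) m (raySite m σ (n + 1)) ω ∂Measure.infinitePi κ
        ≤ ENNReal.ofReal M * (D * ENNReal.ofReal (2 * (2 * A + B))) := by
  classical
  obtain ⟨η, hη0, hη1, hη⟩ := exists_chainWeight_bound A hA
  refine ⟨η, hη0, hη1, fun κ a M m σ n D hprob hsupp ha haA hM hσ hκ hD => ?_⟩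
  set K := 2 * A + B with hK
  set μ := Measure.infinitePi κ with hμ
  refine lintegral_iSup_le_of_finset (fun p => measurable_ofReal_abs_polyEntry _ _ _ _)
    fun s => ?_
  -- The box radius `l + (n + 1)` exceeds every degree in `s`. The final bound does not depend on
  -- `l`, so the supremum over all `s` is harmless.
  set l := s.sup fun p => p.1.natDegree with hl
  set F : (ℤ → ℝ) → ℝ≥0∞ := fun ω => ⨆ p ∈ s, ENNReal.ofReal
    |polyEntry a ω (p.1.map (algebraMap ℚ ℝ)) m (raySite m σ (n + 1))| with hF
  have hFm : Measurable F :=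
    Measurable.iSup fun p => Measurable.iSup fun _ => measurable_ofReal_abs_polyEntry _ _ _ _
  set W : (ℤ → ℝ) → ℝ → ℝ≥0∞ := fun ω E => (Set.Icc (-B) B).indicator 1
        (E - ratioChain (rayCoupling a m σ) (fun k => E - ω (raySite m σ k)) (l + (n + 1)) 0
          - ratioChain (rayCoupling a m (-σ)) (fun k => E - ω (raySite m (-σ) k))
              (l + (n + 1)) 0) *
      ENNReal.ofReal (chainWeight (rayCoupling a m σ) (fun k => E - ω (raySite m σ k)) l
        (n + 1) 0) with hW
  have hInd : Measurable ((Set.Icc (-B) B).indicator (1 : ℝ → ℝ≥0∞)) :=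
    measurable_one.indicator measurableSet_Icc
  have hWm : Measurable (Function.uncurry W) := by
    simp only [hW, Function.uncurry_def]
    fun_prop
  have hκm : κ m ≤ ENNReal.ofReal M • volume.restrict (Set.Icc (-B) B) := by
    refine restrict_le_of_compl_null ?_ (hsupp m)
    simpa [raySite] using hκ 0 (Nat.zero_le _)
  have hgood : ∀ᵐ ω ∂μ, ∀ i, ω i ∈ Set.Icc (-B) B := by
    refine ae_all_iff.2 fun i => ?_
    have h1 : ∀ᵐ x ∂κ i, x ∈ Set.Icc (-B) B := mem_ae_iff.2 (hsupp i)
    rw [← Measure.infinitePi_map_eval κ i] at h1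
    exact ae_of_ae_map (measurable_pi_apply i).aemeasurable h1
  -- The law at the base site is replaced by `M` times Lebesgue measure on `[-B, B]`. All box
  -- eigenvalues then lie in `[-K, K]`, so polynomials in `unitPolys K` are at most one on them.
  have hstep : ∀ᵐ ω ∂μ, ∫⁻ x, F (Function.update ω m x) ∂κ m
      ≤ ENNReal.ofReal M * ∫⁻ E in Set.Icc (-K) K, W ω E := by
    filter_upwards [hgood] with ω hω
    calc ∫⁻ x, F (Function.update ω m x) ∂κ m
        ≤ ∫⁻ x, F (Function.update ω m x)
            ∂(ENNReal.ofReal M • volume.restrict (Set.Icc (-B) B)) := lintegral_mono' hκm le_rfl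
      _ = ENNReal.ofReal M * ∫⁻ x in Set.Icc (-B) B, F (Function.update ω m x) := by
          rw [lintegral_smul_measure, smul_eq_mul]
      _ ≤ _ := by
          refine mul_le_mul_right (setLIntegral_correlator_le ha hσ ω m l n measurableSet_Icc
            measurableSet_Icc fun x hx ι hι φ ev hsys => ?_) _
          have hev : ∀ i, ev i ∈ Set.Icc (-K) K := fun i => by
            refine abs_le.1 (hsys.abs_ev_le (A := A) (B := B)
              (fun k => by rw [abs_of_pos (ha k)]; exact haA k) (fun k _ => abs_le.2 ?_) i)
            by_cases hk : k = m
            · subst hk; rw [Function.update_self]; exact hx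
            · rw [Function.update_of_ne hk]; exact hω k
          refine ⟨hev, iSup₂_le fun p hp => hsys.abs_polyEntry_le hev p.2 ?_ _⟩
          have : p.1.natDegree ≤ l := Finset.le_sup (f := fun p => p.1.natDegree) hp
          omega
  calc ∫⁻ ω, F ω ∂μ = ∫⁻ ω, ∫⁻ x, F (Function.update ω m x) ∂κ m ∂μ :=
        lintegral_infinitePi_eq_update κ m hFm
    _ ≤ ∫⁻ ω, ENNReal.ofReal M * (∫⁻ E in Set.Icc (-K) K, W ω E) ∂μ := lintegral_mono_ae hstep
    _ = ENNReal.ofReal M * ∫⁻ E in Set.Icc (-K) K, ∫⁻ ω, W ω E ∂μ := by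
        rw [lintegral_const_mul _ (Measurable.lintegral_prod_right hWm),
          lintegral_lintegral_swap hWm.aemeasurable]
    _ ≤ ENNReal.ofReal M * ∫⁻ _ in Set.Icc (-K) K, D := by
        refine mul_le_mul_right (lintegral_mono fun E => ?_) _
        exact hη κ (raySite m σ) (raySite m (-σ)) _ _ E M B l n _ D hprob hM hB
          (raySite_injective hσ m) (fun i j hi => raySite_ne hσ m i j hi) hκ
          (fun i => ha _) (fun i => haA _) hD
    _ = _ := by
        rw [setLIntegral_const, Real.volume_Icc]
        congr 3
        ring

/-! ### Summability of the expected correlator -/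

theorem summable_rpow_mul_exp_neg_rpow {c a β : ℝ} (hc : 1 ≤ c) (ha : 0 < a) (hβ : 0 < β)
    (s : ℝ) : Summable fun n : ℕ => (c + n) ^ s * Real.exp (-a * (c + n) ^ β) := by
  have h1 : (fun x : ℝ => Real.exp (-a * x ^ β)) =o[Filter.atTop]
      fun x => (x ^ β) ^ ((-2 - s) / β) :=
    (isLittleO_exp_neg_mul_rpow_atTop ha ((-2 - s) / β)).comp_tendsto (tendsto_rpow_atTop hβ)
  have htop : Filter.Tendsto (fun n : ℕ => c + (n : ℝ)) Filter.atTop Filter.atTop :=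
    Filter.tendsto_atTop_add_const_left _ _ tendsto_natCast_atTop_atTop
  have h2 := (h1.comp_tendsto htop).isBigO
  have h3 : (fun n : ℕ => (c + n) ^ s * Real.exp (-a * (c + n) ^ β)) =O[Filter.atTop]
      fun n : ℕ => (n : ℝ) ^ (-2 : ℝ) := by
    refine ((Asymptotics.isBigO_refl (fun n : ℕ => (c + (n : ℝ)) ^ s) _).mul h2).trans ?_
    refine Asymptotics.IsBigO.of_bound 1 ?_
    filter_upwards [Filter.eventually_gt_atTop 0] with n hn
    have hn' : (0 : ℝ) < n := by exact_mod_cast hn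
    have hx : 0 < c + n := by linarith
    simp only [Function.comp]
    rw [← Real.rpow_mul hx.le, mul_div_cancel₀ _ hβ.ne', ← Real.rpow_add hx, one_mul,
      Real.norm_of_nonneg (by positivity), Real.norm_of_nonneg (by positivity)]
    rw [show s + (-2 - s) = -2 by ring]
    exact Real.rpow_le_rpow_of_nonpos hn' (by linarith) (by norm_num)
  exact summable_of_isBigO_nat (Real.summable_nat_rpow.2 (by norm_num)) h3

/-- Apply `1 - x ≤ exp (-x)`: about `n / 2` factors, each with `x` of order `n ^ (-2 * ζ)`. The
factor `exp (c + 1)` absorbs the shift `c` and the rounding in `n / 2`. -/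
theorem one_sub_pow_le_exp {η C ζ c : ℝ} (hη0 : 0 < η) (hη1 : η ≤ 1 / 2) (hC : 1 ≤ C)
    (hζ : 0 ≤ ζ) (hc : 1 ≤ c) (n : ℕ) :
    (1 - η / (C * (c + n) ^ ζ) ^ 2) ^ (n / 2)
      ≤ Real.exp (c + 1) * Real.exp (-(η / (2 * C ^ 2)) * (c + n) ^ (1 - 2 * ζ)) := by
  set x : ℝ := c + n with hx
  have hx1 : 1 ≤ x := by rw [hx]; have : (0 : ℝ) ≤ n := n.cast_nonneg; linarith
  have hxz : 1 ≤ x ^ ζ := Real.one_le_rpow hx1 hζ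
  have hCx : 1 ≤ (C * x ^ ζ) ^ 2 := one_le_pow₀ (one_le_mul_of_one_le_of_one_le hC hxz)
  have h0 : 0 ≤ 1 - η / (C * x ^ ζ) ^ 2 := by
    rw [sub_nonneg, div_le_one (by linarith)]; linarith
  have h1 : 1 - η / (C * x ^ ζ) ^ 2 ≤ Real.exp (-(η / (C * x ^ ζ) ^ 2)) :=
    Real.one_sub_le_exp_neg _
  refine (pow_le_pow_left₀ h0 h1 _).trans ?_
  rw [← Real.exp_nat_mul, ← Real.exp_add]
  refine Real.exp_le_exp.2 ?_
  have hfl : (n : ℝ) / 2 - 1 / 2 ≤ ((n / 2 : ℕ) : ℝ) := by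
    have : n ≤ 2 * (n / 2) + 1 := by omega
    have : (n : ℝ) ≤ 2 * ((n / 2 : ℕ) : ℝ) + 1 := by exact_mod_cast this
    linarith
  have hq : 0 ≤ η / (C * x ^ ζ) ^ 2 := by positivity
  have hq1 : η / (C * x ^ ζ) ^ 2 ≤ 1 := by linarith
  have hsplit : η / (2 * C ^ 2) * x ^ (1 - 2 * ζ) = η / (C * x ^ ζ) ^ 2 * (x / 2) := by
    rw [Real.rpow_sub (by linarith), Real.rpow_one, mul_comm 2 ζ, Real.rpow_mul (by linarith),
      Real.rpow_two]
    have : x ^ ζ ≠ 0 := by positivity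
    have : C ≠ 0 := by positivity
    field_simp
  rw [neg_mul, hsplit]
  have h3 : η / (C * x ^ ζ) ^ 2 * (x / 2 - ((n / 2 : ℕ) : ℝ)) ≤ c + 1 := by
    have h4 : x / 2 - ((n / 2 : ℕ) : ℝ) ≤ c + 1 := by rw [hx]; linarith
    calc _ ≤ η / (C * x ^ ζ) ^ 2 * (c + 1) := mul_le_mul_of_nonneg_left h4 hq
      _ ≤ 1 * (c + 1) := mul_le_mul_of_nonneg_right hq1 (by linarith)
      _ = _ := one_mul _
  linarith

/-- The expectations are summable, so by Tonelli the sum is almost surely finite. This is where `ζ <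
1 / 2` enters, as positivity of the exponent `1 - 2 * ζ`. -/
theorem ae_tsum_correlator_ne_top {A B C ζ : ℝ} (hA : 0 < A) (hB : 0 ≤ B) (hC : 1 ≤ C)
    (hζ0 : 0 ≤ ζ) (hζ : ζ < 1 / 2) {κ : ℤ → Measure ℝ} [hprob : ∀ i, IsProbabilityMeasure (κ i)]
    (hsupp : ∀ i, κ i (Set.Icc (-B) B)ᶜ = 0)
    (hκ : ∀ i : ℤ, κ i ≤ ENNReal.ofReal (C * (1 + |(i : ℝ)|) ^ ζ) • volume)
    {a : ℤ → ℝ} (ha : ∀ i, 0 < a i) (haA : ∀ i, a i ≤ A) (m : ℤ) {σ : ℤ}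
    (hσ : σ = 1 ∨ σ = -1) :
    ∀ᵐ ω ∂Measure.infinitePi κ,
      ∑' n : ℕ, correlator a (2 * A + B) m (raySite m σ (n + 1)) ω ≠ ∞ := by
  obtain ⟨η, hη0, hη1, hη⟩ := exists_lintegral_correlator_bound A B hA hB
  -- For `i ≤ n + 1` the `i`-th ray site satisfies `1 + |site| ≤ c + n`, so `M n` bounds all
  -- densities used at stage `n`.
  set c : ℝ := 2 + |(m : ℝ)| with hc
  have hc1 : 1 ≤ c := by have := abs_nonneg (m : ℝ); linarith
  set M : ℕ → ℝ := fun n => C * (c + n) ^ ζ with hM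
  have hx1 (n : ℕ) : 1 ≤ c + n := by have : (0 : ℝ) ≤ n := n.cast_nonneg; linarith
  have hM1 (n : ℕ) : 1 ≤ M n :=
    one_le_mul_of_one_le_of_one_le hC (Real.one_le_rpow (hx1 n) hζ0)
  set q : ℕ → ℝ := fun n => 1 - η / M n ^ 2 with hq
  have hq0 (n : ℕ) : 0 ≤ q n := by
    have : 1 ≤ M n ^ 2 := one_le_pow₀ (hM1 n)
    rw [hq, sub_nonneg, div_le_one (by linarith)]; linarith
  set D : ℕ → ℝ := fun n => √(M n * (q n ^ (n / 2) * (2 * B))) with hD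
  set T : ℕ → ℝ := fun n => M n * (D n * (2 * (2 * A + B))) with hT
  have hD0 (n : ℕ) : 0 ≤ M n * (q n ^ (n / 2) * (2 * B)) := by
    have := hM1 n; have := pow_nonneg (hq0 n) (n / 2); positivity
  have hbound (n : ℕ) : ∫⁻ ω, correlator a (2 * A + B) m (raySite m σ (n + 1)) ω
      ∂Measure.infinitePi κ ≤ ENNReal.ofReal (T n) := by
    have hMn := hM1 n
    have h1 := hη κ a (M n) m σ n (ENNReal.ofReal (D n)) hprob hsupp ha haA hMn hσ
      (fun i hi => ?_) ?_
    · refine h1.trans_eq ?_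
      change _ = ENNReal.ofReal (M n * (D n * (2 * (2 * A + B))))
      rw [ENNReal.ofReal_mul (by linarith : 0 ≤ M n),
        ENNReal.ofReal_mul (Real.sqrt_nonneg _ : 0 ≤ D n)]
    · refine (hκ _).trans ?_
      refine Measure.le_iff.2 fun S hS => ?_
      rw [Measure.smul_apply, Measure.smul_apply, smul_eq_mul, smul_eq_mul]
      refine mul_le_mul_left (ENNReal.ofReal_le_ofReal ?_) _
      refine mul_le_mul_of_nonneg_left (Real.rpow_le_rpow (by positivity) ?_ hζ0) (by linarith)
      have h2 : |((raySite m σ i : ℤ) : ℝ)| ≤ |(m : ℝ)| + i := by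
        rw [raySite]; push_cast
        refine (abs_add_le _ _).trans ?_
        rw [abs_mul]
        rcases hσ with rfl | rfl <;> simp
      have h3 : (i : ℝ) ≤ n + 1 := by exact_mod_cast hi
      rw [hc]; linarith
    · rw [← ENNReal.ofReal_pow (hq0 n), ← ENNReal.ofReal_mul (pow_nonneg (hq0 n) _),
        ← ENNReal.ofReal_mul (by linarith), ← ENNReal.ofReal_pow (Real.sqrt_nonneg _),
        Real.sq_sqrt (hD0 n)]
  have hsum : Summable T := by
    set R : ℝ := C * (√(C * (Real.exp (c + 1) * (2 * B))) * (2 * (2 * A + B))) with hR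
    -- The prefactor `M n` contributes the power `ζ`. The square root in `D n` contributes `ζ / 2`
    -- and halves the exponential rate.
    have hs := (summable_rpow_mul_exp_neg_rpow (a := η / (2 * C ^ 2) / 2) hc1 (by positivity)
      (by linarith : 0 < 1 - 2 * ζ) (ζ + ζ / 2)).mul_left R
    refine hs.of_nonneg_of_le (fun n => ?_) (fun n => ?_)
    · have := hM1 n
      have : 0 ≤ D n := Real.sqrt_nonneg _
      simp only [hT]
      positivity
    · have hx := hx1 n
      have hx0 : 0 < c + (n : ℝ) := by linarith
      have h1 := one_sub_pow_le_exp hη0 hη1 hC hζ0 hc1 n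
      set y := Real.exp (-(η / (2 * C ^ 2) / 2) * (c + n) ^ (1 - 2 * ζ)) with hy
      have hy2 : Real.exp (-(η / (2 * C ^ 2)) * (c + n) ^ (1 - 2 * ζ)) = y ^ 2 := by
        rw [hy, ← Real.exp_nat_mul]
        congr 1
        push_cast
        ring
      rw [hy2] at h1
      have h2 : D n ≤ √(C * (Real.exp (c + 1) * (2 * B))) * ((c + n) ^ (ζ / 2) * y) := by
        have h3 : M n * (q n ^ (n / 2) * (2 * B))
            ≤ C * (Real.exp (c + 1) * (2 * B)) * ((c + n) ^ (ζ / 2) * y) ^ 2 := by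
          have h4 : ((c + n) ^ (ζ / 2)) ^ 2 = (c + (n : ℝ)) ^ ζ := by
            rw [← Real.rpow_natCast, ← Real.rpow_mul hx0.le]
            congr 1
            push_cast
            ring
          calc M n * (q n ^ (n / 2) * (2 * B))
              ≤ M n * ((Real.exp (c + 1) * y ^ 2) * (2 * B)) := by
                have := hM1 n
                gcongr
            _ = _ := by rw [mul_pow, h4, hM]; ring
        calc D n ≤ √(C * (Real.exp (c + 1) * (2 * B)) * ((c + n) ^ (ζ / 2) * y) ^ 2) :=
              Real.sqrt_le_sqrt h3
          _ = _ := by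
              rw [Real.sqrt_mul (by positivity), Real.sqrt_sq (by positivity)]
      calc T n ≤ M n * (√(C * (Real.exp (c + 1) * (2 * B))) * ((c + n) ^ (ζ / 2) * y)
              * (2 * (2 * A + B))) := by
            have := hM1 n
            simp only [hT]
            gcongr
        _ = _ := by
            rw [hM, hR, Real.rpow_add hx0]; ring
  have hm (n : ℕ) := measurable_correlator a (2 * A + B) m (raySite m σ (n + 1))
  have hint : ∫⁻ ω, ∑' n : ℕ, correlator a (2 * A + B) m (raySite m σ (n + 1)) ω
      ∂Measure.infinitePi κ ≠ ∞ := by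
    rw [lintegral_tsum fun n => (hm n).aemeasurable]
    exact ne_top_of_le_ne_top hsum.tsum_ofReal_ne_top (ENNReal.tsum_le_tsum hbound)
  filter_upwards [ae_lt_top (Measurable.tsum hm) hint] with ω hω
  exact hω.ne

/-! ### Operators with a dense span of eigenvectors have pure point spectrum -/

section Abstract

variable {H : Type*} [NormedAddCommGroup H] [InnerProductSpace ℂ H] {A : H →L[ℂ] H}

theorem spectrum_subset_Icc [CompleteSpace H] {K : ℝ} (hK : ‖A‖ ≤ K) : spectrum ℝ A ⊆ Set.Icc (-K) K := by
  intro x hx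
  have h1 : ‖x‖ ≤ ‖A‖ * ‖(1 : H →L[ℂ] H)‖ := spectrum.norm_le_norm_mul_of_mem hx
  have h2 : ‖(1 : H →L[ℂ] H)‖ ≤ 1 := ContinuousLinearMap.norm_id_le
  have h3 : ‖A‖ * ‖(1 : H →L[ℂ] H)‖ ≤ ‖A‖ := mul_le_of_le_one_right (norm_nonneg _) h2
  exact abs_le.1 ((h1.trans h3).trans hK)

theorem aeval_apply_of_eigenvector {x : ℝ} {w : H} (hw : A w = (x : ℂ) • w)
    (p : Polynomial ℝ) : Polynomial.aeval A p w = ((p.eval x : ℝ) : ℂ) • w := by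
  have hpow (k : ℕ) : (A ^ k) w = ((x ^ k : ℝ) : ℂ) • w := by
    induction k with
    | zero => simp
    | succ k ih =>
      rw [pow_succ', mul_apply_eq_comp, ih, map_smul, hw, smul_smul]
      push_cast
      rw [pow_succ]
  rw [Polynomial.aeval_eq_sum_range, Polynomial.eval_eq_sum_range, sum_apply, Complex.ofReal_sum,
    Finset.sum_smul]
  refine Finset.sum_congr rfl fun k _ => ?_
  rw [smul_apply, hpow, Complex.ofReal_mul, mul_smul, Complex.coe_smul (p.coeff k)]

/-- Clear for polynomials; `f` is approximated uniformly on `[-‖A‖, ‖A‖]`, which contains the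
spectrum and, for `w ≠ 0`, the point `x`. -/
theorem cfc_apply_of_eigenvector [CompleteSpace H] (hA : IsSelfAdjoint A) {x : ℝ} {w : H}
    (hw : A w = (x : ℂ) • w) {f : ℝ → ℝ} (hf : Continuous f) :
    cfc f A w = ((f x : ℝ) : ℂ) • w := by
  rcases eq_or_ne w 0 with rfl | hw0
  · simp
  have hx : x ∈ Set.Icc (-‖A‖) ‖A‖ := by
    refine abs_le.1 (le_of_mul_le_mul_right ?_ (norm_pos_iff.2 hw0))
    calc |x| * ‖w‖ = ‖A w‖ := by rw [hw, norm_smul, Complex.norm_real, Real.norm_eq_abs]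
      _ ≤ ‖A‖ * ‖w‖ := A.le_opNorm w
  rw [← sub_eq_zero, ← norm_le_zero_iff]
  refine le_of_forall_pos_le_add fun ε hε => ?_
  rw [zero_add]
  set ε' := ε / (2 * ‖w‖) with hε'
  have hwpos : 0 < ‖w‖ := norm_pos_iff.2 hw0
  have hε'0 : 0 < ε' := by positivity
  obtain ⟨p, hp⟩ := exists_polynomial_near_of_continuousOn (-‖A‖) ‖A‖ f hf.continuousOn ε' hε'0
  have h1 : ‖cfc f A - Polynomial.aeval A p‖ ≤ ε' := by
    rw [← cfc_polynomial (R := ℝ) p A, ← cfc_sub f p.eval A]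
    refine norm_cfc_le hε'0.le fun y hy => ?_
    rw [Real.norm_eq_abs, abs_sub_comm]
    exact (hp y (spectrum_subset_Icc le_rfl hy)).le
  have h2 : cfc f A w - ((f x : ℝ) : ℂ) • w
      = (cfc f A - Polynomial.aeval A p) w + ((p.eval x - f x : ℝ) : ℂ) • w := by
    rw [sub_apply, aeval_apply_of_eigenvector hw]
    push_cast
    rw [sub_smul]
    abel
  calc ‖cfc f A w - ((f x : ℝ) : ℂ) • w‖
      ≤ ‖cfc f A - Polynomial.aeval A p‖ * ‖w‖ + |p.eval x - f x| * ‖w‖ := by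
        rw [h2]
        refine (norm_add_le _ _).trans (add_le_add (ContinuousLinearMap.le_opNorm _ _) ?_)
        rw [norm_smul, Complex.norm_real, Real.norm_eq_abs]
    _ ≤ ε' * ‖w‖ + ε' * ‖w‖ := by
        gcongr
        exact (hp x hx).le
    _ = ε := by rw [hε']; field_simp; ring

/-- A self-adjoint operator whose eigenvectors span a dense subspace has pure point spectrum. -/
theorem hasPurePointSpectrum_of_eigenvectors_dense [CompleteSpace H] (hA : IsSelfAdjoint A)
    (hdense : ∀ ψ : H, (∀ (x : ℝ) (w : H), A w = (x : ℂ) • w → inner ℂ ψ w = 0) → ψ = 0) :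
    HasPurePointSpectrum A := by
  refine ⟨hA, fun ψ => ?_⟩
  have hsym : (A : H →ₗ[ℂ] H).IsSymmetric :=
    ContinuousLinearMap.isSelfAdjoint_iff_isSymmetric.1 hA
  set F : ℂ → Submodule ℂ H := fun z => Module.End.eigenspace (A : H →ₗ[ℂ] H) z with hF
  have hmemF {z : ℂ} {w : H} : w ∈ F z ↔ A w = z • w := Module.End.mem_eigenspace_iff
  have hcomplete (z : ℂ) : CompleteSpace (F z) := by
    have hcl : IsClosed (F z : Set H) := by
      have : (F z : Set H) = {w | A w = z • w} := by ext w; exact hmemF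
      rw [this]
      exact isClosed_eq A.continuous (continuous_const_smul z)
    exact hcl.completeSpace_coe
  have htop : ⊤ ≤ (⨆ z, F z).topologicalClosure := by
    rw [top_le_iff, Submodule.topologicalClosure_eq_top_iff, Submodule.eq_bot_iff]
    intro ψ hψ
    refine hdense ψ fun x w hw => ?_
    rw [← inner_conj_symm, hψ w (Submodule.mem_iSup_of_mem (x : ℂ) (hmemF.2 hw)), map_zero]
  have hsum : IsHilbertSum ℂ (fun z => F z) fun z => (F z).subtypeₗᵢ :=
    IsHilbertSum.mkInternal F hsym.orthogonalFamily_eigenspaces htop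
  set w := hsum.linearIsometryEquiv ψ with hw
  have hψ : HasSum (fun z => (w z : H)) ψ := by
    simpa [hw] using hsum.hasSum_linearIsometryEquiv_symm w
  have heig (z : ℂ) : A (w z : H) = z • (w z : H) := hmemF.1 (w z).2
  have hreal (z : ℂ) : A (w z : H) = (z.re : ℂ) • (w z : H) := by
    rcases eq_or_ne (w z : H) 0 with h0 | h0
    · simp [h0]
    · have h1 : Module.End.HasEigenvalue (A : H →ₗ[ℂ] H) z :=
        Module.End.hasEigenvalue_of_hasEigenvector (x := (w z : H)) ⟨(w z).2, h0⟩
      rw [heig, (Complex.conj_eq_iff_re.1 (hsym.conj_eigenvalue_eq_self h1))]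
  have horth (z : ℂ) : inner ℂ ψ (w z : H) = ((‖(w z : H)‖ ^ 2 : ℝ) : ℂ) := by
    have h1 : HasSum (fun z' => inner ℂ (w z' : H) (w z : H)) (inner ℂ ψ (w z : H)) := by
      have h2 := hψ.mapL (innerSL ℂ (w z : H))
      have h3 := h2.map (starRingEnd ℂ) Complex.continuous_conj
      simpa [Function.comp_def, inner_conj_symm] using h3
    have h4 : HasSum (fun z' => inner ℂ (w z' : H) (w z : H)) (inner ℂ (w z : H) (w z : H)) :=
      hasSum_single z fun z' hz' =>
        hsym.orthogonalFamily_eigenspaces hz' (w z') (w z)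
    rw [h1.unique h4, inner_self_eq_norm_sq_to_K]
    push_cast
    rfl
  have hsq : Summable fun z => ‖(w z : H)‖ ^ 2 := by
    have h1 := hψ.mapL (innerSL ℂ ψ)
    simp only [innerSL_apply_apply, horth] at h1
    exact Complex.summable_ofReal.1 h1.summable
  -- The spectral measure of `ψ` puts mass `‖w z‖ ^ 2` at each eigenvalue. Eigenspaces are indexed
  -- by complex `z`, but `w z` vanishes unless `z` is real.
  set ν : Measure ℝ := Measure.sum fun z : ℂ =>
    ENNReal.ofReal (‖(w z : H)‖ ^ 2) • Measure.dirac z.re with hν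
  have hfin : IsFiniteMeasure ν := by
    constructor
    rw [hν, Measure.sum_apply _ MeasurableSet.univ]
    simp only [Measure.smul_apply, measure_univ, smul_eq_mul, mul_one]
    exact hsq.tsum_ofReal_ne_top.lt_top
  refine ⟨ν, ⟨hfin, fun f => ?_⟩, Complex.re '' {z | ‖(w z : H)‖ ^ 2 ≠ 0}, ?_, ?_⟩
  · have h1 : HasSum (fun z => ((f z.re * ‖(w z : H)‖ ^ 2 : ℝ) : ℂ))
        (inner ℂ ψ (cfc (f : ℝ → ℝ) A ψ)) := by
      have h2 := (hψ.mapL (cfc (f : ℝ → ℝ) A)).mapL (innerSL ℂ ψ)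
      have h3 : (fun z => ((f z.re * ‖(w z : H)‖ ^ 2 : ℝ) : ℂ)) =
          fun z => innerSL ℂ ψ (cfc (f : ℝ → ℝ) A (w z : H)) := funext fun z => by
        rw [innerSL_apply_apply, cfc_apply_of_eigenvector hA (hreal z) f.continuous,
          inner_smul_right, horth]
        push_cast
        rfl
      rw [h3]
      exact h2
    have h3 : ∫ x, f x ∂ν = ∑' z : ℂ, f z.re * ‖(w z : H)‖ ^ 2 := by
      rw [hν, integral_sum_measure (by rw [← hν]; exact f.integrable ν)]
      refine tsum_congr fun z => ?_
      rw [integral_smul_measure, integral_dirac, ENNReal.toReal_ofReal (sq_nonneg _),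
        smul_eq_mul, mul_comm]
    rw [h3, Complex.ofReal_tsum]
    exact h1.tsum_eq.symm
  · exact hsq.countable_support.image _
  · have hS : (Complex.re '' {z | ‖(w z : H)‖ ^ 2 ≠ 0}).Countable :=
      hsq.countable_support.image _
    rw [hν, Measure.sum_apply _ hS.measurableSet.compl, ENNReal.tsum_eq_zero]
    intro z
    rw [Measure.smul_apply, smul_eq_mul]
    by_cases hz : ‖(w z : H)‖ ^ 2 = 0
    · rw [hz]; simp
    · rw [Measure.dirac_apply' _ hS.measurableSet.compl, Set.indicator_of_notMem, mul_zero]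
      exact fun h => h ⟨z, hz, rfl⟩

end Abstract

/-! ### Spectral densities relative to a cyclic vector -/

section SpectralModel

variable {H : Type*} [NormedAddCommGroup H] [InnerProductSpace ℂ H] [CompleteSpace H]
  {A : H →L[ℂ] H}

/-- Restrict functions on `[-K, K]` to the spectrum and apply the functional calculus. A fixed
interval makes the densities comparable with polynomials bounded on `[-K, K]`. -/
theorem exists_starAlgHom_extending_aeval (hA : IsSelfAdjoint A) {K : ℝ} (hK : ‖A‖ ≤ K) :
    ∃ π : C(Set.Icc (-K) K, ℝ) →⋆ₐ[ℝ] (H →L[ℂ] H),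
      ∀ p : Polynomial ℝ, π (p.toContinuousMapOn _) = Polynomial.aeval A p := by
  set ι : C(spectrum ℝ A, Set.Icc (-K) K) :=
    ⟨Set.inclusion (spectrum_subset_Icc hK), continuous_inclusion _⟩ with hι
  set π : C(Set.Icc (-K) K, ℝ) →⋆ₐ[ℝ] (H →L[ℂ] H) :=
    (cfcHom hA).comp (ContinuousMap.compStarAlgHom' ℝ ℝ ι) with hπ
  refine ⟨π, fun p => ?_⟩
  have h : (π : C(Set.Icc (-K) K, ℝ) →ₐ[ℝ] (H →L[ℂ] H)).comp
      (Polynomial.toContinuousMapOnAlgHom (Set.Icc (-K) K)) = Polynomial.aeval A := by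
    refine Polynomial.algHom_ext ?_
    have h1 : (Polynomial.X : Polynomial ℝ).toContinuousMapOn (Set.Icc (-K) K) =
        ContinuousMap.restrict _ (ContinuousMap.id ℝ) := by
      ext x; simp
    change π ((Polynomial.X : Polynomial ℝ).toContinuousMapOn (Set.Icc (-K) K)) = _
    rw [h1, Polynomial.aeval_X]
    exact cfcHom_id hA
  exact DFunLike.congr_fun h p

theorem inner_starAlgHom_mul {X : Type*} [TopologicalSpace X]
    (π : C(X, ℝ) →⋆ₐ[ℝ] (H →L[ℂ] H)) (f h : C(X, ℝ)) (e : H) :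
    inner ℂ e (π (f * h) e) = inner ℂ (π f e) (π h e) := by
  have h1 : star (π f) = π f := by
    rw [← map_star, star_trivial]
  rw [map_mul, mul_apply_eq_comp]
  conv_lhs => rw [← h1]
  rw [ContinuousLinearMap.star_eq_adjoint, ContinuousLinearMap.adjoint_inner_right]

/-- Riesz–Markov; positivity holds because `f = √f * √f` turns the functional into `‖π (√f) e‖ ^ 2`.
-/
theorem exists_measure_of_starAlgHom {X : Type*} [TopologicalSpace X] [CompactSpace X] [T2Space X]
    [MeasurableSpace X] [BorelSpace X] (π : C(X, ℝ) →⋆ₐ[ℝ] (H →L[ℂ] H)) (e : H) :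
    ∃ ν : Measure X, IsFiniteMeasure ν ∧ ν.Regular ∧
      ∀ f : C(X, ℝ), ∫ x, f x ∂ν = (inner ℂ e (π f e)).re := by
  have hpos (f : C(X, ℝ)) (hf : ∀ x, 0 ≤ f x) : 0 ≤ (inner ℂ e (π f e)).re := by
    set s : C(X, ℝ) := ⟨fun x => √(f x), by fun_prop⟩ with hs
    have h1 : f = s * s := by
      ext x
      exact (Real.mul_self_sqrt (hf x)).symm
    rw [h1, inner_starAlgHom_mul]
    exact inner_self_nonneg (𝕜 := ℂ)
  have hadd (f h : C(X, ℝ)) : (inner ℂ e (π (f + h) e)).re =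
      (inner ℂ e (π f e)).re + (inner ℂ e (π h e)).re := by
    rw [map_add, add_apply, inner_add_right, Complex.add_re]
  set Λ : CompactlySupportedContinuousMap X ℝ →ₚ[ℝ] ℝ :=
    { toFun := fun f => (inner ℂ e (π f.toContinuousMap e)).re
      map_add' := fun f h => hadd f.toContinuousMap h.toContinuousMap
      map_smul' := fun c f => by
        have h1 : (c • f).toContinuousMap = c • f.toContinuousMap := rfl
        rw [h1, map_smul, smul_apply, ← Complex.coe_smul, inner_smul_right, Complex.re_ofReal_mul]
        rfl
      monotone' := fun f h hfh => by
        have h1 : h.toContinuousMap = f.toContinuousMap + (h.toContinuousMap - f.toContinuousMap) :=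
          (add_sub_cancel _ _).symm
        change (inner ℂ e (π f.toContinuousMap e)).re ≤ (inner ℂ e (π h.toContinuousMap e)).re
        rw [h1, hadd]
        exact le_add_of_nonneg_right (hpos _ fun x => sub_nonneg.2 (hfh x)) } with hΛ
  refine ⟨RealRMK.rieszMeasure Λ, inferInstance, inferInstance, fun f => ?_⟩
  exact RealRMK.integral_rieszMeasure Λ (CompactlySupportedContinuousMap.continuousMapEquiv f)

/-- The map `f ↦ π f e` is isometric for the `L²(ν)` norm, so `f ↦ Re ⟨y, π f e⟩` extends to a
bounded functional on `L²(ν)` and Riesz representation supplies `g`. -/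
theorem exists_density_of_starAlgHom {X : Type*} [TopologicalSpace X] [CompactSpace X] [T2Space X]
    [MeasurableSpace X] [BorelSpace X] (π : C(X, ℝ) →⋆ₐ[ℝ] (H →L[ℂ] H)) (e : H)
    {ν : Measure X} [IsFiniteMeasure ν] [ν.Regular]
    (hν : ∀ f : C(X, ℝ), ∫ x, f x ∂ν = (inner ℂ e (π f e)).re) (y : H) :
    ∃ g : X → ℝ, MemLp g 2 ν ∧
      ∀ f : C(X, ℝ), ∫ x, f x * g x ∂ν = (inner ℂ y (π f e)).re := by
  set T : C(X, ℝ) →ₗ[ℝ] Lp ℝ 2 ν := (ContinuousMap.toLp 2 ν ℝ).toLinearMap with hT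
  set L : C(X, ℝ) →ₗ[ℝ] ℝ :=
    { toFun := fun f => (inner ℂ y (π f e)).re
      map_add' := fun f h => by
        rw [map_add, add_apply, inner_add_right, Complex.add_re]
      map_smul' := fun c f => by
        rw [map_smul, smul_apply, ← Complex.coe_smul, inner_smul_right, Complex.re_ofReal_mul]
        rfl } with hL
  have hnorm (f : C(X, ℝ)) : ‖T f‖ = ‖π f e‖ := by
    have h1 : ‖T f‖ ^ 2 = ‖π f e‖ ^ 2 := by
      rw [← real_inner_self_eq_norm_sq, L2.inner_def]
      have h2 : ∫ x, inner ℝ (T f x) (T f x) ∂ν = ∫ x, (f * f) x ∂ν := by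
        refine integral_congr_ae ?_
        filter_upwards [ContinuousMap.coeFn_toLp (p := 2) (𝕜 := ℝ) ν f] with x hx
        change inner ℝ ((ContinuousMap.toLp 2 ν ℝ f) x) ((ContinuousMap.toLp 2 ν ℝ f) x) = _
        rw [hx]
        rfl
      rw [h2, hν, inner_starAlgHom_mul, inner_self_eq_norm_sq_to_K]
      norm_cast
    exact (pow_left_inj₀ (norm_nonneg _) (norm_nonneg _) two_ne_zero).1 h1
  have hdense : DenseRange T := ContinuousMap.toLp_denseRange ℝ ν ℝ (by norm_num)
  have hbound : ∃ C : ℝ, ∀ f, ‖L f‖ ≤ C * ‖T f‖ :=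
    ⟨‖y‖, fun f => by
      rw [hnorm]
      exact (Complex.abs_re_le_norm _).trans (norm_inner_le_norm _ _)⟩
  set g := (InnerProductSpace.toDual ℝ (Lp ℝ 2 ν)).symm (L.extendOfNorm T) with hg
  refine ⟨g, Lp.memLp g, fun f => ?_⟩
  have h1 : inner ℝ g (T f) = L f := by
    rw [hg, InnerProductSpace.toDual_symm_apply, LinearMap.extendOfNorm_eq hdense hbound]
  refine Eq.trans ?_ h1
  rw [L2.inner_def]
  refine integral_congr_ae ?_
  filter_upwards [ContinuousMap.coeFn_toLp (p := 2) (𝕜 := ℝ) ν f] with x hx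
  change _ = inner ℝ (g x) ((ContinuousMap.toLp 2 ν ℝ f) x)
  rw [hx]
  rfl

/-- Relative to a scalar measure on `[-K, K]`, all the functionals `p ↦ ⟨y, p(A) e⟩` have square
integrable densities. -/
theorem exists_spectral_density (hA : IsSelfAdjoint A) {K : ℝ} (hK : ‖A‖ ≤ K) (e : H) :
    ∃ ν : Measure (Set.Icc (-K) K), IsFiniteMeasure ν ∧ ∀ y : H, ∃ g : Set.Icc (-K) K → ℝ,
      MemLp g 2 ν ∧ ∀ p : Polynomial ℝ,
        ∫ x, p.eval (x : ℝ) * g x ∂ν = (inner ℂ y (Polynomial.aeval A p e)).re := by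
  obtain ⟨π, hπ⟩ := exists_starAlgHom_extending_aeval hA hK
  obtain ⟨ν, h1, h2, hν⟩ := exists_measure_of_starAlgHom π e
  refine ⟨ν, h1, fun y => ?_⟩
  obtain ⟨g, hg, hgf⟩ := exists_density_of_starAlgHom π e hν y
  exact ⟨g, hg, fun p => by rw [← hπ]; exact hgf (p.toContinuousMapOn _)⟩

end SpectralModel

/-! ### `L¹` norms by duality with rational polynomials -/

theorem exists_rat_poly_near (K : ℝ) (p : Polynomial ℝ) {ε : ℝ} (hε : 0 < ε) :
    ∃ q : Polynomial ℚ, ∀ x ∈ Set.Icc (-K) K,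
      |(q.map (algebraMap ℚ ℝ)).eval x - p.eval x| ≤ ε := by
  induction p using Polynomial.induction_on' generalizing ε with
  | add p p' hp hp' =>
    obtain ⟨q, hq⟩ := hp (half_pos hε)
    obtain ⟨q', hq'⟩ := hp' (half_pos hε)
    refine ⟨q + q', fun x hx => ?_⟩
    rw [Polynomial.map_add, Polynomial.eval_add, Polynomial.eval_add, add_sub_add_comm]
    exact (abs_add_le _ _).trans (by linarith [hq x hx, hq' x hx])
  | monomial n c =>
    have hpos : 0 < ε / (|K| ^ n + 1) := by positivity
    obtain ⟨q, hq⟩ := exists_rat_near c hpos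
    refine ⟨Polynomial.monomial n q, fun x hx => ?_⟩
    rw [Polynomial.map_monomial, Polynomial.eval_monomial, Polynomial.eval_monomial, ← sub_mul,
      abs_mul, abs_pow]
    have hxK : |x| ^ n ≤ |K| ^ n :=
      pow_le_pow_left₀ (abs_nonneg _) ((abs_le.2 hx).trans (le_abs_self K)) n
    rw [abs_sub_comm] at hq
    calc |(algebraMap ℚ ℝ) q - c| * |x| ^ n
        ≤ ε / (|K| ^ n + 1) * (|K| ^ n + 1) := by
          gcongr
          · exact hq.le
          · linarith
      _ = ε := by field_simp

/-- Weierstrass approximation followed by rational approximation of coefficients. By compactness the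
strict bound on `f` leaves room for the approximant to stay in `unitPolys K`. -/
theorem abs_integral_mul_le_of_unitPolys {K : ℝ} {ν : Measure (Set.Icc (-K) K)}
    [IsFiniteMeasure ν] {g : Set.Icc (-K) K → ℝ} (hg : Integrable g ν) {Q : ℝ}
    (hQ : ∀ p ∈ unitPolys K,
      |∫ x, (p.map (algebraMap ℚ ℝ)).eval (x : ℝ) * g x ∂ν| ≤ Q)
    (f : C(Set.Icc (-K) K, ℝ)) (hf : ∀ x, |f x| < 1) : |∫ x, f x * g x ∂ν| ≤ Q := by
  have hint (f : C(Set.Icc (-K) K, ℝ)) : Integrable (fun x => f x * g x) ν :=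
    hg.bdd_mul f.continuous.aestronglyMeasurable
      (Filter.Eventually.of_forall fun x => f.norm_coe_le_norm x)
  obtain ⟨s, hs0, hs1, hs⟩ : ∃ s : ℝ, 0 ≤ s ∧ s < 1 ∧ ∀ x, |f x| ≤ s := by
    refine ⟨‖f‖, norm_nonneg _, ?_, fun x => f.norm_coe_le_norm x⟩
    exact (ContinuousMap.norm_lt_iff f one_pos).2 hf
  refine le_of_forall_pos_le_add fun ε hε => ?_
  set G := ∫ x, |g x| ∂ν with hG
  have hG0 : 0 ≤ G := integral_nonneg fun x => abs_nonneg _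
  -- The rational polynomial is within `2 * η` of `f`: the first entry keeps it at most `s + 2 * η ≤
  -- 1`, the second keeps the change in the integral below `ε`.
  set η := min ((1 - s) / 2) (ε / (2 * (G + 1))) with hη
  have hη0 : 0 < η := lt_min (by linarith) (by positivity)
  obtain ⟨p, hp⟩ := exists_polynomial_near_continuousMap (-K) K f η hη0
  obtain ⟨q, hq⟩ := exists_rat_poly_near K p hη0
  have hpx (x : Set.Icc (-K) K) : |p.eval (x : ℝ) - f x| ≤ η :=
    ((p.toContinuousMapOn (Set.Icc (-K) K) - f).norm_coe_le_norm x).trans hp.le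
  have hqx (x : Set.Icc (-K) K) :
      |(q.map (algebraMap ℚ ℝ)).eval (x : ℝ) - f x| ≤ 2 * η := by
    refine (abs_sub_le _ (p.eval (x : ℝ)) _).trans ?_
    linarith [hq x x.2, hpx x]
  have hqu : q ∈ unitPolys K := fun x hx => by
    have h1 := hqx ⟨x, hx⟩
    have h2 := hs ⟨x, hx⟩
    have h3 : η ≤ (1 - s) / 2 := min_le_left _ _
    have h4 := abs_sub_abs_le_abs_sub ((q.map (algebraMap ℚ ℝ)).eval x) (f ⟨x, hx⟩)
    simp only at h1
    linarith
  have h1 := hQ q hqu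
  have hintq : Integrable (fun x : Set.Icc (-K) K =>
      (q.map (algebraMap ℚ ℝ)).eval (x : ℝ) * g x) ν :=
    hint ((q.map (algebraMap ℚ ℝ)).toContinuousMapOn _)
  have h2 : |∫ x, f x * g x ∂ν - ∫ x, (q.map (algebraMap ℚ ℝ)).eval (x : ℝ) * g x ∂ν|
      ≤ 2 * η * G := by
    rw [← integral_sub (hint f) hintq, hG, ← integral_const_mul]
    refine (abs_integral_le_integral_abs).trans (integral_mono ((hint f).sub hintq).abs
      (hg.abs.const_mul _) fun x => ?_)
    change |f x * g x - (q.map (algebraMap ℚ ℝ)).eval (x : ℝ) * g x| ≤ 2 * η * |g x|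
    rw [← sub_mul, abs_mul, abs_sub_comm]
    exact mul_le_mul_of_nonneg_right (hqx x) (abs_nonneg _)
  have h3 : 2 * η * G ≤ ε := by
    have h4 : η ≤ ε / (2 * (G + 1)) := min_le_right _ _
    rw [le_div_iff₀ (by positivity)] at h4
    nlinarith
  have h5 := abs_sub_abs_le_abs_sub (∫ x, f x * g x ∂ν)
    (∫ x, (q.map (algebraMap ℚ ℝ)).eval (x : ℝ) * g x ∂ν)
  linarith

/-- Test against a continuous substitute for the sign of `g`, namely `h / (|h| + ε)` with `h`
continuous and `L¹`-close to `g`. It is strictly below one in absolute value, as the previous lemma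
needs. -/
theorem integral_abs_le_of_unitPolys {K : ℝ} {ν : Measure (Set.Icc (-K) K)}
    [IsFiniteMeasure ν] {g : Set.Icc (-K) K → ℝ} (hg : Integrable g ν) {Q : ℝ}
    (hQ : ∀ p ∈ unitPolys K,
      |∫ x, (p.map (algebraMap ℚ ℝ)).eval (x : ℝ) * g x ∂ν| ≤ Q) :
    ∫ x, |g x| ∂ν ≤ Q := by
  refine le_of_forall_pos_le_add fun ε' hε' => ?_
  set V := ν.real Set.univ with hV
  have hV0 : 0 ≤ V := measureReal_nonneg
  set ε := ε' / (2 + V) with hεdef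
  have hε : 0 < ε := by positivity
  obtain ⟨h, hgh, hhint⟩ := hg.exists_boundedContinuous_integral_sub_le hε
  have hden (x) : 0 < |h x| + ε := by positivity
  set f : C(Set.Icc (-K) K, ℝ) :=
    ⟨fun x => h x / (|h x| + ε), h.continuous.div (by fun_prop) fun x => (hden x).ne'⟩ with hf
  have hf1 (x) : |f x| < 1 := by
    change |h x / (|h x| + ε)| < 1
    rw [abs_div, abs_of_pos (hden x), div_lt_one (hden x)]
    linarith
  have h1 := abs_integral_mul_le_of_unitPolys hg hQ f hf1
  have hint : Integrable (fun x => f x * g x) ν :=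
    hg.bdd_mul f.continuous.aestronglyMeasurable
      (Filter.Eventually.of_forall fun x => f.norm_coe_le_norm x)
  have hpt (x) : |g x| ≤ f x * g x + 2 * ‖g x - h x‖ + ε := by
    have h2 : |h x| ≤ f x * h x + ε := by
      change |h x| ≤ h x / (|h x| + ε) * h x + ε
      have h3 : h x / (|h x| + ε) * h x = |h x| ^ 2 / (|h x| + ε) := by
        rw [sq_abs]; ring
      rw [h3, ← sub_le_iff_le_add, le_div_iff₀ (hden x)]
      nlinarith [abs_nonneg (h x)]
    have h4 : f x * h x ≤ f x * g x + |g x - h x| := by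
      have h5 : f x * h x - f x * g x ≤ |f x * (h x - g x)| := by
        rw [mul_sub]; exact le_abs_self _
      rw [abs_mul, abs_sub_comm (h x)] at h5
      have h6 := mul_le_mul_of_nonneg_right (hf1 x).le (abs_nonneg (g x - h x))
      linarith
    have h7 := abs_sub_abs_le_abs_sub (g x) (h x)
    rw [Real.norm_eq_abs]
    linarith
  have hint2 : Integrable (fun x => 2 * ‖g x - h x‖) ν := (hg.sub hhint).norm.const_mul 2
  calc ∫ x, |g x| ∂ν ≤ ∫ x, (f x * g x + 2 * ‖g x - h x‖ + ε) ∂ν :=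
        integral_mono hg.abs ((hint.add hint2).add (integrable_const ε)) hpt
    _ = ∫ x, f x * g x ∂ν + 2 * ∫ x, ‖g x - h x‖ ∂ν + ε * V := by
        rw [integral_add (f := fun x => f x * g x + 2 * ‖g x - h x‖) (hint.add hint2)
            (integrable_const ε), integral_add hint hint2,
          integral_const_mul, integral_const, smul_eq_mul, mul_comm ε]
    _ ≤ Q + 2 * ε + ε * V := by
        gcongr
        exact (le_abs_self _).trans h1
    _ = Q + ε' := by rw [hεdef]; field_simp; ring

theorem ae_eq_zero_of_polynomial_moments {K : ℝ} {ν : Measure (Set.Icc (-K) K)}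
    [IsFiniteMeasure ν] {g : Set.Icc (-K) K → ℝ} (hg : Integrable g ν)
    (h : ∀ p : Polynomial ℝ, ∫ x, p.eval (x : ℝ) * g x ∂ν = 0) : g =ᵐ[ν] 0 := by
  have h1 : ∫ x, |g x| ∂ν ≤ 0 :=
    integral_abs_le_of_unitPolys hg fun p _ => by rw [h, abs_zero]
  have h2 := (integral_eq_zero_iff_of_nonneg (fun x => abs_nonneg (g x)) hg.abs).1
    (le_antisymm h1 (integral_nonneg fun x => abs_nonneg _))
  filter_upwards [h2] with x hx
  exact abs_eq_zero.1 hx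

/-! ### The Jacobi operator on `ℓ²(ℤ)` -/

theorem inner_shift_left (k : ℤ) (φ ψ : L2Z) :
    inner ℂ (shift k φ) ψ = inner ℂ φ (shift (-k) ψ) := by
  rw [lp.inner_eq_tsum, lp.inner_eq_tsum,
    ← (Equiv.addRight k).tsum_eq fun n : ℤ => inner ℂ (φ n) (shift (-k) ψ n)]
  refine tsum_congr fun n => ?_
  simp

theorem inner_multiplication_left (b : LInftyZ) (φ ψ : L2Z) :
    inner ℂ (multiplication b φ) ψ = inner ℂ φ (multiplication b ψ) := by
  rw [lp.inner_eq_tsum, lp.inner_eq_tsum]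
  refine tsum_congr fun n => ?_
  rw [multiplication_apply, multiplication_apply, ← smul_eq_mul, ← smul_eq_mul, inner_smul_left,
    inner_smul_right, Complex.conj_ofReal]

theorem isSelfAdjoint_jacobi (a b : LInftyZ) : IsSelfAdjoint (jacobi a b) := by
  rw [ContinuousLinearMap.isSelfAdjoint_iff_isSymmetric]
  intro φ ψ
  change inner ℂ (multiplication a (shift 1 φ) + shift (-1) (multiplication a φ)
      + multiplication b φ) ψ =
    inner ℂ φ (multiplication a (shift 1 ψ) + shift (-1) (multiplication a ψ)
      + multiplication b ψ)
  simp only [inner_add_left, inner_add_right, inner_shift_left, inner_multiplication_left, neg_neg]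
  ring

theorem norm_shift_le (k : ℤ) : ‖shift k‖ ≤ 1 :=
  LinearMap.mkContinuous_norm_le _ zero_le_one _

theorem norm_multiplication_le (b : LInftyZ) : ‖multiplication b‖ ≤ ‖b‖ :=
  LinearMap.mkContinuous_norm_le _ (norm_nonneg b) _

theorem norm_jacobi_le (a b : LInftyZ) : ‖jacobi a b‖ ≤ 2 * ‖a‖ + ‖b‖ := by
  have h1 : ‖multiplication a ∘L shift 1‖ ≤ ‖a‖ * 1 :=
    (ContinuousLinearMap.opNorm_comp_le _ _).trans
      (mul_le_mul (norm_multiplication_le a) (norm_shift_le 1) (norm_nonneg _) (norm_nonneg _))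
  have h2 : ‖shift (-1) ∘L multiplication a‖ ≤ 1 * ‖a‖ :=
    (ContinuousLinearMap.opNorm_comp_le _ _).trans
      (mul_le_mul (norm_shift_le (-1)) (norm_multiplication_le a) (norm_nonneg _) zero_le_one)
  refine (norm_add_le _ _).trans ?_
  linarith [norm_add_le (multiplication a ∘L shift 1) (shift (-1) ∘L multiplication a),
    norm_multiplication_le b]

theorem aeval_jacobi_apply (a b : LInftyZ) {φ : L2Z} {f : ℤ → ℝ} (hφ : ∀ n, φ n = (f n : ℂ))
    (p : Polynomial ℝ) (n : ℤ) :
    Polynomial.aeval (jacobi a b) p φ n = ((Polynomial.aeval (formalJacobi a b) p f n : ℝ) : ℂ) := by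
  have hpow (k : ℕ) (n : ℤ) :
      ((jacobi a b) ^ k) φ n = ((((formalJacobi a b) ^ k) f n : ℝ) : ℂ) := by
    induction k generalizing n with
    | zero => simpa using hφ n
    | succ k ih =>
      rw [pow_succ', pow_succ', mul_apply_eq_comp, Module.End.mul_apply, jacobi_apply, ih, ih, ih,
        formalJacobi_apply]
      push_cast
      rfl
  rw [Polynomial.aeval_eq_sum_range, Polynomial.aeval_eq_sum_range, sum_apply, LinearMap.sum_apply,
    Finset.sum_apply, lp.coeFn_sum, Finset.sum_apply, Complex.ofReal_sum]
  refine Finset.sum_congr rfl fun k _ => ?_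
  rw [smul_apply, LinearMap.smul_apply, Pi.smul_apply, lp.coeFn_smul, Pi.smul_apply, hpow,
    smul_eq_mul, Complex.ofReal_mul, Complex.real_smul]

theorem inner_single_aeval_jacobi (a b : LInftyZ) (p : Polynomial ℝ) (m n : ℤ) :
    inner ℂ (lp.single 2 n (1 : ℂ) : L2Z)
      (Polynomial.aeval (jacobi a b) p (lp.single 2 m (1 : ℂ) : L2Z))
      = ((polyEntry a b p m n : ℝ) : ℂ) := by
  rw [lp.inner_single_left, aeval_jacobi_apply a b (f := Pi.single m 1)]
  · simp [polyEntry]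
  · intro k
    rw [lp.single_apply]
    rcases eq_or_ne k m with rfl | hk
    · simp
    · simp [hk]

theorem polyEntry_X_mul (a b : ℤ → ℝ) (p : Polynomial ℝ) (m n : ℤ) :
    polyEntry a b (Polynomial.X * p) m n = a n * polyEntry a b p m (n + 1)
      + a (n - 1) * polyEntry a b p m (n - 1) + b n * polyEntry a b p m n := by
  rw [polyEntry, map_mul, Polynomial.aeval_X, Module.End.mul_apply, formalJacobi_apply]
  rfl

theorem polyEntry_one (a b : ℤ → ℝ) (m n : ℤ) :
    polyEntry a b 1 m n = (Pi.single m 1 : ℤ → ℝ) n := by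
  rw [polyEntry, map_one, Module.End.one_apply]

/-! ### Generalized eigenvectors from summable correlators -/

theorem integral_abs_le_correlator {a b : ℤ → ℝ} {K : ℝ} {m n : ℤ}
    {ν : Measure (Set.Icc (-K) K)} [IsFiniteMeasure ν] {g : Set.Icc (-K) K → ℝ}
    (hg : Integrable g ν)
    (hmom : ∀ p : Polynomial ℝ, ∫ x, p.eval (x : ℝ) * g x ∂ν = polyEntry a b p m n)
    (h : correlator a K m n b ≠ ∞) : ∫ x, |g x| ∂ν ≤ (correlator a K m n b).toReal := by
  refine integral_abs_le_of_unitPolys hg fun p hp => ?_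
  rw [hmom, ← ENNReal.ofReal_le_iff_le_toReal h]
  exact le_iSup (fun p : unitPolys K =>
    ENNReal.ofReal |polyEntry a b (p.1.map (algebraMap ℚ ℝ)) m n|) ⟨p, hp⟩

theorem summable_int_of_rays {f : ℤ → ℝ} (m : ℤ)
    (h : ∀ σ : ℤ, σ = 1 ∨ σ = -1 → Summable fun n : ℕ => f (raySite m σ (n + 1))) :
    Summable f := by
  rw [← (Equiv.addLeft m).summable_iff]
  refine Summable.of_nat_of_neg_add_one ?_ ?_
  · refine (summable_nat_add_iff 1).1 ((h 1 (Or.inl rfl)).congr fun n => ?_)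
    simp [raySite]
  · refine (h (-1) (Or.inr rfl)).congr fun n => ?_
    simp [raySite]

/-- Multiplying a polynomial by `X` applies the Jacobi expression to the entries in `n`, so both
sides have the same polynomial moments and therefore agree almost everywhere. -/
theorem ae_recurrence {a b : ℤ → ℝ} {K : ℝ} {m : ℤ} {ν : Measure (Set.Icc (-K) K)}
    [IsFiniteMeasure ν] {g : ℤ → Set.Icc (-K) K → ℝ} (hg : ∀ n, Integrable (g n) ν)
    (hmom : ∀ n (p : Polynomial ℝ), ∫ x, p.eval (x : ℝ) * g n x ∂ν = polyEntry a b p m n)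
    (n : ℤ) : ∀ᵐ x : Set.Icc (-K) K ∂ν,
      (x : ℝ) * g n x = a n * g (n + 1) x + a (n - 1) * g (n - 1) x + b n * g n x := by
  have hpoly (p : Polynomial ℝ) (k : ℤ) : Integrable (fun x : Set.Icc (-K) K => p.eval (x : ℝ) * g k x) ν :=
    (hg k).bdd_mul (p.toContinuousMapOn (Set.Icc (-K) K)).continuous.aestronglyMeasurable
      (Filter.Eventually.of_forall fun x =>
        (p.toContinuousMapOn (Set.Icc (-K) K)).norm_coe_le_norm x)
  set R : Set.Icc (-K) K → ℝ := fun x =>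
    a n * g (n + 1) x + a (n - 1) * g (n - 1) x + b n * g n x with hR
  have hRint : Integrable R ν :=
    (((hg _).const_mul _).add ((hg _).const_mul _)).add ((hg _).const_mul _)
  have hXint : Integrable (fun x : Set.Icc (-K) K => (x : ℝ) * g n x) ν := by
    simpa using hpoly Polynomial.X n
  have hzero : (fun x : Set.Icc (-K) K => (x : ℝ) * g n x - R x) =ᵐ[ν] 0 := by
    refine ae_eq_zero_of_polynomial_moments (hXint.sub hRint) fun p => ?_
    have h1 : ∀ x : Set.Icc (-K) K, p.eval (x : ℝ) * ((x : ℝ) * g n x - R x) =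
        (Polynomial.X * p).eval (x : ℝ) * g n x - (a n * (p.eval (x : ℝ) * g (n + 1) x)
          + a (n - 1) * (p.eval (x : ℝ) * g (n - 1) x) + b n * (p.eval (x : ℝ) * g n x)) := by
      intro x
      rw [Polynomial.eval_mul, Polynomial.eval_X]
      ring
    have h2 (k : ℤ) (z : ℝ) : Integrable (fun x : Set.Icc (-K) K => z * (p.eval (x : ℝ) * g k x)) ν :=
      (hpoly p k).const_mul z
    have h3 : Integrable (fun x : Set.Icc (-K) K => a n * (p.eval (x : ℝ) * g (n + 1) x)
        + a (n - 1) * (p.eval (x : ℝ) * g (n - 1) x)) ν := (h2 _ _).add (h2 _ _)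
    have h4 : Integrable (fun x : Set.Icc (-K) K => a n * (p.eval (x : ℝ) * g (n + 1) x)
        + a (n - 1) * (p.eval (x : ℝ) * g (n - 1) x) + b n * (p.eval (x : ℝ) * g n x)) ν :=
      h3.add (h2 _ _)
    simp_rw [h1]
    rw [integral_sub (hpoly _ _) h4, integral_add h3 (h2 _ _), integral_add (h2 _ _) (h2 _ _),
      integral_const_mul, integral_const_mul, integral_const_mul,
      hmom, hmom, hmom, hmom, polyEntry_X_mul, sub_self]
  filter_upwards [hzero] with x hx
  exact sub_eq_zero.1 hx

theorem ae_summable_abs {α ι : Type*} [MeasurableSpace α] [Countable ι] {ν : Measure α}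
    {g : ι → α → ℝ} (hg : ∀ n, Integrable (g n) ν) (hs : Summable fun n => ∫ x, |g n x| ∂ν) :
    ∀ᵐ x ∂ν, Summable fun n => |g n x| := by
  have hm (n : ι) : AEMeasurable (fun x => ENNReal.ofReal |g n x|) ν :=
    (hg n).abs.aestronglyMeasurable.aemeasurable.ennreal_ofReal
  have h1 : ∫⁻ x, ∑' n, ENNReal.ofReal |g n x| ∂ν ≠ ∞ := by
    rw [lintegral_tsum hm]
    simp_rw [← ofReal_integral_eq_lintegral_ofReal (hg _).abs
      (Filter.Eventually.of_forall fun _ => abs_nonneg _)]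
    exact hs.tsum_ofReal_ne_top
  filter_upwards [ae_lt_top' (AEMeasurable.tsum hm) h1] with x hx
  refine (ENNReal.summable_toReal hx.ne).congr fun n => ?_
  exact ENNReal.toReal_ofReal (abs_nonneg _)

/-- Summability of the correlators forces pure point spectrum. -/
theorem hasPurePointSpectrum_jacobi_of_correlator (a b : LInftyZ) {K : ℝ}
    (hK : ‖jacobi a b‖ ≤ K)
    (h : ∀ m σ : ℤ, σ = 1 ∨ σ = -1 →
      ∑' n : ℕ, correlator a K m (raySite m σ (n + 1)) b ≠ ∞) :
    HasPurePointSpectrum (jacobi a b) := by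
  refine hasPurePointSpectrum_of_eigenvectors_dense (isSelfAdjoint_jacobi a b) fun ψ hψ => ?_
  ext m
  obtain ⟨ν, hν, hdens⟩ :=
    exists_spectral_density (isSelfAdjoint_jacobi a b) hK (lp.single 2 m (1 : ℂ) : L2Z)
  choose g hg2 hg using fun n : ℤ => hdens (lp.single 2 n (1 : ℂ))
  have hmom (n : ℤ) (p : Polynomial ℝ) :
      ∫ x, p.eval (x : ℝ) * g n x ∂ν = polyEntry a b p m n := by
    exact (hg n p).trans (congrArg Complex.re (inner_single_aeval_jacobi a b p m n))
  have hint (n : ℤ) : Integrable (g n) ν := (hg2 n).integrable one_le_two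
  have hsum : Summable fun n => ∫ x, |g n x| ∂ν := by
    refine summable_int_of_rays m fun σ hσ => ?_
    refine (ENNReal.summable_toReal (h m σ hσ)).of_nonneg_of_le
      (fun n => integral_nonneg fun x => abs_nonneg _) fun n => ?_
    exact integral_abs_le_correlator (hint _) (hmom _) (ENNReal.ne_top_of_tsum_ne_top (h m σ hσ) n)
  -- For almost every `x` the sequence `(g n x)` lies in `ℓ¹ ⊆ ℓ²` and solves the eigenvalue
  -- equation, so `ψ` is orthogonal to it.
  have horth : ∀ᵐ x ∂ν, ∑' n, (g n x : ℂ) * (starRingEnd ℂ) (ψ n) = 0 := by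
    filter_upwards [ae_summable_abs hint hsum, ae_all_iff.2 (ae_recurrence hint hmom)] with x hx hrec
    have hmem : Memℓp (fun n => (g n x : ℂ)) 2 := by
      refine Memℓp.of_exponent_ge (memℓp_gen (p := 1) ?_) one_le_two
      simpa using hx
    have heig : jacobi a b (⟨fun n => (g n x : ℂ), hmem⟩ : L2Z) =
        ((x : ℝ) : ℂ) • (⟨fun n => (g n x : ℂ), hmem⟩ : L2Z) := by
      ext n
      have h1 := congrArg (fun t : ℝ => (t : ℂ)) (hrec n)
      push_cast at h1
      exact h1.symm
    have h2 := hψ x _ heig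
    rw [lp.inner_eq_tsum] at h2
    exact h2
  have hF (n : ℤ) : Integrable (fun x => (g n x : ℂ) * (starRingEnd ℂ) (ψ n)) ν :=
    (hint n).ofReal.mul_const _
  have hFsum : Summable fun n => ∫ x, ‖(g n x : ℂ) * (starRingEnd ℂ) (ψ n)‖ ∂ν := by
    refine (hsum.mul_right ‖ψ‖).of_nonneg_of_le
      (fun n => integral_nonneg fun x => norm_nonneg _) fun n => ?_
    rw [← integral_mul_const]
    refine integral_mono (hF n).norm ((hint n).abs.mul_const _) fun x => ?_
    change ‖(g n x : ℂ) * (starRingEnd ℂ) (ψ n)‖ ≤ |g n x| * ‖ψ‖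
    rw [norm_mul, Complex.norm_real, RCLike.norm_conj, Real.norm_eq_abs]
    exact mul_le_mul_of_nonneg_left (lp.norm_apply_le_norm two_ne_zero ψ n) (abs_nonneg _)
  have h1 := hasSum_integral_of_summable_integral_norm hF hFsum
  -- Exchanging sum and integral, the moments `∫ g n = δ_{mn}` for `p = 1` leave only the conjugate
  -- of `ψ m`, which must be zero.
  rw [integral_congr_ae horth, integral_zero] at h1
  have h2 (n : ℤ) : ∫ x, (g n x : ℂ) * (starRingEnd ℂ) (ψ n) ∂ν =
      (((Pi.single m 1 : ℤ → ℝ) n : ℝ) : ℂ) * (starRingEnd ℂ) (ψ n) := by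
    have h3 : ∫ x, (g n x : ℂ) ∂ν = ((∫ x, g n x ∂ν : ℝ) : ℂ) := integral_ofReal
    have h4 : ∫ x, g n x ∂ν = (Pi.single m 1 : ℤ → ℝ) n := by
      rw [← polyEntry_one a b, ← hmom]
      simp
    rw [integral_mul_const, h3, h4]
  simp_rw [h2] at h1
  have h3 := h1.unique (hasSum_single m fun n hn => by simp [hn])
  simpa using h3.symm

/-! ### The site laws -/

theorem siteLaw_le {r : ℝ → ℝ} {L : ℝ} (hL : ∀ x, r x ≤ L) {d : ℤ → ℝ} {n : ℤ} (hd : 0 < d n)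
    (c : ℤ → ℝ) : siteLaw r d c n ≤ ENNReal.ofReal (L / d n) • volume := by
  rw [siteLaw, ← withDensity_const]
  refine withDensity_mono (Filter.Eventually.of_forall fun x => ENNReal.ofReal_le_ofReal ?_)
  rw [scaledDensity, div_eq_inv_mul]
  exact mul_le_mul_of_nonneg_left (hL _) (inv_nonneg.2 hd.le)

theorem ae_siteLaw_ne_zero {r : ℝ → ℝ} (hr : Measurable r) (d c : ℤ → ℝ) (n : ℤ) :
    ∀ᵐ x ∂siteLaw r d c n, scaledDensity r d n (x - c n) ≠ 0 := by
  have hm : Measurable fun x => ENNReal.ofReal (scaledDensity r d n (x - c n)) := by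
    unfold scaledDensity
    fun_prop
  rw [siteLaw, ae_withDensity_iff hm]
  refine Filter.Eventually.of_forall fun x hx h0 => hx ?_
  rw [h0, ENNReal.ofReal_zero]

theorem abs_le_of_scaledDensity_ne_zero {r : ℝ → ℝ} {R : ℝ} (hR : ∀ x, r x ≠ 0 → |x| ≤ R)
    {d : ℤ → ℝ} {n : ℤ} (hd : 0 < d n) (hd1 : d n ≤ 1) {x : ℝ} (hx : scaledDensity r d n x ≠ 0) :
    |x| ≤ R := by
  have h1 := hR _ (right_ne_zero_of_mul hx)
  rw [abs_mul, abs_of_pos (inv_pos.2 hd), inv_mul_le_iff₀ hd] at h1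
  have h2 : 0 ≤ R := by
    by_contra h
    nlinarith [abs_nonneg x]
  exact h1.trans (mul_le_of_le_one_left h2 hd1)

theorem abs_le_siteRadius {r : ℝ → ℝ} {R : ℝ} (hR : ∀ x, r x ≠ 0 → |x| ≤ R)
    {d : ℤ → ℝ} {n : ℤ} (hd : 0 < d n) (hd1 : d n ≤ 1) {x : ℝ} (hx : scaledDensity r d n x ≠ 0) :
    |x| ≤ siteRadius r d n := by
  refine le_csSup ⟨R, ?_⟩ ⟨x, subset_tsupport _ hx, rfl⟩
  rintro _ ⟨E, hE, rfl⟩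
  have h1 : tsupport (scaledDensity r d n) ⊆ Set.Icc (-R) R :=
    closure_minimal (fun y hy => abs_le.1 (abs_le_of_scaledDensity_ne_zero hR hd hd1 hy))
      isClosed_Icc
  exact abs_le.2 (h1 hE)

theorem ae_potentialLaw_forall {r : ℝ → ℝ} {d c : ℤ → ℝ}
    [∀ n, IsProbabilityMeasure (siteLaw r d c n)] {P : ℤ → ℝ → Prop}
    (h : ∀ n, ∀ᵐ x ∂siteLaw r d c n, P n x) : ∀ᵐ ω ∂potentialLaw r d c, ∀ n, P n (ω n) :=
  ae_all_iff.2 fun n =>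
    (measurePreserving_eval_infinitePi (siteLaw r d c) n).quasiMeasurePreserving.ae (h n)

/-- The exponent is replaced by `max ζ 0` because `ζ` may be negative while the decay estimates use
a nonnegative exponent; the site `0` is absorbed into the constant. -/
theorem exists_scale_bound {d : ℤ → ℝ} {C ζ : ℝ} (hC : 0 < C)
    (hdζ : ∀ n : ℤ, n ≠ 0 → C * |(n : ℝ)| ^ (-ζ) ≤ d n) {L : ℝ} (hL : 0 ≤ L) :
    ∃ D, 1 ≤ D ∧ ∀ n : ℤ, L / d n ≤ D * (1 + |(n : ℝ)|) ^ max ζ 0 := by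
  refine ⟨max 1 (max (L / d 0) (L / C)), le_max_left _ _, fun n => ?_⟩
  rcases eq_or_ne n 0 with rfl | hn
  · simp
  have hn1 : (1 : ℝ) ≤ |(n : ℝ)| := by exact_mod_cast Int.one_le_abs hn
  have hn0 : (0 : ℝ) < |(n : ℝ)| := by linarith
  have h1 : |(n : ℝ)| ^ ζ ≤ (1 + |(n : ℝ)|) ^ max ζ 0 :=
    (Real.rpow_le_rpow_of_exponent_le hn1 (le_max_left _ _)).trans
      (Real.rpow_le_rpow hn0.le (by linarith) (le_max_right _ _))
  calc L / d n ≤ L / (C * |(n : ℝ)| ^ (-ζ)) := by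
        have := Real.rpow_pos_of_pos hn0 (-ζ)
        exact div_le_div_of_nonneg_left hL (by positivity) (hdζ n hn)
    _ = L / C * |(n : ℝ)| ^ ζ := by
        rw [Real.rpow_neg hn0.le]
        have := (Real.rpow_pos_of_pos hn0 ζ).ne'
        field_simp
    _ ≤ _ := mul_le_mul ((le_max_right _ _).trans (le_max_right _ _)) h1
        (by positivity) (by positivity)

end RandomJacobi

end

/-! ### Assembly of the main theorem. -/

open RandomJacobi in
theorem theorem2p2 (r : ℝ → ℝ) (hr : IsSingleSiteDensity r)
    (a c : LInftyZ) (δ : ℝ) (hδ : 0 < δ) (ha : ∀ n : ℤ, δ ≤ a n)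
    (d : ℤ → ℝ) (hd : ∀ n : ℤ, 0 ≤ d n ∧ d n ≤ 1) (hd0 : 0 < d 0)
    (C ζ : ℝ) (hC : 0 < C) (hζ : ζ < 1 / 2)
    (hdζ : ∀ n : ℤ, n ≠ 0 → C * |(n : ℝ)| ^ (-ζ) ≤ d n) :
    ∀ᵐ ω ∂potentialLaw r d c,
      ω ∈ configurations r d c ∧
        ∃ hω : Memℓp ω ∞, HasPurePointSpectrum (jacobi a (⟨ω, hω⟩ : LInftyZ)) := by
  have hdpos (n : ℤ) : 0 < d n := by
    rcases eq_or_ne n 0 with rfl | hn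
    · exact hd0
    · have : (0 : ℝ) < |(n : ℝ)| := abs_pos.2 (Int.cast_ne_zero.2 hn)
      exact (mul_pos hC (Real.rpow_pos_of_pos this _)).trans_le (hdζ n hn)
  have hprob := isProbabilityMeasure_siteLaw hr hdpos c
  obtain ⟨L, hL⟩ := hr.bounded
  have hL0 : 0 ≤ L := (hr.nonneg 0).trans (hL 0)
  obtain ⟨R, hR⟩ : ∃ R, ∀ x, r x ≠ 0 → |x| ≤ R := by
    obtain ⟨R, hR⟩ := hr.hasCompactSupport.isCompact.isBounded.exists_norm_le
    exact ⟨R, fun x hx => hR x (subset_tsupport _ hx)⟩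
  obtain ⟨D, hD1, hD⟩ := exists_scale_bound hC hdζ hL0
  -- Scales are at most one, so rescaling does not enlarge the support radius `R`; `B` bounds the
  -- potential at every site, uniformly.
  set B := ‖c‖ + max R 0 with hB
  have hB0 : 0 ≤ B := by positivity
  have hA : 0 < ‖a‖ := hδ.trans_le
    ((ha 0).trans ((le_abs_self _).trans (lp.norm_apply_le_norm ENNReal.top_ne_zero a 0)))
  have hbox (n : ℤ) {x : ℝ} (hx : scaledDensity r d n (x - c n) ≠ 0) : |x| ≤ B := by
    have h1 := abs_le_of_scaledDensity_ne_zero hR (hdpos n) (hd n).2 hx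
    have h2 : |c n| ≤ ‖c‖ := lp.norm_apply_le_norm ENNReal.top_ne_zero c n
    have h3 := abs_sub_abs_le_abs_sub x (c n)
    linarith [le_max_left R 0]
  have hsupp (n : ℤ) : siteLaw r d c n (Set.Icc (-B) B)ᶜ = 0 := by
    filter_upwards [ae_siteLaw_ne_zero hr.measurable d c n] with x hx
    exact abs_le.1 (hbox n hx)
  have hcorr (m σ : ℤ) : ∀ᵐ ω ∂potentialLaw r d c, σ = 1 ∨ σ = -1 →
      ∑' n : ℕ, correlator a (2 * ‖a‖ + B) m (raySite m σ (n + 1)) ω ≠ ∞ := by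
    by_cases hσ : σ = 1 ∨ σ = -1
    · filter_upwards [ae_tsum_correlator_ne_top hA hB0 hD1 (le_max_right ζ 0)
        (max_lt hζ one_half_pos) hsupp (fun n => (siteLaw_le hL (hdpos n) c).trans
          (Measure.le_intro fun s _ _ => mul_le_mul' (ENNReal.ofReal_le_ofReal (hD n)) le_rfl))
        (fun n => hδ.trans_le (ha n)) (fun n => (le_abs_self _).trans
          (lp.norm_apply_le_norm ENNReal.top_ne_zero a n)) m hσ] with ω hω _ using hω
    · exact Filter.Eventually.of_forall fun ω h => absurd h hσ
  -- Almost surely the density is nonzero at the sampled value of every site. This gives both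
  -- membership in the product of intervals and the bound `B`, hence `‖J_ω‖ ≤ 2 * ‖a‖ + B`, the
  -- interval used for the correlator.
  filter_upwards [ae_potentialLaw_forall (ae_siteLaw_ne_zero hr.measurable d c),
    ae_all_iff.2 fun m => ae_all_iff.2 fun σ => hcorr m σ] with ω hω hsum
  have hbound (n : ℤ) : ‖ω n‖ ≤ B := hbox n (hω n)
  have hmem : Memℓp ω ∞ := memℓp_infty ⟨B, by rintro _ ⟨n, rfl⟩; exact hbound n⟩
  refine ⟨fun n _ => ?_, hmem, ?_⟩
  · have h1 := abs_le.1 (abs_le_siteRadius hR (hdpos n) (hd n).2 (hω n))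
    exact ⟨by linarith [h1.1], by linarith [h1.2]⟩
  · refine hasPurePointSpectrum_jacobi_of_correlator a ⟨ω, hmem⟩ ?_ hsum
    refine (norm_jacobi_le _ _).trans (add_le_add_right ?_ _)
    exact lp.norm_le_of_forall_le hB0 hbound
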